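/- Let $(M,g)$ be a complete connected Riemannian manifold without boundary, $\varphi:M\to\mathbb R$ smooth, $p>1$, $q>0$ and $\delta=q(p-1)-1$. Write $d\mu=e^{-\varphi}\,dV_g$, and $u^q:=|u|^{q-1}u$, $u^{q+1}:=|u|^{q+1}$ for sign-changing $u$. For $r\ge 1$ let $W^{1,r}_\varphi(M)$ be the space of $v\in L^r(M,\mu)$ with weak gradient $\nabla v\in L^r(M,\mu)$, and let $W^{1,r}_{0;\varphi}(M)$ be the closure of $C_c^\infty(M)$ in it. Let $u$ be an ancient solution of $$\partial_t u=e^{\varphi}\operatorname{div}\bigl(e^{-\varphi}|\nabla u^q|^{p-2}\nabla u^q\bigr)\quad\text{on } M\times(-\infty,0),$$ that is, $t\mapsto u(\cdot,t)\in L^{q+1}(M,\mu)$ is differentiable on $(-\infty,0)$ with derivative $u_t$, and for every $t<0$ the function $u^q(\cdot,t)$ has a weak gradient with $|\nabla u^q|^{p-1}$ locally integrable and $$\int_M u_t\,\psi\,d\mu=-\int_M|\nabla u^q|^{p-2}\langle\nabla u^q,\nabla\psi\rangle\,d\mu\qquad\text{for all }\psi\in C_c^\infty(M).$$ Suppose that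 for each $t<0$ $$u,\;u_t\in W^{1,q+1}_{0;\varphi}(M),\qquad |\nabla u^q|\in L^p(M,\mu),$$ and put $$I(t)=\int_M u^{q+1}\,d\mu,\qquad D(t)=-\int_M|\nabla u^q|^p\,d\mu,\qquad N(t)=\frac{D(t)}{I(t)}$$ (with $N(t)=0$ when $I(t)=0$). (i) If $\delta>0$ and $0<I(t)<\infty$ for all $t<0$, then $u$ is constant. (ii) If $\delta=0$ and there are $C,d>0$ such that $I(t)\le C(1+|t|)^d$ for all $t<0$, then $N(t)=0$ for all $t<0$ and $u$ is constant. Here "$u$ is constant" means that there is $c\in\mathbb R$ such that for every $t<0$, $u(\cdot,t)=c$ almost everywhere on $M$ (functions being identified when they agree almost everywhere). -/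

import Mathlib

open MeasureTheory Filter Bundle
open scoped Manifold Topology ENNReal ContDiff

noncomputable section

namespace DNE

/-- The coordinate vector field of a chart `e` in the direction `w`, at the point with
coordinates `y`: the image of `w` under the differential of the inverse chart. -/
def coordVec {n : ℕ} {M : Type*} [TopologicalSpace M]
    [ChartedSpace (EuclideanSpace ℝ (Fin n)) M]
    (e : OpenPartialHomeomorph M (EuclideanSpace ℝ (Fin n)))
    (y w : EuclideanSpace ℝ (Fin n)) : TangentSpace (𝓡 n) (e.symm y) :=
  mfderiv (𝓡 n) (𝓡 n) e.symm y w

/-- The matrix `g_ij` of the Riemannian metric in the chart `e`. -/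
def gramMatrix {n : ℕ} {M : Type*} [TopologicalSpace M]
    [ChartedSpace (EuclideanSpace ℝ (Fin n)) M]
    [RiemannianBundle (fun x : M => TangentSpace (𝓡 n) x)]
    (e : OpenPartialHomeomorph M (EuclideanSpace ℝ (Fin n)))
    (y : EuclideanSpace ℝ (Fin n)) : Matrix (Fin n) (Fin n) ℝ :=
  Matrix.of fun i j => inner ℝ (coordVec e y (EuclideanSpace.single i 1))
    (coordVec e y (EuclideanSpace.single j 1))

/-- The Riemannian volume of the domain of the chart `e`, extended by zero:
the measure `√(det g_ij) dy` on the target of `e`, transported to `M`. -/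
def chartVolume {n : ℕ} {M : Type*} [TopologicalSpace M]
    [ChartedSpace (EuclideanSpace ℝ (Fin n)) M]
    [RiemannianBundle (fun x : M => TangentSpace (𝓡 n) x)] [MeasurableSpace M]
    (e : OpenPartialHomeomorph M (EuclideanSpace ℝ (Fin n))) : Measure M :=
  ((volume.restrict e.target).withDensity
    fun y => ENNReal.ofReal (Real.sqrt (gramMatrix e y).det)).map e.symm

/-- The Riemannian volume measure `dV_g`. The measures `chartVolume e` coincide on the overlaps of
the charts (change of variables), so their least upper bound is the one Borel measure on `M` which
in every chart is given by `√(det g_ij) dy`. -/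
def riemannianVolume (n : ℕ) (M : Type*) [TopologicalSpace M]
    [ChartedSpace (EuclideanSpace ℝ (Fin n)) M]
    [RiemannianBundle (fun x : M => TangentSpace (𝓡 n) x)] [MeasurableSpace M] : Measure M :=
  ⨆ e ∈ atlas (EuclideanSpace ℝ (Fin n)) M, chartVolume e

/-- The weighted measure `e^{-φ} dV_g`. -/
def weightedVolume (n : ℕ) {M : Type*} [TopologicalSpace M]
    [ChartedSpace (EuclideanSpace ℝ (Fin n)) M]
    [RiemannianBundle (fun x : M => TangentSpace (𝓡 n) x)] [MeasurableSpace M]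
    (φ : M → ℝ) : Measure M :=
  (riemannianVolume n M).withDensity fun x => ENNReal.ofReal (Real.exp (-φ x))

/-- The vector field `G` is a weak gradient of `f`: in every chart, `f` and the components
`⟨G, ∂_w⟩` are locally integrable, and `⟨G, ∂_w⟩` is the weak derivative of `f` in the
direction `w`, for every `w`. -/
def HasWeakGrad {n : ℕ} {M : Type*} [TopologicalSpace M]
    [ChartedSpace (EuclideanSpace ℝ (Fin n)) M]
    [RiemannianBundle (fun x : M => TangentSpace (𝓡 n) x)]
    (f : M → ℝ) (G : (x : M) → TangentSpace (𝓡 n) x) : Prop :=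
  ∀ e ∈ atlas (EuclideanSpace ℝ (Fin n)) M,
    LocallyIntegrableOn (fun y => f (e.symm y)) e.target ∧
    ∀ w : EuclideanSpace ℝ (Fin n),
      LocallyIntegrableOn (fun y => inner ℝ (G (e.symm y)) (coordVec e y w)) e.target ∧
      ∀ θ : EuclideanSpace ℝ (Fin n) → ℝ, ContDiff ℝ ∞ θ → HasCompactSupport θ →
        tsupport θ ⊆ e.target →
        ∫ y, f (e.symm y) * fderiv ℝ θ y w =
          -∫ y, inner ℝ (G (e.symm y)) (coordVec e y w) * θ y

/-- `∇f` exists in the weak sense. -/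
def WeaklyDifferentiable (n : ℕ) {M : Type*} [TopologicalSpace M]
    [ChartedSpace (EuclideanSpace ℝ (Fin n)) M]
    [RiemannianBundle (fun x : M => TangentSpace (𝓡 n) x)] (f : M → ℝ) : Prop :=
  ∃ G : (x : M) → TangentSpace (𝓡 n) x, HasWeakGrad f G

open Classical in
/-- The weak gradient `∇f` (unique up to null sets; zero if `f` has no weak gradient). -/
def weakGrad (n : ℕ) {M : Type*} [TopologicalSpace M]
    [ChartedSpace (EuclideanSpace ℝ (Fin n)) M]
    [RiemannianBundle (fun x : M => TangentSpace (𝓡 n) x)] (f : M → ℝ) :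
    (x : M) → TangentSpace (𝓡 n) x :=
  if h : WeaklyDifferentiable n f then Classical.choose h else fun _ => 0

/-- The function `|∇f|`. -/
def normGrad (n : ℕ) {M : Type*} [TopologicalSpace M]
    [ChartedSpace (EuclideanSpace ℝ (Fin n)) M]
    [RiemannianBundle (fun x : M => TangentSpace (𝓡 n) x)] (f : M → ℝ) (x : M) : ℝ :=
  ‖weakGrad n f x‖

/-- `ψ ∈ C_c^∞(M)`. -/
def IsTestFunction (n : ℕ) {M : Type*} [TopologicalSpace M]
    [ChartedSpace (EuclideanSpace ℝ (Fin n)) M] (ψ : M → ℝ) : Prop :=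
  ContMDiff (𝓡 n) 𝓘(ℝ, ℝ) ∞ ψ ∧ HasCompactSupport ψ

/-- Membership in the weighted Sobolev space `W^{1,r}_φ(M)`. -/
def MemW1 (n : ℕ) {M : Type*} [TopologicalSpace M]
    [ChartedSpace (EuclideanSpace ℝ (Fin n)) M]
    [RiemannianBundle (fun x : M => TangentSpace (𝓡 n) x)] [MeasurableSpace M]
    (φ : M → ℝ) (r : ℝ) (f : M → ℝ) : Prop :=
  MemLp f (ENNReal.ofReal r) (weightedVolume n φ) ∧
  WeaklyDifferentiable n f ∧
  MemLp (normGrad n f) (ENNReal.ofReal r) (weightedVolume n φ)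

/-- The norm of `W^{1,r}_φ(M)`. -/
def sobolevNorm (n : ℕ) {M : Type*} [TopologicalSpace M]
    [ChartedSpace (EuclideanSpace ℝ (Fin n)) M]
    [RiemannianBundle (fun x : M => TangentSpace (𝓡 n) x)] [MeasurableSpace M]
    (φ : M → ℝ) (r : ℝ) (f : M → ℝ) : ℝ≥0∞ :=
  ((∫⁻ x, ENNReal.ofReal (|f x| ^ r) ∂(weightedVolume n φ)) +
    ∫⁻ x, ENNReal.ofReal (normGrad n f x ^ r) ∂(weightedVolume n φ)) ^ (1 / r)

/-- Membership in `W^{1,r}_{0;φ}(M)`, the closure of `C_c^∞(M)` in `W^{1,r}_φ(M)`. -/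
def MemW10 (n : ℕ) {M : Type*} [TopologicalSpace M]
    [ChartedSpace (EuclideanSpace ℝ (Fin n)) M]
    [RiemannianBundle (fun x : M => TangentSpace (𝓡 n) x)] [MeasurableSpace M]
    (φ : M → ℝ) (r : ℝ) (f : M → ℝ) : Prop :=
  MemW1 n φ r f ∧
  ∃ θ : ℕ → M → ℝ, (∀ k, IsTestFunction n (θ k)) ∧
    Tendsto (fun k => sobolevNorm n φ r (fun x => f x - θ k x)) atTop (𝓝 0)

/-- The signed power `a^q = |a|^{q-1} a`. -/
def spow (q a : ℝ) : ℝ := |a| ^ (q - 1) * a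

/-- On the time set `J`, the curve `t ↦ u(·,t)` in `L^{q+1}_φ(M)` is differentiable, with
derivative `t ↦ ut(·,t)`. -/
def IsTimeDerivOn (n : ℕ) {M : Type*} [TopologicalSpace M]
    [ChartedSpace (EuclideanSpace ℝ (Fin n)) M]
    [RiemannianBundle (fun x : M => TangentSpace (𝓡 n) x)] [MeasurableSpace M]
    (φ : M → ℝ) (q : ℝ) (J : Set ℝ) (u ut : ℝ → M → ℝ) : Prop :=
  ∀ t ∈ J,
    MemLp (u t) (ENNReal.ofReal (q + 1)) (weightedVolume n φ) ∧
    MemLp (ut t) (ENNReal.ofReal (q + 1)) (weightedVolume n φ) ∧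
    Tendsto
      (fun s => eLpNorm (fun x => (u s x - u t x) / (s - t) - ut t x)
        (ENNReal.ofReal (q + 1)) (weightedVolume n φ))
      (𝓝[J \ {t}] t) (𝓝 0)

/-- The derivative `dψ(v)` of `ψ` in the direction of a tangent vector `v` at `x`, that is,
`⟨∇ψ, v⟩`. -/
def dirDeriv {n : ℕ} {M : Type*} [TopologicalSpace M]
    [ChartedSpace (EuclideanSpace ℝ (Fin n)) M]
    (ψ : M → ℝ) (x : M) (v : TangentSpace (𝓡 n) x) : ℝ :=
  mfderiv (𝓡 n) 𝓘(ℝ, ℝ) ψ x v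

/-- `u` solves `∂_t u = e^φ div(e^{-φ} |∇u^q|^{p-2} ∇u^q)` on `M × J`, with time derivative `ut`:
at each time the equation holds in the weak sense, tested with functions in `C_c^∞(M)`. -/
def IsSolutionOn (n : ℕ) {M : Type*} [TopologicalSpace M]
    [ChartedSpace (EuclideanSpace ℝ (Fin n)) M]
    [RiemannianBundle (fun x : M => TangentSpace (𝓡 n) x)] [MeasurableSpace M]
    (φ : M → ℝ) (p q : ℝ) (J : Set ℝ) (u ut : ℝ → M → ℝ) : Prop :=
  IsTimeDerivOn n φ q J u ut ∧
  ∀ t ∈ J,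
    WeaklyDifferentiable n (fun x => spow q (u t x)) ∧
    LocallyIntegrable (fun x => normGrad n (fun z => spow q (u t z)) x ^ (p - 1))
      (weightedVolume n φ) ∧
    ∀ ψ : M → ℝ, IsTestFunction n ψ →
      ∫ x, ut t x * ψ x ∂(weightedVolume n φ) =
        -∫ x, normGrad n (fun z => spow q (u t z)) x ^ (p - 2) *
          dirDeriv ψ x (weakGrad n (fun z => spow q (u t z)) x)
          ∂(weightedVolume n φ)

/-- An ancient solution: a solution on `M × (-∞, 0)`. -/
def IsAncientSolution (n : ℕ) {M : Type*} [TopologicalSpace M]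
    [ChartedSpace (EuclideanSpace ℝ (Fin n)) M]
    [RiemannianBundle (fun x : M => TangentSpace (𝓡 n) x)] [MeasurableSpace M]
    (φ : M → ℝ) (p q : ℝ) (u ut : ℝ → M → ℝ) : Prop :=
  IsSolutionOn n φ p q (Set.Iio 0) u ut

/-- The standing assumption: for each time `t ∈ J`, `u, u_t ∈ W^{1,q+1}_{0;φ}(M)` and
`∇u^q ∈ L^p_φ(M)`. -/
def StandingAssumption (n : ℕ) {M : Type*} [TopologicalSpace M]
    [ChartedSpace (EuclideanSpace ℝ (Fin n)) M]
    [RiemannianBundle (fun x : M => TangentSpace (𝓡 n) x)] [MeasurableSpace M]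
    (φ : M → ℝ) (p q : ℝ) (J : Set ℝ) (u ut : ℝ → M → ℝ) : Prop :=
  ∀ t ∈ J,
    MemW10 n φ (q + 1) (u t) ∧ MemW10 n φ (q + 1) (ut t) ∧
    WeaklyDifferentiable n (fun x => spow q (u t x)) ∧
    MemLp (normGrad n fun x => spow q (u t x)) (ENNReal.ofReal p) (weightedVolume n φ)

/-- `I(t) = ∫ |u|^{q+1} e^{-φ} dV_g`. -/
def energyI (n : ℕ) {M : Type*} [TopologicalSpace M]
    [ChartedSpace (EuclideanSpace ℝ (Fin n)) M]
    [RiemannianBundle (fun x : M => TangentSpace (𝓡 n) x)] [MeasurableSpace M]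
    (φ : M → ℝ) (q : ℝ) (u : ℝ → M → ℝ) (t : ℝ) : ℝ :=
  ∫ x, |u t x| ^ (q + 1) ∂(weightedVolume n φ)

/-- `D(t) = -∫ |∇u^q|^p e^{-φ} dV_g`. -/
def energyD (n : ℕ) {M : Type*} [TopologicalSpace M]
    [ChartedSpace (EuclideanSpace ℝ (Fin n)) M]
    [RiemannianBundle (fun x : M => TangentSpace (𝓡 n) x)] [MeasurableSpace M]
    (φ : M → ℝ) (p q : ℝ) (u : ℝ → M → ℝ) (t : ℝ) : ℝ :=
  -∫ x, normGrad n (fun z => spow q (u t z)) x ^ p ∂(weightedVolume n φ)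

/-- The parabolic frequency `N(t) = D(t) / I(t)`. -/
def frequency (n : ℕ) {M : Type*} [TopologicalSpace M]
    [ChartedSpace (EuclideanSpace ℝ (Fin n)) M]
    [RiemannianBundle (fun x : M => TangentSpace (𝓡 n) x)] [MeasurableSpace M]
    (φ : M → ℝ) (p q : ℝ) (u : ℝ → M → ℝ) (t : ℝ) : ℝ :=
  energyD n φ p q u t / energyI n φ q u t

/-- `u` is constant on `M × (-∞, 0)`; as an element of an `L^r` space, `u(·,t)` is a function
up to null sets. -/
def IsConstant (n : ℕ) {M : Type*} [TopologicalSpace M]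
    [ChartedSpace (EuclideanSpace ℝ (Fin n)) M]
    [RiemannianBundle (fun x : M => TangentSpace (𝓡 n) x)] [MeasurableSpace M]
    (φ : M → ℝ) (u : ℝ → M → ℝ) : Prop :=
  ∃ c : ℝ, ∀ t < 0, ∀ᵐ x ∂(weightedVolume n φ), u t x = c

end DNE

end

open MeasureTheory Filter Bundle
open scoped Manifold Topology ENNReal ContDiff

noncomputable section

namespace DNE

/-! ### Scalar differential inequalities for the norm and the dissipation. -/

theorem monotoneOn_Iio_of_hasDerivAt_nonneg {f f' : ℝ → ℝ} {a : ℝ}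
    (hf : ∀ t < a, HasDerivAt f (f' t) t) (h : ∀ t < a, 0 ≤ f' t) :
    MonotoneOn f (Set.Iio a) := by
  apply monotoneOn_of_deriv_nonneg (convex_Iio a)
  · exact fun t ht => (hf t ht).continuousAt.continuousWithinAt
  · rw [interior_Iio]
    exact fun t ht => (hf t ht).differentiableAt.differentiableWithinAt
  · rw [interior_Iio]
    intro t ht
    rw [(hf t ht).deriv]
    exact h t ht

theorem antitoneOn_Iio_of_hasDerivAt_nonpos {f f' : ℝ → ℝ} {a : ℝ}
    (hf : ∀ t < a, HasDerivAt f (f' t) t) (h : ∀ t < a, f' t ≤ 0) :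
    AntitoneOn f (Set.Iio a) := by
  have := monotoneOn_Iio_of_hasDerivAt_nonneg (f := fun t => -f t) (f' := fun t => -f' t)
    (fun t ht => (hf t ht).neg) (fun t ht => by linarith [h t ht])
  intro x hx y hy hxy
  have := this hx hy hxy
  simpa using this

theorem exists_hasDerivAt_antideriv {g : ℝ → ℝ} {a : ℝ} (hg : ContinuousOn g (Set.Iio a)) :
    ∃ τ : ℝ → ℝ, ∀ t < a, HasDerivAt τ (g t) t := by
  refine ⟨fun s => ∫ x in (a - 1)..s, g x, fun t ht => ?_⟩
  have hsub : Set.uIcc (a - 1) t ⊆ Set.Iio a := by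
    intro x hx
    rcases Set.mem_uIcc.1 hx with h | h
    · exact lt_of_le_of_lt h.2 ht
    · exact lt_of_le_of_lt h.2 (by linarith)
  refine intervalIntegral.integral_hasDerivAt_right ((hg.mono hsub).intervalIntegrable) ?_
    (hg.continuousAt (Iio_mem_nhds ht))
  exact hg.stronglyMeasurableAtFilter isOpen_Iio t ht

/-- The slope inequality for `N` as a function of `τ`, `τ' = N ^ (p q - q)`. -/
theorem slope_inequality {p q a : ℝ} (hp : 1 < p) (hq : 0 < q) {N F τ : ℝ → ℝ}
    {W W' : ℝ → ℝ → ℝ} (hN : ∀ t < a, 0 < N t) (hF : ∀ t < a, 0 ≤ F t)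
    (hNd : ∀ t < a, HasDerivAt N (-(F t / N t ^ q)) t)
    (hτ : ∀ t < a, HasDerivAt τ (N t ^ (p * q - q)) t)
    (hW : ∀ s < a, ∀ t < a, HasDerivAt (W s) (W' s t) t)
    (hW' : ∀ s < a, ∀ t < a, -W' s t ≤ F t ^ (1 - 1 / p) * F s ^ (1 / p))
    (hWs : ∀ s < a, W s s = N s ^ (q + 1))
    (hWt : ∀ s < a, ∀ t < a, W s t ≤ N t * N s ^ q) {s t : ℝ} (hst : s ≤ t) (hta : t < a) :
    N s - N t ≤ F s / N s ^ (p * q) * (τ t - τ s) := by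
  have hsa : s < a := lt_of_le_of_lt hst hta
  have hp0 : 0 < p := by linarith
  -- The quotient that makes `-ρ` the derivative of `N` with respect to `τ`.
  set ρ : ℝ → ℝ := fun t => F t / N t ^ (p * q) with hρ
  have hρ0 : ∀ t < a, 0 ≤ ρ t := fun t ht => div_nonneg (hF t ht) (Real.rpow_nonneg (hN t ht).le _)
  have hFρ : ∀ t < a, F t = ρ t * N t ^ (p * q) := fun t ht => by
    simp only [hρ]
    rw [div_mul_cancel₀]
    exact (Real.rpow_pos_of_pos (hN t ht) _).ne'
  -- After Young's inequality the lower bound for `W'` is the exact derivative of `N s ^ q * ((1 -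
  -- 1/p) * N - ρ s / p * τ)`, so the difference is monotone.
  have key : MonotoneOn (fun x => W s x - N s ^ q * ((1 - 1 / p) * N x - ρ s / p * τ x))
      (Set.Iio a) := by
    refine monotoneOn_Iio_of_hasDerivAt_nonneg
      (f' := fun x => W' s x - N s ^ q * ((1 - 1 / p) * (-(F x / N x ^ q))
        - ρ s / p * N x ^ (p * q - q))) (fun x hx => ?_) (fun x hx => ?_)
    · exact (hW s hsa x hx).sub ((((hNd x hx).const_mul _).sub ((hτ x hx).const_mul _)).const_mul _)
    · have h1 := hW' s hsa x hx
      have hNx := hN x hx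
      have hNs := hN s hsa
      have e1 : F x ^ (1 - 1 / p) = ρ x ^ (1 - 1 / p) * N x ^ (p * q - q) := by
        rw [hFρ x hx, Real.mul_rpow (hρ0 x hx) (Real.rpow_nonneg hNx.le _),
          ← Real.rpow_mul hNx.le]
        congr 2
        field_simp
      have e2 : F s ^ (1 / p) = ρ s ^ (1 / p) * N s ^ q := by
        rw [hFρ s hsa, Real.mul_rpow (hρ0 s hsa) (Real.rpow_nonneg hNs.le _),
          ← Real.rpow_mul hNs.le]
        congr 2
        field_simp
      have e3 : F x / N x ^ q = ρ x * N x ^ (p * q - q) := by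
        rw [hFρ x hx, Real.rpow_sub hNx]
        ring
      -- Young for `ρ x ^ (1 - 1/p) * ρ s ^ (1/p)`. The powers of `N` have been factored out first,
      -- which is why `ρ` and not `F` is averaged.
      have hy := Real.geom_mean_le_arith_mean2_weighted (w₁ := 1 - 1 / p) (w₂ := 1 / p)
        (by rw [sub_nonneg, div_le_one hp0]; exact hp.le) (by positivity) (hρ0 x hx) (hρ0 s hsa)
        (by ring)
      rw [e1, e2] at h1
      rw [e3]
      have hA : 0 ≤ N x ^ (p * q - q) * N s ^ q := by positivity
      have h2 := mul_le_mul_of_nonneg_left hy hA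
      have h3 : N s ^ q * ((1 - 1 / p) * (-(ρ x * N x ^ (p * q - q))) - ρ s / p * N x ^ (p * q - q))
        = -(N x ^ (p * q - q) * N s ^ q * ((1 - 1 / p) * ρ x + 1 / p * ρ s)) := by ring
      rw [h3]
      nlinarith [h1, h2]
  have h := key (Set.mem_Iio.2 hsa) (Set.mem_Iio.2 hta) hst
  simp only at h
  rw [hWs s hsa] at h
  have h2 := hWt s hsa t hta
  have hNs := hN s hsa
  have hpos : 0 < N s ^ q := Real.rpow_pos_of_pos hNs _
  have e4 : N s ^ (q + 1) = N s ^ q * N s := by rw [Real.rpow_add hNs, Real.rpow_one]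
  rw [e4] at h
  -- Only the fraction `1/p` of `N s - N t` survives, against the fraction `1/p` of the slope term;
  -- multiplying by `p` below restores both.
  have h3 : N s ^ q * (N s - (1 - 1 / p) * N s + ρ s / p * τ s) ≤
      N s ^ q * (N t - (1 - 1 / p) * N t + ρ s / p * τ t) := by
    nlinarith [h, h2]
  have h4 := le_of_mul_le_mul_left h3 hpos
  have h5 : p * (N s - (1 - 1 / p) * N s + ρ s / p * τ s) ≤
      p * (N t - (1 - 1 / p) * N t + ρ s / p * τ t) := mul_le_mul_of_nonneg_left h4 hp0.le
  have e5 : ∀ x y : ℝ, p * (x - (1 - 1 / p) * x + ρ s / p * y) = x + ρ s * y := by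
    intro x y
    field_simp
    ring
  rw [e5, e5] at h5
  change N s - N t ≤ ρ s * (τ t - τ s)
  linarith

/-- The slope inequality is the statement that the secant slope `(N s - N t₀) / (τ t₀ - τ s)` has
nonpositive derivative in `s`. Hence for `s ≤ s₀` it is at least its value at `s₀`, which is
positive because `N t₀ < N s₀`; and the tangent slope `F s / N s ^ (p * q)` dominates the secant
slope. -/
theorem exists_decay_rate {p q a : ℝ} (hp : 1 < p) (hq : 0 < q) {N F : ℝ → ℝ}
    {W W' : ℝ → ℝ → ℝ} (hN : ∀ t < a, 0 < N t) (hF : ∀ t < a, 0 ≤ F t)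
    (hNd : ∀ t < a, HasDerivAt N (-(F t / N t ^ q)) t)
    (hW : ∀ s < a, ∀ t < a, HasDerivAt (W s) (W' s t) t)
    (hW' : ∀ s < a, ∀ t < a, -W' s t ≤ F t ^ (1 - 1 / p) * F s ^ (1 / p))
    (hWs : ∀ s < a, W s s = N s ^ (q + 1))
    (hWt : ∀ s < a, ∀ t < a, W s t ≤ N t * N s ^ q) {s₀ t₀ : ℝ} (hst : s₀ < t₀) (hta : t₀ < a)
    (hlt : N t₀ < N s₀) :
    ∃ c > 0, ∀ s ≤ s₀, c * N s ^ (p * q - q) ≤ F s / N s ^ q := by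
  obtain ⟨τ, hτ⟩ := exists_hasDerivAt_antideriv (g := fun t => N t ^ (p * q - q)) (a := a)
    (fun t ht => ((hNd t ht).continuousAt.rpow_const (Or.inl (hN t ht).ne')).continuousWithinAt)
  have slope := fun s (hs : s < t₀) =>
    slope_inequality hp hq hN hF hNd hτ hW hW' hWs hWt hs.le hta
  have hτpos : ∀ s < t₀, 0 < τ t₀ - τ s := by
    intro s hs
    have : StrictMonoOn τ (Set.Iio a) := by
      refine strictMonoOn_of_deriv_pos (convex_Iio a)
        (fun t ht => (hτ t ht).continuousAt.continuousWithinAt) ?_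
      rw [interior_Iio]
      intro t ht
      rw [(hτ t ht).deriv]
      exact Real.rpow_pos_of_pos (hN t ht) _
    linarith [this (Set.mem_Iio.2 (hs.trans hta)) (Set.mem_Iio.2 hta) hs]
  have anti : AntitoneOn (fun s => (N s - N t₀) / (τ t₀ - τ s)) (Set.Iio t₀) := by
    refine antitoneOn_Iio_of_hasDerivAt_nonpos (f' := fun s =>
      (-(F s / N s ^ q) * (τ t₀ - τ s) - (N s - N t₀) * (-(N s ^ (p * q - q)))) /
        (τ t₀ - τ s) ^ 2) (fun s hs => ?_) (fun s hs => ?_)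
    · exact ((hNd s (hs.trans hta)).sub_const _).fun_div ((hτ s (hs.trans hta)).const_sub _)
        (hτpos s hs).ne'
    · refine div_nonpos_of_nonpos_of_nonneg ?_ (sq_nonneg _)
      have h1 := slope s hs
      have hNs := hN s (hs.trans hta)
      have e1 : F s / N s ^ q = F s / N s ^ (p * q) * N s ^ (p * q - q) := by
        have := (Real.rpow_pos_of_pos hNs (p * q)).ne'
        have := (Real.rpow_pos_of_pos hNs q).ne'
        rw [Real.rpow_sub hNs]
        field_simp
      rw [e1]
      have hA : 0 ≤ N s ^ (p * q - q) := by positivity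
      nlinarith [mul_le_mul_of_nonneg_left h1 hA]
  refine ⟨(N s₀ - N t₀) / (τ t₀ - τ s₀), div_pos (by linarith) (hτpos _ hst), fun s hs => ?_⟩
  have hs' : s < t₀ := lt_of_le_of_lt hs hst
  have h1 := anti (Set.mem_Iio.2 hs') (Set.mem_Iio.2 hst) hs
  simp only at h1
  have hNs := hN s (hs'.trans hta)
  have e1 : F s / N s ^ q = F s / N s ^ (p * q) * N s ^ (p * q - q) := by
    have := (Real.rpow_pos_of_pos hNs (p * q)).ne'
    have := (Real.rpow_pos_of_pos hNs q).ne'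
    rw [Real.rpow_sub hNs]
    field_simp
  rw [e1]
  refine mul_le_mul_of_nonneg_right (h1.trans ?_) (by positivity)
  rw [div_le_iff₀ (hτpos s hs')]
  exact slope s hs'

/-- Backwards in time, `-N' ≥ c N ^ κ` with `κ > 1` forces a blow-up. -/
theorem false_of_superlinear_decay {κ c s₀ : ℝ} (hκ : 1 < κ) (hc : 0 < c) {N N' : ℝ → ℝ}
    (hN : ∀ t < s₀, 0 < N t) (hNd : ∀ t < s₀, HasDerivAt N (-N' t) t)
    (h : ∀ t < s₀, c * N t ^ κ ≤ N' t) : False := by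
  -- The inequality says that `N ^ (1 - κ)` increases at rate at least `c * (κ - 1)`.
  have anti : AntitoneOn (fun t => c * (κ - 1) * t - N t ^ (1 - κ)) (Set.Iio s₀) := by
    refine antitoneOn_Iio_of_hasDerivAt_nonpos
      (f' := fun t => c * (κ - 1) * 1 - (-N' t) * (1 - κ) * N t ^ (1 - κ - 1))
      (fun t ht => ?_) (fun t ht => ?_)
    · exact ((hasDerivAt_id t).const_mul _).sub ((hNd t ht).rpow_const (Or.inl (hN t ht).ne'))
    · have h1 := h t ht
      have hNt := hN t ht
      have e : N t ^ κ * N t ^ (1 - κ - 1) = 1 := by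
        rw [← Real.rpow_add hNt]; ring_nf; exact Real.rpow_zero _
      have h2 : c ≤ N' t * N t ^ (1 - κ - 1) := by
        have := mul_le_mul_of_nonneg_right h1 (Real.rpow_nonneg hNt.le (1 - κ - 1))
        rwa [mul_assoc, e, mul_one] at this
      nlinarith [mul_le_mul_of_nonneg_left h2 (by linarith : 0 ≤ κ - 1)]
  set s₁ := s₀ - 1
  have hs₁ : s₁ < s₀ := by simp [s₁]
  have hP : 0 < N s₁ ^ (1 - κ) := Real.rpow_pos_of_pos (hN _ hs₁) _
  have hk : 0 < c * (κ - 1) := mul_pos hc (by linarith)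
  -- At this time the linear bound, followed backwards from `s₁`, forces `N ^ (1 - κ)` down to zero.
  set t := s₁ - N s₁ ^ (1 - κ) / (c * (κ - 1)) with ht
  have hts : t < s₁ := by
    have := div_pos hP hk
    linarith
  have h1 := anti (Set.mem_Iio.2 (hts.trans hs₁)) (Set.mem_Iio.2 hs₁) hts.le
  simp only at h1
  have h2 : 0 < N t ^ (1 - κ) := Real.rpow_pos_of_pos (hN _ (hts.trans hs₁)) _
  have h3 : c * (κ - 1) * t = c * (κ - 1) * s₁ - N s₁ ^ (1 - κ) := by
    rw [ht, mul_sub, mul_div_assoc', mul_div_cancel_left₀ _ hk.ne']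
  linarith

/-- Backwards in time, `-N' ≥ c N` contradicts polynomial growth. -/
theorem false_of_linear_decay {c s₀ C d : ℝ} (hc : 0 < c) {N N' : ℝ → ℝ}
    (hN : ∀ t < s₀, 0 < N t) (hNd : ∀ t < s₀, HasDerivAt N (-N' t) t)
    (h : ∀ t < s₀, c * N t ≤ N' t) (hC : 0 < C) (hpoly : ∀ t < s₀, N t ≤ C * (1 + |t|) ^ d) :
    False := by
  have anti : AntitoneOn (fun t => Real.exp (c * t) * N t) (Set.Iio s₀) := by
    refine antitoneOn_Iio_of_hasDerivAt_nonpos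
      (f' := fun t => Real.exp (c * t) * (c * 1) * N t + Real.exp (c * t) * (-N' t))
      (fun t ht => ?_) (fun t ht => ?_)
    · exact (((hasDerivAt_id t).const_mul c).exp).mul (hNd t ht)
    · nlinarith [mul_le_mul_of_nonneg_left (h t ht) (Real.exp_pos (c * t)).le]
  set s₁ := min (s₀ - 1) 0
  have hs₁ : s₁ < s₀ := by
    have : s₁ ≤ s₀ - 1 := min_le_left _ _
    linarith
  have hs₁0 : s₁ ≤ 0 := min_le_right _ _
  set m := Real.exp (c * s₁) * N s₁
  have hm : 0 < m := mul_pos (Real.exp_pos _) (hN _ hs₁)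
  -- With `x = 1 - t` and `t ≤ s₁ ≤ 0` one has `1 + |t| = x`, so both sides are functions of `x`
  -- alone.
  have key : ∀ x : ℝ, 1 - s₁ ≤ x → m * Real.exp (-c) * Real.exp (c * x) ≤ C * x ^ d := by
    intro x hx
    have ht : 1 - x ≤ s₁ := by linarith
    have h1 := anti (Set.mem_Iio.2 (ht.trans_lt hs₁)) (Set.mem_Iio.2 hs₁) ht
    have h2 := hpoly (1 - x) (ht.trans_lt hs₁)
    rw [abs_of_nonpos (ht.trans hs₁0), show 1 + -(1 - x) = x by ring] at h2
    have h3 : m ≤ Real.exp (c * (1 - x)) * (C * x ^ d) :=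
      h1.trans (mul_le_mul_of_nonneg_left h2 (Real.exp_pos _).le)
    have h4 := mul_le_mul_of_nonneg_right h3 (Real.exp_pos (-c + c * x)).le
    have e1 : Real.exp (c * (1 - x)) * (C * x ^ d) * Real.exp (-c + c * x) = C * x ^ d := by
      rw [show c * (1 - x) = -(-c + c * x) by ring, Real.exp_neg]
      field_simp
    rw [e1, Real.exp_add, ← mul_assoc] at h4
    exact h4
  -- The factor `2` in the constant makes `x ^ d` too small for `key` by a strict margin.
  have hlo := (isLittleO_rpow_exp_pos_mul_atTop d hc).def
    (show 0 < m * Real.exp (-c) / (2 * C) by positivity)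
  obtain ⟨x, hx1, hx2, hx3⟩ := (hlo.and ((eventually_ge_atTop (1 - s₁)).and
    (eventually_ge_atTop 1))).exists
  have h1 := key x hx2
  rw [Real.norm_of_nonneg (Real.rpow_nonneg (by linarith) _),
    Real.norm_of_nonneg (Real.exp_pos _).le, div_mul_eq_mul_div, le_div_iff₀ (by positivity)] at hx1
  have : 0 < m * Real.exp (-c) * Real.exp (c * x) := by positivity
  nlinarith

/-! ### Signed powers -/

theorem abs_spow {q : ℝ} (hq : 0 < q) (a : ℝ) : |spow q a| = |a| ^ q := by
  unfold spow
  rcases eq_or_ne a 0 with rfl | ha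
  · simp [Real.zero_rpow hq.ne']
  · rw [abs_mul, abs_of_nonneg (Real.rpow_nonneg (abs_nonneg a) _), Real.rpow_sub_one
      (abs_pos.2 ha).ne', div_mul_cancel₀ _ (abs_pos.2 ha).ne']

theorem spow_mul_self {q : ℝ} (hq : 0 < q) (a : ℝ) : a * spow q a = |a| ^ (q + 1) := by
  rcases eq_or_ne a 0 with rfl | ha
  · simp [Real.zero_rpow (by linarith : q + 1 ≠ 0)]
  · unfold spow
    have h := abs_pos.2 ha
    rw [show q + 1 = (q - 1) + 2 by ring, Real.rpow_add h]
    have : |a| ^ (2 : ℝ) = a * a := by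
      rw [show (2 : ℝ) = ((2 : ℕ) : ℝ) by norm_num, Real.rpow_natCast, sq_abs, sq]
    rw [this]; ring

theorem spow_of_nonneg {q : ℝ} (hq : 0 < q) {a : ℝ} (ha : 0 ≤ a) : spow q a = a ^ q := by
  rw [← abs_of_nonneg (a := spow q a), abs_spow hq, abs_of_nonneg ha]
  unfold spow
  positivity

theorem spow_neg (q a : ℝ) : spow q (-a) = -spow q a := by
  unfold spow
  rw [abs_neg]; ring

theorem strictMono_spow {q : ℝ} (hq : 0 < q) : StrictMono (spow q) := by
  have hpos : ∀ a b : ℝ, 0 ≤ a → a < b → spow q a < spow q b := fun a b ha hab => by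
    rw [spow_of_nonneg hq ha, spow_of_nonneg hq (ha.trans hab.le)]
    exact Real.rpow_lt_rpow ha hab hq
  have h0 : spow q 0 = 0 := by simp [spow]
  intro a b hab
  rcases le_or_gt 0 a with ha | ha
  · exact hpos a b ha hab
  · rcases le_or_gt b 0 with hb | hb
    · have := hpos (-b) (-a) (by linarith) (by linarith)
      rw [spow_neg, spow_neg] at this
      linarith
    · have h1 := hpos 0 (-a) le_rfl (by linarith)
      have h2 := hpos 0 b le_rfl hb
      rw [spow_neg] at h1
      linarith

theorem continuous_spow {q : ℝ} (hq : 0 < q) : Continuous (spow q) := by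
  have : spow q = fun a => (max a 0) ^ q - (max (-a) 0) ^ q := by
    ext a
    rcases le_total 0 a with ha | ha
    · rw [spow_of_nonneg hq ha, max_eq_left ha, max_eq_right (by linarith), Real.zero_rpow hq.ne',
        sub_zero]
    · rw [← neg_neg a, spow_neg, spow_of_nonneg hq (by linarith), neg_neg, max_eq_right ha,
        max_eq_left (by linarith), Real.zero_rpow hq.ne', zero_sub]
  rw [this]
  exact ((continuous_id.max continuous_const).rpow_const (fun _ => Or.inr hq.le)).sub
    ((continuous_neg.max continuous_const).rpow_const (fun _ => Or.inr hq.le))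

theorem spow_mul (q a b : ℝ) : spow q (a * b) = spow q a * spow q b := by
  unfold spow
  rw [abs_mul, Real.mul_rpow (abs_nonneg _) (abs_nonneg _)]; ring

theorem hasDerivAt_abs_rpow_add_one {q : ℝ} (hq : 0 < q) (a : ℝ) :
    HasDerivAt (fun x : ℝ => |x| ^ (q + 1)) ((q + 1) * spow q a) a := by
  have := hasDerivAt_abs_rpow a (p := q + 1) (by linarith)
  rwa [show q + 1 - 2 = q - 1 by ring, mul_assoc] at this

/-- Two-sided first order expansion of `|x| ^ (q + 1)`. -/
theorem abs_rpow_expansion {q : ℝ} (hq : 0 < q) (a b : ℝ) :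
    |(|b| ^ (q + 1) - |a| ^ (q + 1) - (q + 1) * (spow q a * (b - a)))| ≤
      (q + 1) * (|spow q b - spow q a| * |b - a|) := by
  have mvt : ∃ c ∈ Set.uIcc a b, |b| ^ (q + 1) - |a| ^ (q + 1) = (q + 1) * spow q c * (b - a) := by
    rcases lt_trichotomy a b with h | h | h
    · obtain ⟨c, hc, h'⟩ := exists_hasDerivAt_eq_slope (fun x : ℝ => |x| ^ (q + 1))
        (fun x => (q + 1) * spow q x) h
        (fun x _ => (hasDerivAt_abs_rpow_add_one hq x).continuousAt.continuousWithinAt)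
        (fun x _ => hasDerivAt_abs_rpow_add_one hq x)
      refine ⟨c, Set.mem_uIcc.2 (Or.inl ⟨hc.1.le, hc.2.le⟩), ?_⟩
      rw [h', div_mul_cancel₀ _ (by linarith)]
    · exact ⟨a, Set.left_mem_uIcc, by simp [h]⟩
    · obtain ⟨c, hc, h'⟩ := exists_hasDerivAt_eq_slope (fun x : ℝ => |x| ^ (q + 1))
        (fun x => (q + 1) * spow q x) h
        (fun x _ => (hasDerivAt_abs_rpow_add_one hq x).continuousAt.continuousWithinAt)
        (fun x _ => hasDerivAt_abs_rpow_add_one hq x)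
      refine ⟨c, Set.mem_uIcc.2 (Or.inr ⟨hc.1.le, hc.2.le⟩), ?_⟩
      rw [h']
      field_simp [(by linarith : a - b ≠ 0)]
      ring
  obtain ⟨c, hc, h⟩ := mvt
  rw [h, show (q + 1) * spow q c * (b - a) - (q + 1) * (spow q a * (b - a)) =
    (q + 1) * ((spow q c - spow q a) * (b - a)) by ring, abs_mul, abs_mul,
    abs_of_pos (by linarith : 0 < q + 1)]
  have hm := (strictMono_spow hq).monotone
  have : |spow q c - spow q a| ≤ |spow q b - spow q a| := by
    rcases Set.mem_uIcc.1 hc with h | h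
    · rw [abs_of_nonneg (sub_nonneg.2 (hm h.1)), abs_of_nonneg (sub_nonneg.2 (hm (h.1.trans h.2)))]
      linarith [hm h.2]
    · rw [abs_of_nonpos (sub_nonpos.2 (hm h.2)), abs_of_nonpos (sub_nonpos.2 (hm (h.1.trans h.2)))]
      linarith [hm h.1]
  gcongr

/-- By homogeneity one may take `a = 1`. Near `1` continuity gives the `η` term; at distance at
least `δ` from `1` every quantity is a multiple of a power of `|b - 1|`. The bound serves `q < 1`
and `q ≥ 1` alike, where `spow` is respectively not Lipschitz at zero or not globally Hölder. -/
theorem abs_spow_sub_le {q : ℝ} (hq : 0 < q) {η : ℝ} (hη : 0 < η) :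
    ∃ C ≥ 0, ∀ a b : ℝ, |spow q b - spow q a| ≤ η * |a| ^ q + C * |b - a| ^ q := by
  obtain ⟨δ, hδ, h⟩ := Metric.continuousAt_iff.1 ((continuous_spow hq).continuousAt (x := 1)) η hη
  have h1 : spow q 1 = 1 := by simp [spow]
  -- For `|b - 1| ≥ δ`, the first summand absorbs `|b| ^ q` and the second absorbs `1`; the third
  -- covers the case `a = 0`.
  refine ⟨(1 + 1 / δ) ^ q + (1 / δ) ^ q + 1, by positivity, ?_⟩
  have hone : ∀ b : ℝ, |spow q b - 1| ≤ η + ((1 + 1 / δ) ^ q + (1 / δ) ^ q + 1) * |b - 1| ^ q := by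
    intro b
    have hb0 : 0 ≤ |b - 1| ^ q := by positivity
    rcases lt_or_ge |b - 1| δ with hb | hb
    · have := h (x := b) (by rwa [Real.dist_eq])
      rw [Real.dist_eq, h1] at this
      have : 0 ≤ ((1 + 1 / δ) ^ q + (1 / δ) ^ q + 1) * |b - 1| ^ q := by positivity
      linarith
    · have e1 : |spow q b - 1| ≤ |b| ^ q + 1 := by
        have := abs_sub (spow q b) 1
        rwa [abs_spow hq, abs_one] at this
      have e2 : 1 ≤ 1 / δ * |b - 1| := by
        rw [one_div, ← div_eq_inv_mul, le_div_iff₀ hδ]; linarith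
      have e3 : |b| ≤ (1 + 1 / δ) * |b - 1| := by
        have : |b| ≤ |b - 1| + 1 := by
          have := abs_add_le (b - 1) 1
          simpa using this
        linarith
      have e4 : |b| ^ q ≤ (1 + 1 / δ) ^ q * |b - 1| ^ q := by
        rw [← Real.mul_rpow (by positivity) (abs_nonneg _)]
        exact Real.rpow_le_rpow (abs_nonneg _) e3 hq.le
      have e5 : 1 ≤ (1 / δ) ^ q * |b - 1| ^ q := by
        rw [← Real.mul_rpow (by positivity) (abs_nonneg _)]
        exact Real.one_le_rpow e2 hq.le
      nlinarith
  intro a b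
  rcases eq_or_ne a 0 with rfl | ha
  · have e0 : spow q 0 = 0 := by simp [spow]
    rw [e0, sub_zero, sub_zero, abs_spow hq, abs_zero, Real.zero_rpow hq.ne', mul_zero, zero_add]
    have : 0 ≤ ((1 + 1 / δ) ^ q + (1 / δ) ^ q) * |b| ^ q := by positivity
    linarith
  · have h2 := hone (b / a)
    have hpos : 0 < |a| ^ q := Real.rpow_pos_of_pos (abs_pos.2 ha) _
    have h3 := mul_le_mul_of_nonneg_left h2 hpos.le
    have e1 : |spow q b - spow q a| = |a| ^ q * |spow q (b / a) - 1| := by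
      rw [← abs_spow hq, ← abs_mul, mul_sub, ← spow_mul, mul_div_cancel₀ _ ha, mul_one]
    have e2 : |b - a| ^ q = |a| ^ q * |b / a - 1| ^ q := by
      rw [← Real.mul_rpow (abs_nonneg _) (abs_nonneg _), ← abs_mul, mul_sub, mul_div_cancel₀ _ ha,
        mul_one]
    rw [e1, e2]
    linarith

/-! ### Differentiable curves in `L^{q+1}`. -/

section

variable {α : Type*} [MeasurableSpace α] {μ : Measure α}

/-- The `L^{q+1}` norm as a real number. -/
def lpNorm (q : ℝ) (μ : Measure α) (f : α → ℝ) : ℝ := (eLpNorm f (ENNReal.ofReal (q + 1)) μ).toReal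

theorem lpNorm_nonneg (q : ℝ) (f : α → ℝ) : 0 ≤ lpNorm q μ f := ENNReal.toReal_nonneg

theorem memLp_spow {q : ℝ} (hq : 0 < q) {f : α → ℝ} (hf : MemLp f (ENNReal.ofReal (q + 1)) μ) :
    MemLp (fun x => spow q (f x)) (ENNReal.ofReal ((q + 1) / q)) μ := by
  have h1 := hf.norm_rpow_div (ENNReal.ofReal q)
  rw [← ENNReal.ofReal_div_of_pos hq, ENNReal.toReal_ofReal hq.le] at h1
  refine h1.of_le ((continuous_spow hq).comp_aestronglyMeasurable hf.1) (ae_of_all _ fun x => ?_)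
  rw [Real.norm_eq_abs, abs_spow hq, Real.norm_eq_abs, Real.norm_eq_abs]
  exact le_abs_self _

theorem holderTriple_add_one {q : ℝ} (hq : 0 < q) :
    ENNReal.HolderTriple (ENNReal.ofReal (q + 1)) (ENNReal.ofReal ((q + 1) / q)) 1 := by
  have h : (q + 1).HolderConjugate ((q + 1) / q) := by
    rw [Real.holderConjugate_iff]
    refine ⟨by linarith, ?_⟩
    field_simp
    ring
  constructor
  rw [← ENNReal.ofReal_inv_of_pos h.pos, ← ENNReal.ofReal_inv_of_pos h.symm.pos,
    ← ENNReal.ofReal_add (inv_nonneg.2 h.nonneg) (inv_nonneg.2 h.symm.nonneg), h.inv_add_inv_eq_one]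
  simp

theorem integrable_mul_spow {q : ℝ} (hq : 0 < q) {f g : α → ℝ}
    (hf : MemLp f (ENNReal.ofReal (q + 1)) μ) (hg : MemLp g (ENNReal.ofReal (q + 1)) μ) :
    Integrable (fun x => f x * spow q (g x)) μ := by
  have := holderTriple_add_one hq
  exact hf.integrable_mul (memLp_spow hq hg)

theorem integral_abs_rpow_eq {q : ℝ} (hq : 0 < q) {f : α → ℝ}
    (hf : MemLp f (ENNReal.ofReal (q + 1)) μ) :
    ∫ x, |f x| ^ (q + 1) ∂μ = lpNorm q μ f ^ (q + 1) := by
  have hq1 : 0 < q + 1 := by linarith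
  unfold lpNorm
  have h0 : 0 ≤ ∫ x, ‖f x‖ ^ (q + 1) ∂μ := integral_nonneg fun x => by positivity
  rw [hf.eLpNorm_eq_integral_rpow_norm (by simpa using hq1) ENNReal.ofReal_ne_top,
    ENNReal.toReal_ofReal hq1.le, ENNReal.toReal_ofReal (by positivity), ← Real.rpow_mul h0,
    inv_mul_cancel₀ hq1.ne', Real.rpow_one]
  simp [Real.norm_eq_abs]

theorem integrable_abs_rpow {q : ℝ} (hq : 0 < q) {f : α → ℝ}
    (hf : MemLp f (ENNReal.ofReal (q + 1)) μ) : Integrable (fun x => |f x| ^ (q + 1)) μ := by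
  have hq1 : 0 < q + 1 := by linarith
  have := hf.integrable_norm_rpow (by simpa using hq1) ENNReal.ofReal_ne_top
  simpa [ENNReal.toReal_ofReal hq1.le, Real.norm_eq_abs] using this

theorem integral_abs_mul_rpow_le {q : ℝ} (hq : 0 < q) {f g : α → ℝ}
    (hf : MemLp f (ENNReal.ofReal (q + 1)) μ) (hg : MemLp g (ENNReal.ofReal (q + 1)) μ) :
    ∫ x, |f x| * |g x| ^ q ∂μ ≤ lpNorm q μ f * lpNorm q μ g ^ q := by
  have hq1 : 0 < q + 1 := by linarith
  have h : (q + 1).HolderConjugate ((q + 1) / q) := by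
    rw [Real.holderConjugate_iff]
    refine ⟨by linarith, ?_⟩
    field_simp
    ring
  have hg' := (memLp_spow hq hg).norm
  simp only [Real.norm_eq_abs, abs_spow hq] at hg'
  have := integral_mul_le_Lp_mul_Lq_of_nonneg (μ := μ) h (f := fun x => |f x|)
    (g := fun x => |g x| ^ q) (ae_of_all _ fun x => abs_nonneg _)
    (ae_of_all _ fun x => by positivity) hf.norm hg'
  refine this.trans (le_of_eq ?_)
  have e : ∀ x, (|g x| ^ q) ^ ((q + 1) / q) = |g x| ^ (q + 1) := fun x => by
    rw [← Real.rpow_mul (abs_nonneg _), mul_div_cancel₀ _ hq.ne']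
  simp only [e]
  rw [integral_abs_rpow_eq hq hf, integral_abs_rpow_eq hq hg, ← Real.rpow_mul (lpNorm_nonneg _ _),
    ← Real.rpow_mul (lpNorm_nonneg _ _)]
  congr 1
  · rw [mul_one_div_cancel hq1.ne', Real.rpow_one]
  · congr 1; field_simp

theorem abs_integral_mul_spow_le {q : ℝ} (hq : 0 < q) {f g : α → ℝ}
    (hf : MemLp f (ENNReal.ofReal (q + 1)) μ) (hg : MemLp g (ENNReal.ofReal (q + 1)) μ) :
    |∫ x, f x * spow q (g x) ∂μ| ≤ lpNorm q μ f * lpNorm q μ g ^ q := by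
  refine (abs_integral_le_integral_abs).trans (le_trans (le_of_eq ?_)
    (integral_abs_mul_rpow_le hq hf hg))
  simp only [abs_mul, abs_spow hq]

theorem lpNorm_add_le {q : ℝ} (hq : 0 < q) {f g : α → ℝ}
    (hf : MemLp f (ENNReal.ofReal (q + 1)) μ) (hg : MemLp g (ENNReal.ofReal (q + 1)) μ) :
    lpNorm q μ (fun x => f x + g x) ≤ lpNorm q μ f + lpNorm q μ g := by
  unfold lpNorm
  rw [← ENNReal.toReal_add hf.2.ne hg.2.ne]
  refine ENNReal.toReal_mono (ENNReal.add_ne_top.2 ⟨hf.2.ne, hg.2.ne⟩) ?_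
  exact eLpNorm_add_le hf.1 hg.1 (by
    rw [← ENNReal.ofReal_one]; exact ENNReal.ofReal_le_ofReal (by linarith))

theorem lpNorm_const_mul (q c : ℝ) (f : α → ℝ) :
    lpNorm q μ (fun x => c * f x) = |c| * lpNorm q μ f := by
  unfold lpNorm
  have := eLpNorm_const_smul c f (ENNReal.ofReal (q + 1)) μ
  rw [show (fun x => c * f x) = c • f from rfl, this, ENNReal.toReal_mul]
  simp

/-- The hypotheses on the curve `t ↦ u t` in `L^{q+1}`. -/
def IsLpDeriv (q : ℝ) (μ : Measure α) (u ut : ℝ → α → ℝ) : Prop :=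
  ∀ t < 0, MemLp (u t) (ENNReal.ofReal (q + 1)) μ ∧ MemLp (ut t) (ENNReal.ofReal (q + 1)) μ ∧
    Tendsto (fun s => eLpNorm (fun x => (u s x - u t x) / (s - t) - ut t x)
      (ENNReal.ofReal (q + 1)) μ) (𝓝[Set.Iio 0 \ {t}] t) (𝓝 0)

theorem IsLpDeriv.tendsto {q : ℝ} {u ut : ℝ → α → ℝ} (h : IsLpDeriv q μ u ut) {t : ℝ}
    (ht : t < 0) :
    Tendsto (fun s => lpNorm q μ (fun x => (u s x - u t x) / (s - t) - ut t x)) (𝓝[≠] t) (𝓝 0) := by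
  have h1 := (h t ht).2.2
  have e : 𝓝[Set.Iio 0 \ {t}] t = 𝓝[≠] t := by
    rw [Set.sdiff_eq]
    exact nhdsWithin_inter_of_mem (nhdsWithin_le_nhds (Iio_mem_nhds ht))
  rw [e] at h1
  have := (ENNReal.tendsto_toReal ENNReal.zero_ne_top).comp h1
  simpa [lpNorm, Function.comp_def] using this

/-- The function `spow q ∘ g` lies in the dual space `L^{(q+1)/q}`, so the pairing is a bounded
linear functional and differentiates along the curve. -/
theorem IsLpDeriv.hasDerivAt_integral_mul_spow {q : ℝ} (hq : 0 < q) {u ut : ℝ → α → ℝ}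
    (h : IsLpDeriv q μ u ut) {t : ℝ} (ht : t < 0) {g : α → ℝ}
    (hg : MemLp g (ENNReal.ofReal (q + 1)) μ) :
    HasDerivAt (fun s => ∫ x, u s x * spow q (g x) ∂μ) (∫ x, ut t x * spow q (g x) ∂μ) t := by
  rw [hasDerivAt_iff_tendsto_slope, tendsto_iff_dist_tendsto_zero]
  have h1 := (h.tendsto ht).mul_const (lpNorm q μ g ^ q)
  rw [zero_mul] at h1
  refine squeeze_zero' (Eventually.of_forall fun _ => dist_nonneg) ?_ h1
  filter_upwards [self_mem_nhdsWithin, nhdsWithin_le_nhds (Iio_mem_nhds ht)] with s hs hs0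
  have hne : s - t ≠ 0 := sub_ne_zero.2 hs
  have hE : MemLp (fun x => (u s x - u t x) / (s - t) - ut t x) (ENNReal.ofReal (q + 1)) μ := by
    have := ((((h s hs0).1.sub (h t ht).1).const_mul (s - t)⁻¹)).sub (h t ht).2.1
    refine this.ae_eq (ae_of_all _ fun x => ?_)
    simp [div_eq_inv_mul]
  refine le_trans (le_of_eq ?_) (abs_integral_mul_spow_le hq hE hg)
  rw [Real.dist_eq, slope_def_field]
  congr 1
  have i1 := integrable_mul_spow hq (h s hs0).1 hg
  have i2 := integrable_mul_spow hq (h t ht).1 hg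
  have i3 := integrable_mul_spow hq (h t ht).2.1 hg
  have i4 : Integrable (fun x => (u s x * spow q (g x) - u t x * spow q (g x)) / (s - t)) μ :=
    (i1.sub i2).div_const _
  rw [← integral_sub i1 i2, ← integral_div, ← integral_sub i4 i3]
  refine integral_congr_ae (ae_of_all _ fun x => ?_)
  simp only
  ring

/-- The linear part of the increment is the pairing with `spow q (u t)`, already differentiated. The
rest is at most `η ‖Δ‖ ‖u t‖ ^ q + C ‖Δ‖ ^ (q + 1)` up to the factor `q + 1`, where `Δ = u s - u t`
has norm `O(|s - t|)` and `η` is arbitrary; hence it is `o(|s - t|)`. -/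
theorem IsLpDeriv.hasDerivAt_energy {q : ℝ} (hq : 0 < q) {u ut : ℝ → α → ℝ}
    (h : IsLpDeriv q μ u ut) {t : ℝ} (ht : t < 0) :
    HasDerivAt (fun s => ∫ x, |u s x| ^ (q + 1) ∂μ)
      ((q + 1) * ∫ x, ut t x * spow q (u t x) ∂μ) t := by
  have hq1 : 0 < q + 1 := by linarith
  set A := lpNorm q μ (u t) ^ q
  have hA : 0 ≤ A := Real.rpow_nonneg (lpNorm_nonneg _ _) _
  -- A bound for the norm of the difference quotient once it is within `1` of `ut t`.
  set B := lpNorm q μ (ut t) + 1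
  have hB : 0 < B := by have := lpNorm_nonneg (μ := μ) q (ut t); positivity
  have hlin := h.hasDerivAt_integral_mul_spow hq ht (h t ht).1
  suffices hR : HasDerivAt (fun s => ∫ x, |u s x| ^ (q + 1) ∂μ - ∫ x, |u t x| ^ (q + 1) ∂μ
      - (q + 1) * (∫ x, u s x * spow q (u t x) ∂μ - ∫ x, u t x * spow q (u t x) ∂μ)) 0 t by
    have h2 := ((hR.add ((hlin.sub_const (∫ x, u t x * spow q (u t x) ∂μ)).const_mul (q + 1))).add_const
      (∫ x, |u t x| ^ (q + 1) ∂μ))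
    rw [zero_add] at h2
    refine h2.congr_of_eventuallyEq (Eventually.of_forall fun s => ?_)
    simp only [Pi.add_apply]
    ring
  rw [hasDerivAt_iff_isLittleO, Asymptotics.isLittleO_iff]
  intro c hc
  -- Chosen so that the `η` term is at most `c / 2 * |s - t|`; `A + 1` replaces `A`, which may
  -- vanish.
  obtain ⟨C, hC, hineq⟩ := abs_spow_sub_le hq (η := c / (2 * (q + 1) * (A + 1) * B))
    (by positivity)
  set η := c / (2 * (q + 1) * (A + 1) * B)
  have hη : 0 < η := by positivity
  have hsmall : ∀ᶠ s in 𝓝 t, (q + 1) * (C * (|s - t| ^ q * B ^ (q + 1))) < c / 2 := by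
    have : Tendsto (fun s => (q + 1) * (C * (|s - t| ^ q * B ^ (q + 1)))) (𝓝 t)
        (𝓝 ((q + 1) * (C * (|t - t| ^ q * B ^ (q + 1))))) := by
      refine Continuous.tendsto ?_ t
      have : Continuous fun s : ℝ => |s - t| ^ q :=
        ((continuous_id.sub continuous_const).abs).rpow_const (fun _ => Or.inr hq.le)
      fun_prop
    rw [sub_self, abs_zero, Real.zero_rpow hq.ne', zero_mul, mul_zero, mul_zero] at this
    exact this.eventually (gt_mem_nhds (by positivity))
  have hE1 : ∀ᶠ s in 𝓝 t, s ≠ t →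
      lpNorm q μ (fun x => (u s x - u t x) / (s - t) - ut t x) < 1 := by
    have := (h.tendsto ht).eventually (gt_mem_nhds one_pos)
    exact eventually_nhdsWithin_iff.1 this
  filter_upwards [hsmall, hE1, Iio_mem_nhds ht] with s hs1 hs2 hs0
  rcases eq_or_ne s t with rfl | hst
  · simp
  have hne : s - t ≠ 0 := sub_ne_zero.2 hst
  have hE : MemLp (fun x => (u s x - u t x) / (s - t) - ut t x) (ENNReal.ofReal (q + 1)) μ := by
    have := ((((h s hs0).1.sub (h t ht).1).const_mul (s - t)⁻¹)).sub (h t ht).2.1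
    refine this.ae_eq (ae_of_all _ fun x => ?_)
    simp [div_eq_inv_mul]
  have hΔ : MemLp (fun x => u s x - u t x) (ENNReal.ofReal (q + 1)) μ := (h s hs0).1.sub (h t ht).1
  have hΔn : lpNorm q μ (fun x => u s x - u t x) ≤ |s - t| * B := by
    have e : (fun x => u s x - u t x) = fun x => (s - t) *
        (ut t x + ((u s x - u t x) / (s - t) - ut t x)) := by
      ext x; field_simp; ring
    rw [e, lpNorm_const_mul]
    refine mul_le_mul_of_nonneg_left ?_ (abs_nonneg _)
    exact (lpNorm_add_le hq (h t ht).2.1 hE).trans (by have := (hs2 hst).le; simp only [B]; linarith)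
  have hΔ0 : 0 ≤ lpNorm q μ (fun x => u s x - u t x) := lpNorm_nonneg _ _
  have i1 := integrable_abs_rpow hq (h s hs0).1
  have i2 := integrable_abs_rpow hq (h t ht).1
  have i3 := integrable_mul_spow hq hΔ (h t ht).1
  have i4 : Integrable (fun x => |u s x - u t x| * |u t x| ^ q) μ := by
    have := i3.abs
    simpa only [abs_mul, abs_spow hq] using this
  have i5 := integrable_abs_rpow hq hΔ
  have e0 : ∫ x, |u s x| ^ (q + 1) ∂μ - ∫ x, |u t x| ^ (q + 1) ∂μ
      - (q + 1) * (∫ x, u s x * spow q (u t x) ∂μ - ∫ x, u t x * spow q (u t x) ∂μ) =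
      ∫ x, (|u s x| ^ (q + 1) - |u t x| ^ (q + 1) - (q + 1) * (spow q (u t x) * (u s x - u t x))) ∂μ := by
    have i6 : Integrable (fun x => |u s x| ^ (q + 1) - |u t x| ^ (q + 1)) μ := i1.sub i2
    rw [integral_sub i6, integral_sub i1 i2, integral_const_mul,
      ← integral_sub (integrable_mul_spow hq (h s hs0).1 (h t ht).1)
        (integrable_mul_spow hq (h t ht).1 (h t ht).1)]
    · congr 2
      refine integral_congr_ae (ae_of_all _ fun x => ?_)
      simp only; ring
    · refine (i3.congr (ae_of_all _ fun x => ?_)).const_mul _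
      simp only; ring
  have e00 : ∫ x, |u t x| ^ (q + 1) ∂μ - ∫ x, |u t x| ^ (q + 1) ∂μ
      - (q + 1) * (∫ x, u t x * spow q (u t x) ∂μ - ∫ x, u t x * spow q (u t x) ∂μ) = 0 := by ring
  rw [e00, smul_zero, sub_zero, sub_zero, e0]
  have b1 : ‖∫ x, (|u s x| ^ (q + 1) - |u t x| ^ (q + 1) -
      (q + 1) * (spow q (u t x) * (u s x - u t x))) ∂μ‖ ≤
      ∫ x, (q + 1) * (η * (|u s x - u t x| * |u t x| ^ q) + C * |u s x - u t x| ^ (q + 1)) ∂μ := by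
    refine norm_integral_le_of_norm_le (((i4.const_mul η).add (i5.const_mul C)).const_mul _)
      (ae_of_all _ fun x => ?_)
    refine (abs_rpow_expansion hq (u t x) (u s x)).trans ?_
    refine mul_le_mul_of_nonneg_left ?_ hq1.le
    have := mul_le_mul_of_nonneg_right (hineq (u t x) (u s x)) (abs_nonneg (u s x - u t x))
    refine this.trans (le_of_eq ?_)
    have e1 : |u s x - u t x| ^ (q + 1) = |u s x - u t x| ^ q * |u s x - u t x| := by
      rcases eq_or_ne (u s x - u t x) 0 with h0 | h0
      · rw [h0]; simp [Real.zero_rpow hq1.ne']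
      · rw [Real.rpow_add (abs_pos.2 h0), Real.rpow_one]
    rw [e1]; ring
  refine b1.trans ?_
  rw [integral_const_mul, integral_add (i4.const_mul η) (i5.const_mul C), integral_const_mul,
    integral_const_mul, integral_abs_rpow_eq hq hΔ]
  have b2 := (integral_abs_mul_rpow_le hq hΔ (h t ht).1)
  have b3 : lpNorm q μ (fun x => u s x - u t x) ^ (q + 1) ≤ |s - t| * (|s - t| ^ q * B ^ (q + 1)) := by
    refine (Real.rpow_le_rpow hΔ0 hΔn hq1.le).trans (le_of_eq ?_)
    rw [Real.mul_rpow (abs_nonneg _) hB.le, Real.rpow_add (abs_pos.2 hne), Real.rpow_one]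
    ring
  have b4 : ∫ x, |u s x - u t x| * |u t x| ^ q ∂μ ≤ |s - t| * B * A :=
    b2.trans (mul_le_mul_of_nonneg_right hΔn hA)
  have b5 : (q + 1) * (η * (|s - t| * B * A)) ≤ c / 2 * |s - t| := by
    have : (q + 1) * (η * (B * (A + 1))) = c / 2 := by
      simp only [η]; field_simp
    rw [← this]
    have : 0 ≤ (q + 1) * (η * B) * |s - t| := by positivity
    nlinarith
  have b6 : (q + 1) * (C * (|s - t| * (|s - t| ^ q * B ^ (q + 1)))) ≤ c / 2 * |s - t| := by
    have := mul_le_mul_of_nonneg_right hs1.le (abs_nonneg (s - t))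
    linarith
  rw [Real.norm_eq_abs]
  calc (q + 1) * (η * ∫ x, |u s x - u t x| * |u t x| ^ q ∂μ +
        C * lpNorm q μ (fun x => u s x - u t x) ^ (q + 1))
      ≤ (q + 1) * (η * (|s - t| * B * A) + C * (|s - t| * (|s - t| ^ q * B ^ (q + 1)))) := by
        gcongr
    _ ≤ c * |s - t| := by rw [mul_add]; linarith

end

/-! ### Vanishing of the dissipation, in abstract form. -/

section

variable {α : Type*} [MeasurableSpace α] {μ : Measure α}

theorem IsLpDeriv.hasDerivAt_lpNorm {q : ℝ} (hq : 0 < q) {u ut : ℝ → α → ℝ} {F : ℝ → ℝ}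
    (h : IsLpDeriv q μ u ut) (ha : ∀ t < 0, ∫ x, ut t x * spow q (u t x) ∂μ = -F t)
    {t : ℝ} (ht : t < 0) (hpos : 0 < lpNorm q μ (u t)) :
    HasDerivAt (fun s => lpNorm q μ (u s)) (-(F t / lpNorm q μ (u t) ^ q)) t := by
  have hq1 : 0 < q + 1 := by linarith
  have h1 := h.hasDerivAt_energy hq ht
  rw [ha t ht] at h1
  have hI : ∀ s < 0, ∫ x, |u s x| ^ (q + 1) ∂μ = lpNorm q μ (u s) ^ (q + 1) :=
    fun s hs => integral_abs_rpow_eq hq (h s hs).1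
  have hI0 : ∫ x, |u t x| ^ (q + 1) ∂μ ≠ 0 := by
    rw [hI t ht]; exact (Real.rpow_pos_of_pos hpos _).ne'
  have h2 := h1.rpow_const (p := 1 / (q + 1)) (Or.inl hI0)
  have h3 : HasDerivAt (fun s => lpNorm q μ (u s))
      ((q + 1) * -F t * (1 / (q + 1)) * (∫ x, |u t x| ^ (q + 1) ∂μ) ^ (1 / (q + 1) - 1)) t := by
    refine h2.congr_of_eventuallyEq ?_
    filter_upwards [Iio_mem_nhds ht] with s hs
    rw [hI s hs, ← Real.rpow_mul (lpNorm_nonneg _ _), mul_one_div_cancel hq1.ne', Real.rpow_one]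
  convert h3 using 1
  rw [hI t ht, ← Real.rpow_mul hpos.le]
  have e : (q + 1) * (1 / (q + 1) - 1) = -q := by field_simp; ring
  rw [e, Real.rpow_neg hpos.le]
  field_simp

/-- If `F s₀ > 0`, then `N` strictly decreases just after `s₀`, which starts the decay rate for all
earlier times and contradicts one of the two growth lemmas. The geometry enters only through the
tested identity `ha` and the Hölder bound `hb`. -/
theorem IsLpDeriv.dissipation_eq_zero {p q : ℝ} (hp : 1 < p) (hq : 0 < q) {u ut : ℝ → α → ℝ}
    {F : ℝ → ℝ} (h : IsLpDeriv q μ u ut) (hF : ∀ t < 0, 0 ≤ F t)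
    (ha : ∀ t < 0, ∫ x, ut t x * spow q (u t x) ∂μ = -F t)
    (hb : ∀ s < 0, ∀ t < 0,
      -∫ x, ut t x * spow q (u s x) ∂μ ≤ F t ^ (1 - 1 / p) * F s ^ (1 / p))
    (hκ : 0 < q * (p - 1) - 1 ∨ (q * (p - 1) - 1 = 0 ∧
      ∃ C d : ℝ, 0 < C ∧ 0 < d ∧ ∀ t < 0, ∫ x, |u t x| ^ (q + 1) ∂μ ≤ C * (1 + |t|) ^ d))
    {s₀ : ℝ} (hs₀ : s₀ < 0) : F s₀ = 0 := by
  have hq1 : 0 < q + 1 := by linarith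
  by_contra hne
  have hFs : 0 < F s₀ := lt_of_le_of_ne (hF s₀ hs₀) (Ne.symm hne)
  set N : ℝ → ℝ := fun t => lpNorm q μ (u t) with hNdef
  have hN0 : ∀ t, 0 ≤ N t := fun t => lpNorm_nonneg _ _
  have hI : ∀ s < 0, ∫ x, |u s x| ^ (q + 1) ∂μ = N s ^ (q + 1) :=
    fun s hs => integral_abs_rpow_eq hq (h s hs).1
  have anti : AntitoneOn (fun s => ∫ x, |u s x| ^ (q + 1) ∂μ) (Set.Iio 0) := by
    refine antitoneOn_Iio_of_hasDerivAt_nonpos (fun t ht => h.hasDerivAt_energy hq ht)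
      (fun t ht => ?_)
    rw [ha t ht]
    nlinarith [hF t ht]
  -- If `u s₀` had norm zero, Hölder would make the pairing `-F s₀` vanish too.
  have hNs : 0 < N s₀ := by
    refine lt_of_le_of_ne (hN0 _) fun h0 => hne ?_
    have := abs_integral_mul_spow_le hq (h s₀ hs₀).2.1 (h s₀ hs₀).1
    rw [show lpNorm q μ (u s₀) = 0 from h0.symm, Real.zero_rpow hq.ne', mul_zero, ha s₀ hs₀] at this
    have := abs_nonpos_iff.1 this
    linarith
  have hle : ∀ t ≤ s₀, N s₀ ≤ N t := by
    intro t ht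
    have h1 := anti (Set.mem_Iio.2 (ht.trans_lt hs₀)) (Set.mem_Iio.2 hs₀) ht
    simp only at h1
    rw [hI _ hs₀, hI _ (ht.trans_lt hs₀)] at h1
    exact (Real.rpow_le_rpow_iff (hN0 _) (hN0 _) hq1).1 h1
  have hder : ∀ t < 0, 0 < N t → HasDerivAt N (-(F t / N t ^ q)) t := fun t ht hpos =>
    h.hasDerivAt_lpNorm hq ha ht hpos
  have hev : ∀ᶠ t in 𝓝 s₀, 0 < N t :=
    (hder s₀ hs₀ hNs).continuousAt.eventually (lt_mem_nhds hNs)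
  obtain ⟨ε, hε, hball⟩ := Metric.eventually_nhds_iff.1 hev
  set a := min (s₀ + ε) 0 with hadef
  have hsa : s₀ < a := lt_min (by linarith) hs₀
  have ha0 : a ≤ 0 := min_le_right _ _
  have hNpos : ∀ t < a, 0 < N t := by
    intro t ht
    rcases le_or_gt t s₀ with h1 | h1
    · exact hNs.trans_le (hle t h1)
    · refine hball ?_
      rw [Real.dist_eq, abs_of_pos (by linarith)]
      have := ht.trans_le (min_le_left (s₀ + ε) 0)
      linarith
  obtain ⟨t₀, ht₀, ht₀a, hlt⟩ : ∃ t₀, s₀ < t₀ ∧ t₀ < a ∧ N t₀ < N s₀ := by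
    have h1 := hasDerivAt_iff_tendsto_slope.1 (hder s₀ hs₀ hNs)
    have hneg : -(F s₀ / N s₀ ^ q) < 0 := by
      have := div_pos hFs (Real.rpow_pos_of_pos hNs q)
      linarith
    have h2 : ∀ᶠ t in 𝓝[>] s₀, slope N s₀ t < 0 :=
      (h1.mono_left (nhdsWithin_mono _ fun x hx => ne_of_gt hx)).eventually (gt_mem_nhds hneg)
    have h6 : ∀ᶠ t in 𝓝[>] s₀, t < a := nhdsWithin_le_nhds (Iio_mem_nhds hsa)
    have h7 : ∀ᶠ t in 𝓝[>] s₀, s₀ < t := self_mem_nhdsWithin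
    obtain ⟨t, h3, h4, h5⟩ := (h2.and (h6.and h7)).exists
    refine ⟨t, h5, h4, ?_⟩
    rw [slope_def_field, div_lt_iff₀ (sub_pos.2 h5), zero_mul] at h3
    linarith
  obtain ⟨c, hc, hrate⟩ := exists_decay_rate (a := a) hp hq (N := N) (F := F)
    (W := fun s t => ∫ x, u t x * spow q (u s x) ∂μ)
    (W' := fun s t => ∫ x, ut t x * spow q (u s x) ∂μ) hNpos
    (fun t ht => hF t (ht.trans_le ha0)) (fun t ht => hder t (ht.trans_le ha0) (hNpos t ht))
    (fun s hs t ht => h.hasDerivAt_integral_mul_spow hq (ht.trans_le ha0)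
      (h s (hs.trans_le ha0)).1)
    (fun s hs t ht => hb s (hs.trans_le ha0) t (ht.trans_le ha0))
    (fun s hs => by
      simp only [spow_mul_self hq]
      exact hI s (hs.trans_le ha0))
    (fun s hs t ht => (le_abs_self _).trans
      (abs_integral_mul_spow_le hq (h t (ht.trans_le ha0)).1 (h s (hs.trans_le ha0)).1))
    ht₀ ht₀a hlt
  have hN' : ∀ t < s₀, 0 < N t := fun t ht => hNpos t (ht.trans hsa)
  have hd' : ∀ t < s₀, HasDerivAt N (-(F t / N t ^ q)) t := fun t ht =>
    hder t (ht.trans hs₀) (hN' t ht)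
  -- The exponent of the decay rate is `p * q - q = δ + 1`.
  rcases hκ with hκ | ⟨hκ, C, d, hC, hd, hpoly⟩
  · exact false_of_superlinear_decay (κ := p * q - q) (by linarith) hc hN' hd'
      (fun t ht => hrate t ht.le)
  · have e : p * q - q = 1 := by linarith
    simp only [e, Real.rpow_one] at hrate
    refine false_of_linear_decay (C := C ^ (1 / (q + 1))) (d := d / (q + 1)) hc hN' hd'
      (fun t ht => hrate t ht.le) (by positivity) (fun t ht => ?_)
    have h1 := hpoly t (ht.trans hs₀)
    rw [hI t (ht.trans hs₀)] at h1
    have h2 := Real.rpow_le_rpow (by have := hN0 t; positivity) h1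
      (by positivity : (0 : ℝ) ≤ 1 / (q + 1))
    rw [← Real.rpow_mul (hN0 t), mul_one_div_cancel hq1.ne', Real.rpow_one,
      Real.mul_rpow hC.le (by positivity), ← Real.rpow_mul (by positivity), mul_one_div] at h2
    exact h2

end

/-! ### Mollification in Euclidean space. -/

section

open scoped Convolution

variable {n : ℕ}

/-- A bump function supported in the ball of radius `1 / (m + 1)`. -/
def mollifier (n m : ℕ) : ContDiffBump (0 : EuclideanSpace ℝ (Fin n)) where
  rIn := 1 / (m + 1) / 2
  rOut := 1 / (m + 1)
  rIn_pos := by positivity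
  rIn_lt_rOut := half_lt_self (by positivity)

/-- The kernel of the mollification. -/
def mollKernel (n m : ℕ) : EuclideanSpace ℝ (Fin n) → ℝ := (mollifier n m).normed volume

/-- The mollification of `f` at scale `1 / (m + 1)`. -/
def mollify (m : ℕ) (f : EuclideanSpace ℝ (Fin n) → ℝ) : EuclideanSpace ℝ (Fin n) → ℝ :=
  mollKernel n m ⋆[ContinuousLinearMap.lsmul ℝ ℝ, volume] f

theorem tendsto_mollifier_rOut (n : ℕ) : Tendsto (fun m => (mollifier n m).rOut) atTop (𝓝 0) :=
  tendsto_one_div_add_atTop_nhds_zero_nat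

theorem mollKernel_nonneg (m : ℕ) (x : EuclideanSpace ℝ (Fin n)) : 0 ≤ mollKernel n m x :=
  (mollifier n m).nonneg_normed x

theorem contDiff_mollKernel (m : ℕ) : ContDiff ℝ ∞ (mollKernel n m) :=
  (mollifier n m).contDiff_normed

theorem hasCompactSupport_mollKernel (m : ℕ) : HasCompactSupport (mollKernel n m) :=
  (mollifier n m).hasCompactSupport_normed

theorem support_mollKernel (m : ℕ) :
    Function.support (mollKernel n m) = Metric.ball 0 (1 / (m + 1)) :=
  (mollifier n m).support_normed_eq

theorem tsupport_mollKernel (m : ℕ) :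
    tsupport (mollKernel n m) = Metric.closedBall 0 (1 / (m + 1)) :=
  (mollifier n m).tsupport_normed_eq

theorem mollify_apply (m : ℕ) (f : EuclideanSpace ℝ (Fin n) → ℝ) (y : EuclideanSpace ℝ (Fin n)) :
    mollify m f y = ∫ z, mollKernel n m z * f (y - z) := rfl

theorem mollify_apply' (m : ℕ) (f : EuclideanSpace ℝ (Fin n) → ℝ) (y : EuclideanSpace ℝ (Fin n)) :
    mollify m f y = ∫ z, mollKernel n m (y - z) * f z := by
  rw [mollify_apply, ← integral_sub_left_eq_self _ _ y]
  simp

theorem integrable_mollKernel (m : ℕ) : Integrable (mollKernel n m) :=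
  (mollifier n m).integrable_normed

theorem integral_mollKernel (m : ℕ) : ∫ z, mollKernel n m z = 1 :=
  (mollifier n m).integral_normed

theorem contDiff_mollify (m : ℕ) {f : EuclideanSpace ℝ (Fin n) → ℝ} (hf : LocallyIntegrable f) :
    ContDiff ℝ ∞ (mollify m f) :=
  (hasCompactSupport_mollKernel m).contDiff_convolution_left _ (contDiff_mollKernel m) hf

theorem ae_tendsto_mollify {f : EuclideanSpace ℝ (Fin n) → ℝ} (hf : LocallyIntegrable f) :
    ∀ᵐ y, Tendsto (fun m => mollify m f y) atTop (𝓝 (f y)) :=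
  -- The outer radius is twice the inner one; this bounded ratio is `K = 2`.
  ContDiffBump.ae_convolution_tendsto_right_of_locallyIntegrable (φ := mollifier n) (K := 2)
    (tendsto_mollifier_rOut n)
    (Eventually.of_forall fun m => le_of_eq (by simp only [mollifier]; ring)) hf

theorem integrable_mollKernel_mul {m : ℕ} {f : EuclideanSpace ℝ (Fin n) → ℝ}
    (hf : LocallyIntegrable f) (y : EuclideanSpace ℝ (Fin n)) :
    Integrable (fun z => mollKernel n m z * f (y - z)) :=
  (hasCompactSupport_mollKernel m).convolutionExists_left (ContinuousLinearMap.lsmul ℝ ℝ)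
    (contDiff_mollKernel m).continuous hf y

theorem abs_mollify_le (m : ℕ) {f : EuclideanSpace ℝ (Fin n) → ℝ}
    {C : ℝ} {y : EuclideanSpace ℝ (Fin n)} (hC : ∀ z ∈ Metric.ball y (1 / (m + 1)), |f z| ≤ C) :
    |mollify m f y| ≤ C := by
  rw [mollify_apply, ← Real.norm_eq_abs]
  have : ‖∫ z, mollKernel n m z * f (y - z)‖ ≤ ∫ z, mollKernel n m z * C := by
    refine norm_integral_le_of_norm_le ((integrable_mollKernel m).mul_const C)
      (ae_of_all _ fun z => ?_)
    rw [norm_mul, Real.norm_of_nonneg (mollKernel_nonneg m z)]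
    by_cases hz : z ∈ Metric.ball (0 : EuclideanSpace ℝ (Fin n)) (1 / (m + 1))
    · refine mul_le_mul_of_nonneg_left (hC _ ?_) (mollKernel_nonneg m z)
      simpa [dist_eq_norm] using hz
    · rw [← support_mollKernel, Function.notMem_support] at hz
      simp [hz]
  rwa [integral_mul_const, integral_mollKernel, one_mul] at this

/-- The mollification averages translates with a probability density, so a bound on differences of
translates is inherited. This transfers Lipschitz bounds to mollified functions. -/
theorem mollify_sub_mollify_le (m : ℕ) {f : EuclideanSpace ℝ (Fin n) → ℝ}
    (hf : LocallyIntegrable f) {C : ℝ} {y y' : EuclideanSpace ℝ (Fin n)}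
    (hC : ∀ z ∈ Metric.ball (0 : EuclideanSpace ℝ (Fin n)) (1 / (m + 1)),
      |f (y - z) - f (y' - z)| ≤ C) :
    |mollify m f y - mollify m f y'| ≤ C := by
  rw [mollify_apply, mollify_apply, ← integral_sub (integrable_mollKernel_mul hf y)
    (integrable_mollKernel_mul hf y'), ← Real.norm_eq_abs]
  have : ‖∫ z, (mollKernel n m z * f (y - z) - mollKernel n m z * f (y' - z))‖ ≤
      ∫ z, mollKernel n m z * C := by
    refine norm_integral_le_of_norm_le ((integrable_mollKernel m).mul_const C)
      (ae_of_all _ fun z => ?_)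
    rw [← mul_sub, norm_mul, Real.norm_of_nonneg (mollKernel_nonneg m z)]
    by_cases hz : z ∈ Metric.ball (0 : EuclideanSpace ℝ (Fin n)) (1 / (m + 1))
    · exact mul_le_mul_of_nonneg_left (hC _ hz) (mollKernel_nonneg m z)
    · rw [← support_mollKernel, Function.notMem_support] at hz
      simp [hz]
  rwa [integral_mul_const, integral_mollKernel, one_mul] at this

theorem mollify_sub_self (m : ℕ) {f : EuclideanSpace ℝ (Fin n) → ℝ}
    (hf : LocallyIntegrable f) (y : EuclideanSpace ℝ (Fin n)) :
    mollify m f y - f y = ∫ z, mollKernel n m z * (f (y - z) - f y) := by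
  simp only [mul_sub]
  rw [integral_sub (integrable_mollKernel_mul hf y) ((integrable_mollKernel m).mul_const _),
    integral_mul_const, integral_mollKernel, one_mul, mollify_apply]

/-- Continuity of translations in `L^r`. -/
theorem tendsto_eLpNorm_translate_sub {r : ℝ≥0∞} (hr1 : 1 ≤ r) (hr : r ≠ ⊤)
    {f : EuclideanSpace ℝ (Fin n) → ℝ} (hf : MemLp f r) :
    Tendsto (fun z => eLpNorm (fun y => f (y - z) - f y) r volume) (𝓝 0) (𝓝 0) := by
  have : Fact (1 ≤ r) := ⟨hr1⟩
  have : Fact (r ≠ ⊤) := ⟨hr⟩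
  set φ := hf.toLp f
  -- The translation group acts continuously on `L^r` for `r < ∞`; the element `mk (-z)` acts by `y
  -- ↦ φ (-z + y)`.
  have hcont : Tendsto (fun z : EuclideanSpace ℝ (Fin n) => (DomAddAct.mk (-z)) +ᵥ φ) (𝓝 0)
      (𝓝 ((DomAddAct.mk (-0 : EuclideanSpace ℝ (Fin n))) +ᵥ φ)) := by
    refine Continuous.tendsto ?_ 0
    have h1 : Continuous fun z : EuclideanSpace ℝ (Fin n) => DomAddAct.mk (-z) :=
      DomAddAct.continuous_mk.comp continuous_neg
    exact h1.vadd continuous_const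
  have e0 : (DomAddAct.mk (-0 : EuclideanSpace ℝ (Fin n))) +ᵥ φ = φ := by simp
  rw [e0, Lp.tendsto_Lp_iff_tendsto_eLpNorm'] at hcont
  refine hcont.congr fun z => eLpNorm_congr_ae ?_
  have h1 := DomAddAct.vadd_Lp_ae_eq (DomAddAct.mk (-z)) φ
  have h2 := hf.coeFn_toLp
  have h3 : ∀ᵐ y, φ (-z +ᵥ y) = f (-z +ᵥ y) :=
    (measurePreserving_vadd (-z) (volume : Measure (EuclideanSpace ℝ (Fin n)))).quasiMeasurePreserving.ae h2
  filter_upwards [h1, h2, h3] with y h1 h2 h3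
  simp only [Pi.sub_apply]
  rw [h1, h2]
  change φ (-z +ᵥ y) - f y = _
  rw [h3, vadd_eq_add, neg_add_eq_sub]

/-- Mollifications converge in `L^r`. -/
theorem tendsto_eLpNorm_mollify_sub {r : ℝ} (hr : 1 ≤ r) {f : EuclideanSpace ℝ (Fin n) → ℝ}
    (hf : MemLp f (ENNReal.ofReal r)) :
    Tendsto (fun m => eLpNorm (fun y => mollify m f y - f y) (ENNReal.ofReal r) volume)
      atTop (𝓝 0) := by
  have hr0 : 0 < r := by linarith
  have hr1 : (1 : ℝ≥0∞) ≤ ENNReal.ofReal r := by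
    rw [← ENNReal.ofReal_one]; exact ENNReal.ofReal_le_ofReal hr
  have hfl : LocallyIntegrable f := hf.locallyIntegrable hr1
  have hR0 : ENNReal.ofReal r ≠ 0 := by simpa using hr0
  have htr := tendsto_eLpNorm_translate_sub hr1 ENNReal.ofReal_ne_top hf
  rw [ENNReal.tendsto_nhds_zero] at htr ⊢
  intro ε hε
  obtain ⟨δ, hδ, hball⟩ := Metric.eventually_nhds_iff.1 (htr ε hε)
  have hm : ∀ᶠ m in atTop, (mollifier n m).rOut < δ :=
    (tendsto_mollifier_rOut n).eventually (gt_mem_nhds hδ)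
  filter_upwards [hm] with m hm
  -- The kernel as a probability measure: Jensen bounds `|mollify m f y - f y| ^ r` by a
  -- `ν`-average, and Tonelli turns the integral over `y` into an average of translation errors over
  -- small `z`.
  set ν : Measure (EuclideanSpace ℝ (Fin n)) :=
    volume.withDensity fun z => ENNReal.ofReal (mollKernel n m z) with hν
  have hmeas : Measurable fun z => ENNReal.ofReal (mollKernel n m z) :=
    (contDiff_mollKernel m).continuous.measurable.ennreal_ofReal
  have hprob : IsProbabilityMeasure ν := ⟨by
    rw [hν, withDensity_apply _ MeasurableSet.univ, Measure.restrict_univ,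
      ← ofReal_integral_eq_lintegral_ofReal (integrable_mollKernel m)
        (ae_of_all _ (mollKernel_nonneg m)), integral_mollKernel, ENNReal.ofReal_one]⟩
  have hνac : ν ≪ volume := withDensity_absolutelyContinuous _ _
  have hF : AEStronglyMeasurable
      (fun x : EuclideanSpace ℝ (Fin n) × EuclideanSpace ℝ (Fin n) => f (x.1 - x.2) - f x.1)
      ((volume : Measure (EuclideanSpace ℝ (Fin n))).prod volume) :=
    (hf.1.comp_quasiMeasurePreserving
      (quasiMeasurePreserving_sub_of_right_invariant volume volume)).sub hf.1.comp_fst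
  have hF' : AEStronglyMeasurable
      (fun x : EuclideanSpace ℝ (Fin n) × EuclideanSpace ℝ (Fin n) => f (x.1 - x.2) - f x.1)
      ((volume : Measure (EuclideanSpace ℝ (Fin n))).prod ν) :=
    hF.mono_ac (Measure.AbsolutelyContinuous.rfl.prod hνac)
  have hFm : AEMeasurable (fun x : EuclideanSpace ℝ (Fin n) × EuclideanSpace ℝ (Fin n) =>
      ‖f (x.1 - x.2) - f x.1‖ₑ ^ r) ((volume : Measure (EuclideanSpace ℝ (Fin n))).prod ν) :=
    hF'.enorm.pow_const r
  have hpt : ∀ᵐ y : EuclideanSpace ℝ (Fin n),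
      ‖mollify m f y - f y‖ₑ ^ r ≤ ∫⁻ z, ‖f (y - z) - f y‖ₑ ^ r ∂ν := by
    filter_upwards [hF'.prodMk_left] with y hy
    have h1 : ‖mollify m f y - f y‖ₑ ≤ ∫⁻ z, ‖f (y - z) - f y‖ₑ ∂ν := by
      rw [mollify_sub_self m hfl y]
      refine (enorm_integral_le_lintegral_enorm _).trans (le_of_eq ?_)
      rw [hν, lintegral_withDensity_eq_lintegral_mul₀' hmeas.aemeasurable]
      · refine lintegral_congr fun z => ?_
        simp only [Pi.mul_apply]
        rw [enorm_mul, Real.enorm_of_nonneg (mollKernel_nonneg m z)]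
      · exact hy.enorm
    -- Jensen, as monotonicity of `L^r` norms in the exponent under a probability measure.
    have h2 : ∫⁻ z, ‖f (y - z) - f y‖ₑ ∂ν ≤
        (∫⁻ z, ‖f (y - z) - f y‖ₑ ^ r ∂ν) ^ (1 / r) := by
      have := eLpNorm_le_eLpNorm_of_exponent_le (μ := ν) hr1 hy
      rw [eLpNorm_one_eq_lintegral_enorm, eLpNorm_eq_lintegral_rpow_enorm_toReal hR0
        ENNReal.ofReal_ne_top, ENNReal.toReal_ofReal hr0.le] at this
      exact this
    calc ‖mollify m f y - f y‖ₑ ^ r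
        ≤ ((∫⁻ z, ‖f (y - z) - f y‖ₑ ^ r ∂ν) ^ (1 / r)) ^ r :=
          ENNReal.rpow_le_rpow (h1.trans h2) hr0.le
      _ = _ := by rw [← ENNReal.rpow_mul, one_div_mul_cancel hr0.ne', ENNReal.rpow_one]
  rw [eLpNorm_eq_lintegral_rpow_enorm_toReal hR0 ENNReal.ofReal_ne_top,
    ENNReal.toReal_ofReal hr0.le, one_div, ENNReal.rpow_inv_le_iff hr0]
  have hinner : ∀ᵐ z ∂ν, ∫⁻ y, ‖f (y - z) - f y‖ₑ ^ r ≤ ε ^ r := by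
    have hsup : ∀ᵐ z ∂ν, mollKernel n m z ≠ 0 := by
      rw [hν, ae_withDensity_iff hmeas]
      refine ae_of_all _ fun z hz h0 => hz ?_
      rw [h0, ENNReal.ofReal_zero]
    filter_upwards [hsup] with z hz
    have hz' : z ∈ Metric.ball (0 : EuclideanSpace ℝ (Fin n)) (1 / (m + 1)) := by
      rw [← support_mollKernel]; exact hz
    have h1 := hball (y := z) (lt_trans (Metric.mem_ball.1 hz') hm)
    rwa [eLpNorm_eq_lintegral_rpow_enorm_toReal hR0 ENNReal.ofReal_ne_top,
      ENNReal.toReal_ofReal hr0.le, one_div, ENNReal.rpow_inv_le_iff hr0] at h1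
  calc ∫⁻ y, ‖mollify m f y - f y‖ₑ ^ r
      ≤ ∫⁻ y, ∫⁻ z, ‖f (y - z) - f y‖ₑ ^ r ∂ν := lintegral_mono_ae hpt
    _ = ∫⁻ z, (∫⁻ y, ‖f (y - z) - f y‖ₑ ^ r) ∂ν := lintegral_lintegral_swap hFm
    _ ≤ ∫⁻ _, ε ^ r ∂ν := lintegral_mono_ae hinner
    _ = ε ^ r := by simp

/-- Mollification commutes with weak derivatives. -/
theorem fderiv_mollify_indicator {U K : Set (EuclideanSpace ℝ (Fin n))} (hK : IsCompact K)
    (hKU : K ⊆ U) {f g : EuclideanSpace ℝ (Fin n) → ℝ} {w : EuclideanSpace ℝ (Fin n)}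
    (hf : LocallyIntegrableOn f U)
    (hfg : ∀ θ : EuclideanSpace ℝ (Fin n) → ℝ, ContDiff ℝ ∞ θ → HasCompactSupport θ →
      tsupport θ ⊆ U → ∫ y, f y * fderiv ℝ θ y w = -∫ y, g y * θ y)
    {m : ℕ} {y : EuclideanSpace ℝ (Fin n)} (hy : Metric.closedBall y (1 / (m + 1)) ⊆ K) :
    fderiv ℝ (mollify m (K.indicator f)) y w = mollify m (K.indicator g) y := by
  have hfi : Integrable (K.indicator f) :=
    (integrable_indicator_iff hK.measurableSet).2 (hf.integrableOn_compact_subset hKU hK)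
  have hfl : LocallyIntegrable (K.indicator f) := hfi.locallyIntegrable
  have hd := (hasCompactSupport_mollKernel m).hasFDerivAt_convolution_left
    (ContinuousLinearMap.lsmul ℝ ℝ) ((contDiff_mollKernel (n := n) m).of_le (by simp)) hfl y
  have hd' : fderiv ℝ (mollify m (K.indicator f)) y = _ := hd.fderiv
  -- The kernel reflected at `y` is the test function. Its support lies in `K`, so the indicator is
  -- not seen.
  set θ : EuclideanSpace ℝ (Fin n) → ℝ := fun z => mollKernel n m (y - z)
  have hθs : ∀ z, z ∉ K → θ z = 0 ∧ fderiv ℝ (mollKernel n m) (y - z) = 0 := by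
    intro z hz
    have hz' : y - z ∉ tsupport (mollKernel n m) := by
      rw [tsupport_mollKernel]
      intro h
      refine hz (hy ?_)
      rwa [mem_closedBall_zero_iff, ← dist_eq_norm, dist_comm] at h
    exact ⟨image_eq_zero_of_notMem_tsupport (f := mollKernel n m) hz', by
      by_contra hne
      exact hz' (support_fderiv_subset ℝ hne)⟩
  have hθsupp : tsupport θ ⊆ K := by
    refine closure_minimal (fun z hz => ?_) hK.isClosed
    by_contra h
    exact hz (hθs z h).1
  have hθc : HasCompactSupport θ := HasCompactSupport.of_support_subset_isCompact hK
    (subset_closure.trans hθsupp)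
  have hθd : ContDiff ℝ ∞ θ := (contDiff_mollKernel m).comp (contDiff_const.sub contDiff_id)
  have hθf : ∀ z, fderiv ℝ θ z w = -fderiv ℝ (mollKernel n m) (y - z) w := by
    intro z
    have h1 : HasFDerivAt θ ((fderiv ℝ (mollKernel n m) (y - z)).comp
        (-(ContinuousLinearMap.id ℝ (EuclideanSpace ℝ (Fin n))))) z := by
      have h2 := ((contDiff_mollKernel (n := n) m).differentiable (by simp) (y - z)).hasFDerivAt
      exact h2.comp z ((hasFDerivAt_id z).const_sub y)
    rw [h1.fderiv]
    simp
  have key := hfg θ hθd hθc (hθsupp.trans hKU)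
  have hcont : Continuous (fderiv ℝ (mollKernel n m)) :=
    (contDiff_mollKernel m).continuous_fderiv (by simp)
  have hex := ((hasCompactSupport_mollKernel (n := n) m).fderiv ℝ).convolutionExists_left
    ((ContinuousLinearMap.lsmul ℝ ℝ).precompL (EuclideanSpace ℝ (Fin n))) hcont hfl y
  rw [hd', convolution_def, ContinuousLinearMap.integral_apply hex]
  simp only [ContinuousLinearMap.precompL_apply, ContinuousLinearMap.lsmul_apply, smul_eq_mul]
  rw [← integral_sub_left_eq_self _ _ y, mollify_apply']
  simp only [sub_sub_cancel]
  have e1 : ∫ z, fderiv ℝ (mollKernel n m) (y - z) w * K.indicator f z =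
      -∫ z, f z * fderiv ℝ θ z w := by
    rw [← integral_neg]
    refine integral_congr_ae (ae_of_all _ fun z => ?_)
    simp only [hθf]
    by_cases hz : z ∈ K
    · rw [Set.indicator_of_mem hz]; ring
    · rw [(hθs z hz).2]; simp
  rw [e1, key, neg_neg]
  refine integral_congr_ae (ae_of_all _ fun z => ?_)
  by_cases hz : z ∈ K
  · simp only [Set.indicator_of_mem hz, θ]; ring
  · simp only [(hθs z hz).1, Set.indicator_of_notMem hz]; simp

/-- A function with zero weak derivatives is almost everywhere locally constant. -/
theorem ae_const_of_weak_deriv_zero {U : Set (EuclideanSpace ℝ (Fin n))}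
    {f : EuclideanSpace ℝ (Fin n) → ℝ} (hf : LocallyIntegrableOn f U)
    (hfg : ∀ w, ∀ θ : EuclideanSpace ℝ (Fin n) → ℝ, ContDiff ℝ ∞ θ → HasCompactSupport θ →
      tsupport θ ⊆ U → ∫ y, f y * fderiv ℝ θ y w = 0)
    {y₀ : EuclideanSpace ℝ (Fin n)} {R : ℝ} (hR : 0 < R) (hball : Metric.closedBall y₀ R ⊆ U) :
    ∃ c, ∀ᵐ y, y ∈ Metric.ball y₀ (R / 2) → f y = c := by
  set K := Metric.closedBall y₀ R with hKdef
  have hK : IsCompact K := isCompact_closedBall _ _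
  have hfi : Integrable (K.indicator f) :=
    (integrable_indicator_iff hK.measurableSet).2 (hf.integrableOn_compact_subset hball hK)
  have hae := ae_tendsto_mollify hfi.locallyIntegrable
  have hm : ∀ᶠ m in atTop, (mollifier n m).rOut < R / 2 :=
    (tendsto_mollifier_rOut n).eventually (gt_mem_nhds (half_pos hR))
  -- On the half ball, once the radius is below `R / 2`, the mollifications have zero derivative and
  -- are constant; almost everywhere convergence passes this to `f`.
  have hconst : ∀ᶠ m in atTop, ∀ y ∈ Metric.ball y₀ (R / 2), ∀ y' ∈ Metric.ball y₀ (R / 2),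
      mollify m (K.indicator f) y = mollify m (K.indicator f) y' := by
    filter_upwards [hm] with m hm y hy y' hy'
    have hdiff := (contDiff_mollify m hfi.locallyIntegrable).differentiable (by simp)
    refine (convex_ball y₀ (R / 2)).is_const_of_fderivWithin_eq_zero (𝕜 := ℝ)
      hdiff.differentiableOn (fun z hz => ?_) hy hy'
    rw [fderivWithin_of_isOpen Metric.isOpen_ball hz]
    ext w
    rw [fderiv_mollify_indicator (g := fun _ => 0) hK hball hf (fun θ h1 h2 h3 => by
      rw [hfg w θ h1 h2 h3]; simp)]
    · simp [mollify_apply]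
    · intro x hx
      rw [hKdef, Metric.mem_closedBall]
      have h1 := Metric.mem_closedBall.1 hx
      have h2 := Metric.mem_ball.1 hz
      have h3 : (1 : ℝ) / (m + 1) < R / 2 := hm
      linarith [dist_triangle x z y₀]
  have hpos : 0 < volume (Metric.ball y₀ (R / 2)) := Metric.measure_ball_pos _ _ (half_pos hR)
  obtain ⟨y₁, hy₁, hy₁t⟩ : ∃ y₁ ∈ Metric.ball y₀ (R / 2),
      Tendsto (fun m => mollify m (K.indicator f) y₁) atTop (𝓝 (K.indicator f y₁)) := by
    by_contra hcon
    push Not at hcon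
    have : volume (Metric.ball y₀ (R / 2)) = 0 := measure_mono_null (fun y hy => hcon y hy) hae
    exact hpos.ne' this
  refine ⟨K.indicator f y₁, ?_⟩
  filter_upwards [hae] with y hy hyb
  have hyK : y ∈ K := Metric.ball_subset_closedBall
    (Metric.ball_subset_ball (by linarith) hyb)
  rw [← Set.indicator_of_mem hyK f]
  refine tendsto_nhds_unique hy (hy₁t.congr' ?_)
  filter_upwards [hconst] with m hm
  exact hm _ hy₁ _ hyb

end

/-! ### Coordinate vector fields and the metric in charts. -/

section

variable {n : ℕ} {M : Type*} [TopologicalSpace M] [ChartedSpace (EuclideanSpace ℝ (Fin n)) M]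

theorem coordVec_add (e : OpenPartialHomeomorph M (EuclideanSpace ℝ (Fin n)))
    (y w w' : EuclideanSpace ℝ (Fin n)) :
    coordVec e y (w + w') = coordVec e y w + coordVec e y w' :=
  map_add (mfderiv (𝓡 n) (𝓡 n) e.symm y) w w'

theorem coordVec_smul (e : OpenPartialHomeomorph M (EuclideanSpace ℝ (Fin n)))
    (y : EuclideanSpace ℝ (Fin n)) (c : ℝ) (w : EuclideanSpace ℝ (Fin n)) :
    coordVec e y (c • w) = c • coordVec e y w :=
  map_smul (mfderiv (𝓡 n) (𝓡 n) e.symm y) c w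

/-- The coordinates, in the chart `e`, of the vector field `X`. -/
def coords (e : OpenPartialHomeomorph M (EuclideanSpace ℝ (Fin n)))
    (X : (x : M) → TangentSpace (𝓡 n) x) (y : EuclideanSpace ℝ (Fin n)) :
    EuclideanSpace ℝ (Fin n) :=
  mfderiv (𝓡 n) (𝓡 n) e (e.symm y) (X (e.symm y))

/-- `coordVec e y` as a linear map. -/
def coordVecL (e : OpenPartialHomeomorph M (EuclideanSpace ℝ (Fin n)))
    (y : EuclideanSpace ℝ (Fin n)) :
    EuclideanSpace ℝ (Fin n) →ₗ[ℝ] TangentSpace (𝓡 n) (e.symm y) where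
  toFun := coordVec e y
  map_add' := coordVec_add e y
  map_smul' := coordVec_smul e y

theorem coordVec_eq_sum (e : OpenPartialHomeomorph M (EuclideanSpace ℝ (Fin n)))
    (y w : EuclideanSpace ℝ (Fin n)) :
    coordVec e y w = ∑ i, w i • coordVec e y (EuclideanSpace.single i 1) := by
  have h : w = ∑ i, w i • EuclideanSpace.single i (1 : ℝ) := by
    conv_lhs => rw [← (EuclideanSpace.basisFun (Fin n) ℝ).sum_repr w]
    simp
  have h2 : coordVecL e y w = ∑ i, w i • coordVecL e y (EuclideanSpace.single i 1) := by
    conv_lhs => rw [h]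
    rw [map_sum]
    simp only [map_smul]
  exact h2

section Manifold

variable [IsManifold (𝓡 n) ∞ M]

theorem mdifferentiable_of_mem_atlas' {e : OpenPartialHomeomorph M (EuclideanSpace ℝ (Fin n))}
    (he : e ∈ atlas (EuclideanSpace ℝ (Fin n)) M) : e.MDifferentiable (𝓡 n) (𝓡 n) :=
  mdifferentiable_of_mem_atlas he

theorem coordVec_coords {e : OpenPartialHomeomorph M (EuclideanSpace ℝ (Fin n))}
    (he : e ∈ atlas (EuclideanSpace ℝ (Fin n)) M) (X : (x : M) → TangentSpace (𝓡 n) x)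
    {y : EuclideanSpace ℝ (Fin n)} (hy : y ∈ e.target) :
    coordVec e y (coords e X y) = X (e.symm y) := by
  have h := (mdifferentiable_of_mem_atlas' he).symm_comp_deriv (e.map_target hy)
  have h2 := congrArg (fun L => L (X (e.symm y))) h
  simp only [ContinuousLinearMap.comp_apply] at h2
  unfold coordVec coords
  have h3 : e (e.symm y) = y := e.right_inv hy
  rw [h3] at h2
  exact h2

theorem coordVec_injective {e : OpenPartialHomeomorph M (EuclideanSpace ℝ (Fin n))}
    (he : e ∈ atlas (EuclideanSpace ℝ (Fin n)) M)
    {y : EuclideanSpace ℝ (Fin n)} (hy : y ∈ e.target) : Function.Injective (coordVecL e y) :=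
  (mdifferentiable_of_mem_atlas' he).symm.mfderiv_injective hy

theorem dirDeriv_coordVec {e : OpenPartialHomeomorph M (EuclideanSpace ℝ (Fin n))}
    (he : e ∈ atlas (EuclideanSpace ℝ (Fin n)) M) {ψ : M → ℝ}
    {y : EuclideanSpace ℝ (Fin n)} (hy : y ∈ e.target)
    (hψ : MDifferentiableAt (𝓡 n) 𝓘(ℝ, ℝ) ψ (e.symm y)) (w : EuclideanSpace ℝ (Fin n)) :
    dirDeriv ψ (e.symm y) (coordVec e y w) = fderiv ℝ (fun z => ψ (e.symm z)) y w := by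
  unfold dirDeriv coordVec
  rw [← mfderiv_eq_fderiv]
  have := mfderiv_comp y hψ ((mdifferentiable_of_mem_atlas' he).mdifferentiableAt_symm hy)
  have h2 := congrArg (fun L => L w) this
  exact h2.symm

/-- Continuity is stated in the total space of the tangent bundle, where continuity of the metric
applies. It comes from the tangent map of the smooth inverse chart. -/
theorem continuousOn_coordVec {e : OpenPartialHomeomorph M (EuclideanSpace ℝ (Fin n))}
    (he : e ∈ atlas (EuclideanSpace ℝ (Fin n)) M) :
    ContinuousOn (fun p : EuclideanSpace ℝ (Fin n) × EuclideanSpace ℝ (Fin n) =>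
      (⟨e.symm p.1, coordVec e p.1 p.2⟩ : TangentBundle (𝓡 n) M)) (e.target ×ˢ Set.univ) := by
  have hs : ContMDiffOn (𝓡 n) (𝓡 n) ∞ e.symm e.target :=
    contMDiffOn_symm_of_mem_maximalAtlas (IsManifold.subset_maximalAtlas he)
  have h1 := hs.continuousOn_tangentMapWithin (by simp) e.open_target.uniqueMDiffOn
  have h2 : Continuous (fun p : EuclideanSpace ℝ (Fin n) × EuclideanSpace ℝ (Fin n) =>
      (⟨p.1, p.2⟩ : TangentBundle (𝓡 n) (EuclideanSpace ℝ (Fin n)))) :=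
    (tangentBundleModelSpaceHomeomorph (𝓡 n)).symm.continuous
  have h3 := h1.comp h2.continuousOn (s := e.target ×ˢ Set.univ) (fun p hp => hp.1)
  refine h3.congr fun p hp => ?_
  simp only [Function.comp, tangentMapWithin]
  rw [mfderivWithin_of_isOpen e.open_target hp.1]
  rfl

end Manifold

section Riemannian

variable [RiemannianBundle (fun x : M => TangentSpace (𝓡 n) x)]

theorem inner_coordVec_eq_sum (e : OpenPartialHomeomorph M (EuclideanSpace ℝ (Fin n)))
    (y w : EuclideanSpace ℝ (Fin n)) (v : TangentSpace (𝓡 n) (e.symm y)) :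
    inner ℝ v (coordVec e y w) =
      ∑ i, w i * inner ℝ v (coordVec e y (EuclideanSpace.single i 1)) := by
  rw [coordVec_eq_sum, inner_sum]
  simp only [inner_smul_right]

variable [IsManifold (𝓡 n) ∞ M]
  [IsContMDiffRiemannianBundle (𝓡 n) ∞ (EuclideanSpace ℝ (Fin n))
    (fun x : M => TangentSpace (𝓡 n) x)]

theorem isContinuousRiemannianBundle_tangent :
    IsContinuousRiemannianBundle (EuclideanSpace ℝ (Fin n))
      (fun x : M => TangentSpace (𝓡 n) x) := by
  obtain ⟨g, hg, h⟩ := IsContMDiffRiemannianBundle.exists_contMDiff (IB := 𝓡 n) (n := ∞)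
    (F := EuclideanSpace ℝ (Fin n)) (E := fun x : M => TangentSpace (𝓡 n) x)
  exact ⟨g, hg.continuous, h⟩

theorem continuousOn_inner_coordVec {e : OpenPartialHomeomorph M (EuclideanSpace ℝ (Fin n))}
    (he : e ∈ atlas (EuclideanSpace ℝ (Fin n)) M) :
    ContinuousOn (fun p : EuclideanSpace ℝ (Fin n) × EuclideanSpace ℝ (Fin n) ×
        EuclideanSpace ℝ (Fin n) =>
      (inner ℝ (coordVec e p.1 p.2.1) (coordVec e p.1 p.2.2) : ℝ)) (e.target ×ˢ Set.univ) := by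
  have := isContinuousRiemannianBundle_tangent (n := n) (M := M)
  have h := continuousOn_coordVec he
  refine ContinuousOn.inner_bundle (F := EuclideanSpace ℝ (Fin n))
    (E := fun x : M => TangentSpace (𝓡 n) x) (b := fun p : EuclideanSpace ℝ (Fin n) × EuclideanSpace ℝ (Fin n) ×
      EuclideanSpace ℝ (Fin n) => e.symm p.1)
    (v := fun p => coordVec e p.1 p.2.1) (w := fun p => coordVec e p.1 p.2.2) ?_ ?_
  · exact h.comp (s := e.target ×ˢ Set.univ) (f := fun p : EuclideanSpace ℝ (Fin n) × EuclideanSpace ℝ (Fin n) ×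
      EuclideanSpace ℝ (Fin n) => (p.1, p.2.1)) (by fun_prop) (fun p hp => ⟨hp.1, trivial⟩)
  · exact h.comp (s := e.target ×ˢ Set.univ) (f := fun p : EuclideanSpace ℝ (Fin n) × EuclideanSpace ℝ (Fin n) ×
      EuclideanSpace ℝ (Fin n) => (p.1, p.2.2)) (by fun_prop) (fun p hp => ⟨hp.1, trivial⟩)

theorem continuousOn_norm_coordVec {e : OpenPartialHomeomorph M (EuclideanSpace ℝ (Fin n))}
    (he : e ∈ atlas (EuclideanSpace ℝ (Fin n)) M) :
    ContinuousOn (fun p : EuclideanSpace ℝ (Fin n) × EuclideanSpace ℝ (Fin n) =>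
      ‖coordVec e p.1 p.2‖) (e.target ×ˢ Set.univ) := by
  have h := ((continuousOn_inner_coordVec he).comp (f := fun p : EuclideanSpace ℝ (Fin n) ×
    EuclideanSpace ℝ (Fin n) => (p.1, p.2, p.2)) (s := e.target ×ˢ Set.univ) (by fun_prop)
    (fun p hp => ⟨hp.1, trivial⟩)).sqrt
  refine h.congr fun p _ => ?_
  simp only [Function.comp]
  rw [norm_eq_sqrt_real_inner]

theorem continuousOn_gramMatrix {e : OpenPartialHomeomorph M (EuclideanSpace ℝ (Fin n))}
    (he : e ∈ atlas (EuclideanSpace ℝ (Fin n)) M) :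
    ContinuousOn (gramMatrix e) e.target := by
  refine continuousOn_pi.2 fun i => continuousOn_pi.2 fun j => ?_
  exact (continuousOn_inner_coordVec he).comp (f := fun y =>
    (y, EuclideanSpace.single i 1, EuclideanSpace.single j 1)) (by fun_prop)
    (fun y hy => ⟨hy, trivial⟩)

omit [IsContMDiffRiemannianBundle (𝓡 n) ∞ (EuclideanSpace ℝ (Fin n))
    (fun x : M => TangentSpace (𝓡 n) x)] in
theorem det_gramMatrix_pos {e : OpenPartialHomeomorph M (EuclideanSpace ℝ (Fin n))}
    (he : e ∈ atlas (EuclideanSpace ℝ (Fin n)) M) {y : EuclideanSpace ℝ (Fin n)}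
    (hy : y ∈ e.target) : 0 < (gramMatrix e y).det := by
  have hli : LinearIndependent ℝ (fun i => coordVecL e y (EuclideanSpace.single i 1)) := by
    have h1 := (EuclideanSpace.basisFun (Fin n) ℝ).toBasis.linearIndependent
    have h2 := h1.map' (coordVecL e y) (LinearMap.ker_eq_bot.2 (coordVec_injective he hy))
    have h3 : (fun i => coordVecL e y (EuclideanSpace.single i 1)) =
        coordVecL e y ∘ (EuclideanSpace.basisFun (Fin n) ℝ).toBasis := by
      ext i
      simp
    rw [h3]
    exact h2
  exact (Matrix.posDef_gram_of_linearIndependent hli).det_pos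

/-- On compact subsets of a chart the Riemannian and the Euclidean norm are comparable. -/
theorem exists_norm_le_norm_coordVec {e : OpenPartialHomeomorph M (EuclideanSpace ℝ (Fin n))}
    (he : e ∈ atlas (EuclideanSpace ℝ (Fin n)) M) {K : Set (EuclideanSpace ℝ (Fin n))}
    (hK : IsCompact K) (hKe : K ⊆ e.target) :
    ∃ C > 0, ∀ y ∈ K, ∀ w : EuclideanSpace ℝ (Fin n),
      ‖w‖ ≤ C * ‖coordVec e y w‖ ∧ ‖coordVec e y w‖ ≤ C * ‖w‖ := by
  -- By homogeneity unit vectors suffice; on the compact set `K × sphere` the norm is continuous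
  -- and, by injectivity of the differential, positive.
  have hS : IsCompact (K ×ˢ Metric.sphere (0 : EuclideanSpace ℝ (Fin n)) 1) :=
    hK.prod (isCompact_sphere _ _)
  have hc := (continuousOn_norm_coordVec he).mono (t := K ×ˢ Metric.sphere 0 1)
    (fun p hp => ⟨hKe hp.1, trivial⟩)
  have hpos : ∀ p ∈ K ×ˢ Metric.sphere (0 : EuclideanSpace ℝ (Fin n)) 1,
      0 < ‖coordVec e p.1 p.2‖ := by
    intro p hp
    refine norm_pos_iff.2 fun h0 => ?_
    have h1 : coordVecL e p.1 p.2 = coordVecL e p.1 0 := by rw [map_zero]; exact h0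
    have h2 := coordVec_injective he (hKe hp.1) h1
    have h3 := hp.2
    rw [h2] at h3
    simp at h3
  obtain ⟨c, hc0, hcle⟩ := hS.exists_forall_le' hc (a := 0) hpos
  obtain ⟨B, hB⟩ := hS.bddAbove_image hc
  have hB' : ∀ p ∈ K ×ˢ Metric.sphere (0 : EuclideanSpace ℝ (Fin n)) 1,
      ‖coordVec e p.1 p.2‖ ≤ B := fun p hp => hB (Set.mem_image_of_mem _ hp)
  refine ⟨max (max c⁻¹ B) 1, by positivity, fun y hy w => ?_⟩
  rcases eq_or_ne w 0 with rfl | hw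
  · have : coordVec e y 0 = 0 := map_zero (coordVecL e y)
    simp [this]
  · have hwn : 0 < ‖w‖ := norm_pos_iff.2 hw
    have hmem : (y, ‖w‖⁻¹ • w) ∈ K ×ˢ Metric.sphere (0 : EuclideanSpace ℝ (Fin n)) 1 :=
      ⟨hy, by simp [norm_smul, hwn.ne']⟩
    have e1 : ‖coordVec e y (‖w‖⁻¹ • w)‖ = ‖w‖⁻¹ * ‖coordVec e y w‖ := by
      rw [coordVec_smul, norm_smul, norm_inv, norm_norm]
    have h1 := hcle _ hmem
    have h2 := hB' _ hmem
    simp only [e1] at h1 h2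
    rw [inv_mul_eq_div] at h1 h2
    rw [le_div_iff₀ hwn] at h1
    rw [div_le_iff₀ hwn] at h2
    constructor
    · calc ‖w‖ = c⁻¹ * (c * ‖w‖) := by field_simp
        _ ≤ c⁻¹ * ‖coordVec e y w‖ := by gcongr
        _ ≤ _ := by gcongr; exact (le_max_left _ _).trans (le_max_left _ _)
    · refine h2.trans ?_
      gcongr
      exact (le_max_right _ _).trans (le_max_left _ _)

/-- At nearby points of a compact subset of a chart the metrics differ at most by a factor `2`. -/
theorem exists_norm_coordVec_le_two_mul {e : OpenPartialHomeomorph M (EuclideanSpace ℝ (Fin n))}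
    (he : e ∈ atlas (EuclideanSpace ℝ (Fin n)) M) {K : Set (EuclideanSpace ℝ (Fin n))}
    (hK : IsCompact K) (hKe : K ⊆ e.target) :
    ∃ ε > 0, ∀ y ∈ K, ∀ z, dist z y < ε → z ∈ e.target ∧
      ∀ w : EuclideanSpace ℝ (Fin n), ‖coordVec e z w‖ ≤ 2 * ‖coordVec e y w‖ := by
  obtain ⟨ε₀, hε₀, hthick⟩ := hK.exists_cthickening_subset_open e.open_target hKe
  have hK' : IsCompact (Metric.cthickening ε₀ K) := hK.cthickening
  have hS : IsCompact (Metric.cthickening ε₀ K ×ˢ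
      Metric.sphere (0 : EuclideanSpace ℝ (Fin n)) 1) := hK'.prod (isCompact_sphere _ _)
  have hc := (continuousOn_norm_coordVec he).mono (t := Metric.cthickening ε₀ K ×ˢ
    Metric.sphere 0 1) (fun p hp => ⟨hthick hp.1, trivial⟩)
  have hu := hS.uniformContinuousOn_of_continuous hc
  obtain ⟨C, hC, hCle⟩ := exists_norm_le_norm_coordVec he hK hKe
  -- On unit vectors the norm at `y ∈ K` is at least `C⁻¹`, so an additive error `C⁻¹` costs at most
  -- a second copy of it.
  obtain ⟨δ, hδ, hunif⟩ := Metric.uniformContinuousOn_iff.1 hu C⁻¹ (by positivity)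
  refine ⟨min ε₀ δ, lt_min hε₀ hδ, fun y hy z hz => ?_⟩
  have hzK : z ∈ Metric.cthickening ε₀ K :=
    Metric.mem_cthickening_of_dist_le z y ε₀ K hy (hz.le.trans (min_le_left _ _))
  have hyK : y ∈ Metric.cthickening ε₀ K := Metric.self_subset_cthickening K hy
  refine ⟨hthick hzK, fun w => ?_⟩
  rcases eq_or_ne w 0 with rfl | hw
  · have h0 : ∀ y, coordVec e y 0 = 0 := fun y => map_zero (coordVecL e y)
    simp [h0]
  · have hwn : 0 < ‖w‖ := norm_pos_iff.2 hw
    have hmem : ‖w‖⁻¹ • w ∈ Metric.sphere (0 : EuclideanSpace ℝ (Fin n)) 1 := by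
      simp [norm_smul, hwn.ne']
    have h1 := hunif (z, ‖w‖⁻¹ • w) ⟨hzK, hmem⟩ (y, ‖w‖⁻¹ • w) ⟨hyK, hmem⟩ (by
      rw [Prod.dist_eq, dist_self, max_eq_left dist_nonneg]
      exact hz.trans_le (min_le_right _ _))
    have e1 : ∀ y, ‖coordVec e y (‖w‖⁻¹ • w)‖ = ‖w‖⁻¹ * ‖coordVec e y w‖ := fun y => by
      rw [coordVec_smul, norm_smul, norm_inv, norm_norm]
    simp only [e1] at h1
    rw [Real.dist_eq] at h1
    have h2 := (hCle y hy w).1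
    have h3 : ‖w‖⁻¹ * ‖coordVec e z w‖ ≤ ‖w‖⁻¹ * ‖coordVec e y w‖ + C⁻¹ := by
      linarith [(abs_lt.1 h1).2]
    have h4 := mul_le_mul_of_nonneg_left h3 hwn.le
    rw [← mul_assoc, mul_inv_cancel₀ hwn.ne', one_mul, mul_add, ← mul_assoc,
      mul_inv_cancel₀ hwn.ne', one_mul] at h4
    have h5 : ‖w‖ * C⁻¹ ≤ ‖coordVec e y w‖ := by
      rw [← div_eq_mul_inv, div_le_iff₀ hC]; linarith
    linarith

end Riemannian

end

/-! ### The Riemannian and weighted volumes in charts. -/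

theorem measurableSet_preimage_inter {X Y : Type*} [TopologicalSpace X] [MeasurableSpace X]
    [OpensMeasurableSpace X] [TopologicalSpace Y] [MeasurableSpace Y] [BorelSpace Y] {f : X → Y}
    {s : Set X} (hf : ContinuousOn f s) (hs : MeasurableSet s) {A : Set Y} (hA : MeasurableSet A) :
    MeasurableSet (f ⁻¹' A ∩ s) := by
  have h1 : Measurable (s.domRestrict f) :=
    (continuousOn_iff_continuous_domRestrict.1 hf).measurable
  have h2 := hs.subtype_image (h1 hA)
  convert h2 using 1
  ext y
  simp [and_comm]

section

variable {n : ℕ} {M : Type*} [TopologicalSpace M] [ChartedSpace (EuclideanSpace ℝ (Fin n)) M]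
  [IsManifold (𝓡 n) ∞ M]

theorem mfderiv_coordVec {e e' : OpenPartialHomeomorph M (EuclideanSpace ℝ (Fin n))}
    (he : e ∈ atlas (EuclideanSpace ℝ (Fin n)) M) (he' : e' ∈ atlas (EuclideanSpace ℝ (Fin n)) M)
    {y : EuclideanSpace ℝ (Fin n)} (hy : y ∈ e.target) (hy' : e.symm y ∈ e'.source) :
    HasFDerivAt (fun z => e' (e.symm z)) (fderiv ℝ (fun z => e' (e.symm z)) y) y ∧
    ∀ w : EuclideanSpace ℝ (Fin n), mfderiv (𝓡 n) (𝓡 n) e' (e.symm y) (coordVec e y w) =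
      fderiv ℝ (fun z => e' (e.symm z)) y w := by
  have h1 := (mdifferentiable_of_mem_atlas' he').mdifferentiableAt hy'
  have h2 := (mdifferentiable_of_mem_atlas' he).mdifferentiableAt_symm hy
  constructor
  · exact (mdifferentiableAt_iff_differentiableAt.1 (h1.comp y h2)).hasFDerivAt
  · intro w
    rw [← mfderiv_eq_fderiv]
    have := mfderiv_comp y h1 h2
    exact (congrArg (fun L => L w) this).symm

section Riemannian

variable [RiemannianBundle (fun x : M => TangentSpace (𝓡 n) x)]

theorem inner_coordVec_mfderiv {e : OpenPartialHomeomorph M (EuclideanSpace ℝ (Fin n))}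
    (he : e ∈ atlas (EuclideanSpace ℝ (Fin n)) M) {x : M} (hx : x ∈ e.source)
    (v v' : TangentSpace (𝓡 n) x) :
    inner ℝ (coordVec e (e x) (mfderiv (𝓡 n) (𝓡 n) e x v))
      (coordVec e (e x) (mfderiv (𝓡 n) (𝓡 n) e x v')) = inner ℝ v v' := by
  obtain ⟨y, hy, rfl⟩ : ∃ y ∈ e.target, e.symm y = x := ⟨e x, e.map_source hx, e.left_inv hx⟩
  -- Quantifying over `Y` lets the equation `e (e.symm y) = y` be used without rewriting inside
  -- dependent tangent spaces.
  have key : ∀ Y, Y = y → (inner ℝ (coordVec e Y (mfderiv (𝓡 n) (𝓡 n) e (e.symm y) v))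
      (coordVec e Y (mfderiv (𝓡 n) (𝓡 n) e (e.symm y) v')) : ℝ) = inner ℝ v v' := by
    rintro Y rfl
    have h : ∀ v : TangentSpace (𝓡 n) (e.symm Y),
        coordVec e Y (mfderiv (𝓡 n) (𝓡 n) e (e.symm Y) v) = v := by
      intro v
      have h1 := (mdifferentiable_of_mem_atlas' he).symm_comp_deriv hx
      have h2 := congrArg (fun L => L v) h1
      simp only [ContinuousLinearMap.comp_apply] at h2
      rw [e.right_inv hy] at h2
      exact h2
    rw [h, h]
  exact key _ (e.right_inv hy)

/-- The Gram matrix transforms as `Aᵀ G' A` with `A` the Jacobian matrix of the transition map. The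
factor `|det A|` is the one in the change of variables formula, which makes the chart volumes agree
on overlaps. -/
theorem gramMatrix_transition {e e' : OpenPartialHomeomorph M (EuclideanSpace ℝ (Fin n))}
    (he : e ∈ atlas (EuclideanSpace ℝ (Fin n)) M) (he' : e' ∈ atlas (EuclideanSpace ℝ (Fin n)) M)
    {y : EuclideanSpace ℝ (Fin n)} (hy : y ∈ e.target) (hy' : e.symm y ∈ e'.source) :
    Real.sqrt (gramMatrix e y).det =
      |(fderiv ℝ (fun z => e' (e.symm z)) y).det| *
        Real.sqrt (gramMatrix e' (e' (e.symm y))).det := by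
  set J := fderiv ℝ (fun z => e' (e.symm z)) y
  set b := (EuclideanSpace.basisFun (Fin n) ℝ).toBasis
  set A := LinearMap.toMatrix b b (J : EuclideanSpace ℝ (Fin n) →ₗ[ℝ] EuclideanSpace ℝ (Fin n))
  have hA : ∀ k i, A k i = J (EuclideanSpace.single i 1) k := by
    intro k i
    simp [A, b, LinearMap.toMatrix_apply]
  have hG : gramMatrix e y = A.transpose * gramMatrix e' (e' (e.symm y)) * A := by
    ext i j
    have h1 : gramMatrix e y i j = inner ℝ (coordVec e' (e' (e.symm y))
        (J (EuclideanSpace.single i 1))) (coordVec e' (e' (e.symm y))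
        (J (EuclideanSpace.single j 1))) := by
      have h2 := (mfderiv_coordVec he he' hy hy').2
      have h3 := inner_coordVec_mfderiv he' hy' (coordVec e y (EuclideanSpace.single i 1))
        (coordVec e y (EuclideanSpace.single j 1))
      rw [h2, h2] at h3
      exact h3.symm
    rw [h1, inner_coordVec_eq_sum, Matrix.mul_apply]
    refine Finset.sum_congr rfl fun k _ => ?_
    rw [hA, real_inner_comm, inner_coordVec_eq_sum, Matrix.mul_apply, mul_comm]
    congr 1
    refine Finset.sum_congr rfl fun l _ => ?_
    rw [Matrix.transpose_apply, hA, real_inner_comm]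
    rfl
  have hdet : A.det = J.det := LinearMap.det_toMatrix b _
  rw [hG, Matrix.det_mul, Matrix.det_mul, Matrix.det_transpose, hdet,
    show J.det * (gramMatrix e' (e' (e.symm y))).det * J.det =
      J.det ^ 2 * (gramMatrix e' (e' (e.symm y))).det by ring,
    Real.sqrt_mul (sq_nonneg _), Real.sqrt_sq_eq_abs]

variable [MeasurableSpace M] [BorelSpace M]

omit [ChartedSpace (EuclideanSpace ℝ (Fin n)) M] [IsManifold (𝓡 n) ∞ M]
  [RiemannianBundle (fun x : M => TangentSpace (𝓡 n) x)] in
theorem measurableSet_target_inter_preimage (e : OpenPartialHomeomorph M (EuclideanSpace ℝ (Fin n)))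
    {A : Set M} (hA : MeasurableSet A) : MeasurableSet (e.symm ⁻¹' A ∩ e.target) :=
  measurableSet_preimage_inter e.continuousOn_symm e.open_target.measurableSet hA

omit [IsManifold (𝓡 n) ∞ M] in
theorem chartVolume_apply (e : OpenPartialHomeomorph M (EuclideanSpace ℝ (Fin n)))
    {A : Set M} (hA : MeasurableSet A) :
    chartVolume e A = ∫⁻ y in e.symm ⁻¹' A ∩ e.target,
      ENNReal.ofReal (Real.sqrt (gramMatrix e y).det) := by
  unfold chartVolume
  rw [Measure.map_apply_of_aemeasurable _ hA, withDensity_apply',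
    Measure.restrict_restrict' e.open_target.measurableSet]
  have h1 : AEMeasurable e.symm (volume.restrict e.target) :=
    e.continuousOn_symm.aemeasurable e.open_target.measurableSet
  exact h1.mono_ac (withDensity_absolutelyContinuous _ _)

theorem chartVolume_eq_chartVolume {e e' : OpenPartialHomeomorph M (EuclideanSpace ℝ (Fin n))}
    (he : e ∈ atlas (EuclideanSpace ℝ (Fin n)) M) (he' : e' ∈ atlas (EuclideanSpace ℝ (Fin n)) M)
    {A : Set M} (hA : MeasurableSet A) (hAe : A ⊆ e.source) (hAe' : A ⊆ e'.source) :
    chartVolume e A = chartVolume e' A := by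
  rw [chartVolume_apply e hA, chartVolume_apply e' hA]
  have himg : (fun z => e' (e.symm z)) '' (e.symm ⁻¹' A ∩ e.target) = e'.symm ⁻¹' A ∩ e'.target := by
    ext z
    constructor
    · rintro ⟨y, ⟨hyA, hy⟩, rfl⟩
      refine ⟨?_, e'.map_source (hAe' hyA)⟩
      change e'.symm (e' (e.symm y)) ∈ A
      rw [e'.left_inv (hAe' hyA)]
      exact hyA
    · rintro ⟨hzA, hz⟩
      refine ⟨e (e'.symm z), ⟨?_, e.map_source (hAe hzA)⟩, ?_⟩
      · change e.symm (e (e'.symm z)) ∈ A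
        rw [e.left_inv (hAe hzA)]
        exact hzA
      · simp only
        rw [e.left_inv (hAe hzA), e'.right_inv hz]
  rw [← himg, lintegral_image_eq_lintegral_abs_det_fderiv_mul volume
    (measurableSet_target_inter_preimage e hA)
    (fun y hy => ((mfderiv_coordVec he he' hy.2 (hAe' hy.1)).1).hasFDerivWithinAt)]
  · refine setLIntegral_congr_fun (measurableSet_target_inter_preimage e hA) fun y hy => ?_
    rw [gramMatrix_transition he he' hy.2 (hAe' hy.1), ENNReal.ofReal_mul (abs_nonneg _)]
  · intro y hy z hz hyz
    simp only at hyz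
    exact e.symm.injOn hy.2 hz.2 (e'.injOn (hAe' hy.1) (hAe' hz.1) hyz)

omit [IsManifold (𝓡 n) ∞ M] in
theorem chartVolume_inter_source (e : OpenPartialHomeomorph M (EuclideanSpace ℝ (Fin n)))
    {A : Set M} (hA : MeasurableSet A) : chartVolume e (A ∩ e.source) = chartVolume e A := by
  rw [chartVolume_apply e hA, chartVolume_apply e (hA.inter e.open_source.measurableSet)]
  congr 2
  ext y
  constructor
  · rintro ⟨h1, h2⟩; exact ⟨h1.1, h2⟩
  · rintro ⟨h1, h2⟩; exact ⟨⟨h1, e.map_target h2⟩, h2⟩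

/-- In a chart the Riemannian volume is given by the chart volume. -/
theorem riemannianVolume_apply {e : OpenPartialHomeomorph M (EuclideanSpace ℝ (Fin n))}
    (he : e ∈ atlas (EuclideanSpace ℝ (Fin n)) M) {A : Set M} (hA : MeasurableSet A)
    (hAe : A ⊆ e.source) : riemannianVolume n M A = chartVolume e A := by
  apply le_antisymm
  · set ν := chartVolume e + (riemannianVolume n M).restrict e.sourceᶜ
    have h1 : riemannianVolume n M ≤ ν := by
      refine iSup₂_le fun e' he' => Measure.le_iff.2 fun B hB => ?_
      have hs := e.open_source.measurableSet
      rw [← measure_inter_add_sdiff B hs]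
      refine add_le_add ?_ ?_
      · rw [← chartVolume_inter_source e' (hB.inter hs), chartVolume_eq_chartVolume he' he
          ((hB.inter hs).inter e'.open_source.measurableSet) Set.inter_subset_right
          (fun x hx => hx.1.2)]
        exact measure_mono fun x hx => hx.1.1
      · change _ ≤ (riemannianVolume n M).restrict e.sourceᶜ B
        rw [Measure.restrict_apply hB, ← Set.sdiff_eq]
        exact Measure.le_iff'.1 (le_iSup₂_of_le e' he' le_rfl) _
    refine (Measure.le_iff'.1 h1 A).trans (le_of_eq ?_)
    simp only [ν, Measure.add_apply]
    rw [Measure.restrict_apply hA]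
    have : A ∩ e.sourceᶜ = ∅ := by
      rw [← Set.sdiff_eq, Set.sdiff_eq_empty]; exact hAe
    rw [this, measure_empty, add_zero]
  · exact Measure.le_iff'.1 (le_iSup₂_of_le e he le_rfl) _

variable [IsContMDiffRiemannianBundle (𝓡 n) ∞ (EuclideanSpace ℝ (Fin n))
    (fun x : M => TangentSpace (𝓡 n) x)] {φ : M → ℝ}

/-- Two-sided bounds for the density of the weighted volume on a compact subset of a chart. -/
theorem weightedVolume_bounds (hφ : Continuous φ)
    {e : OpenPartialHomeomorph M (EuclideanSpace ℝ (Fin n))}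
    (he : e ∈ atlas (EuclideanSpace ℝ (Fin n)) M) {K : Set (EuclideanSpace ℝ (Fin n))}
    (hK : IsCompact K) (hKe : K ⊆ e.target) :
    ∃ C : ℝ≥0∞, C ≠ ⊤ ∧ ∀ A : Set M, MeasurableSet A → A ⊆ e.symm '' K →
      weightedVolume n φ A ≤ C * volume (e.symm ⁻¹' A ∩ K) ∧
      volume (e.symm ⁻¹' A ∩ K) ≤ C * weightedVolume n φ A := by
  -- The density of the weighted volume in the chart is continuous and positive, so compactness
  -- bounds it above by some `B` and below by some `c > 0`; the constant is the maximum of `B` and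
  -- `c⁻¹`.
  have hd : ContinuousOn (fun y => Real.sqrt (gramMatrix e y).det * Real.exp (-φ (e.symm y))) K := by
    have h1 : ContinuousOn (fun y => (gramMatrix e y).det) K :=
      (continuous_id.matrix_det).comp_continuousOn ((continuousOn_gramMatrix he).mono hKe)
    refine h1.sqrt.mul ?_
    exact Real.continuous_exp.comp_continuousOn
      ((hφ.comp_continuousOn (e.continuousOn_symm.mono hKe)).neg)
  have hpos : ∀ y ∈ K, 0 < Real.sqrt (gramMatrix e y).det * Real.exp (-φ (e.symm y)) :=
    fun y hy => mul_pos (Real.sqrt_pos.2 (det_gramMatrix_pos he (hKe hy))) (Real.exp_pos _)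
  obtain ⟨c, hc0, hc⟩ := hK.exists_forall_le' hd hpos
  obtain ⟨B, hB⟩ := hK.bddAbove_image hd
  have hB' : ∀ y ∈ K, Real.sqrt (gramMatrix e y).det * Real.exp (-φ (e.symm y)) ≤ B :=
    fun p hp => hB (Set.mem_image_of_mem _ hp)
  refine ⟨max (ENNReal.ofReal B) (ENNReal.ofReal c⁻¹), by simp, fun A hA hAK => ?_⟩
  have hAe : A ⊆ e.source := fun x hx => by
    obtain ⟨y, hy, rfl⟩ := hAK hx
    exact e.map_target (hKe hy)
  have hset : e.symm ⁻¹' A ∩ e.target = e.symm ⁻¹' A ∩ K := by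
    ext y
    constructor
    · rintro ⟨h1, h2⟩
      obtain ⟨z, hz, hzy⟩ := hAK h1
      have := e.symm.injOn (hKe hz) h2 hzy
      exact ⟨h1, this ▸ hz⟩
    · rintro ⟨h1, h2⟩; exact ⟨h1, hKe h2⟩
  have hS : MeasurableSet (e.symm ⁻¹' A ∩ K) := hset ▸ measurableSet_target_inter_preimage e hA
  have hrestr : (riemannianVolume n M).restrict A = (chartVolume e).restrict A := by
    ext D hD
    rw [Measure.restrict_apply hD, Measure.restrict_apply hD, riemannianVolume_apply he
      (hD.inter hA) (fun x hx => hAe hx.2)]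
  have hae : AEMeasurable e.symm (volume.restrict e.target) :=
    e.continuousOn_symm.aemeasurable e.open_target.measurableSet
  have hgm : AEMeasurable (fun y => ENNReal.ofReal (Real.sqrt (gramMatrix e y).det))
      (volume.restrict e.target) := by
    have h1 : ContinuousOn (fun y => (gramMatrix e y).det) e.target :=
      (continuous_id.matrix_det).comp_continuousOn (continuousOn_gramMatrix he)
    exact (h1.sqrt.aemeasurable e.open_target.measurableSet).ennreal_ofReal
  have hφm : Measurable fun x => ENNReal.ofReal (Real.exp (-φ x)) :=
    (Real.continuous_exp.comp hφ.neg).measurable.ennreal_ofReal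
  have hform : weightedVolume n φ A = ∫⁻ y in e.symm ⁻¹' A ∩ K,
      ENNReal.ofReal (Real.sqrt (gramMatrix e y).det * Real.exp (-φ (e.symm y))) := by
    unfold weightedVolume
    rw [withDensity_apply _ hA, hrestr]
    unfold chartVolume
    rw [← lintegral_indicator hA, lintegral_map' ((hφm.indicator hA).aemeasurable)
      (hae.mono_ac (withDensity_absolutelyContinuous _ _)),
      lintegral_withDensity_eq_lintegral_mul₀ (g := fun y => A.indicator
        (fun x => ENNReal.ofReal (Real.exp (-φ x))) (e.symm y)) hgm
        ((hφm.indicator hA).comp_aemeasurable hae),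
      ← hset, ← Measure.restrict_restrict' e.open_target.measurableSet]
    have hmA : NullMeasurableSet (e.symm ⁻¹' A) (volume.restrict e.target) := hae.nullMeasurable hA
    rw [← lintegral_indicator₀ hmA]
    refine lintegral_congr fun y => ?_
    rw [Pi.mul_apply]
    by_cases hyA : e.symm y ∈ A
    · rw [Set.indicator_of_mem hyA, Set.indicator_of_mem (Set.mem_preimage.2 hyA),
        ENNReal.ofReal_mul (Real.sqrt_nonneg _)]
    · rw [Set.indicator_of_notMem hyA, Set.indicator_of_notMem (by exact hyA), mul_zero]
  rw [hform]
  constructor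
  · calc _ ≤ ∫⁻ y in e.symm ⁻¹' A ∩ K, ENNReal.ofReal B :=
        setLIntegral_mono measurable_const fun y hy => ENNReal.ofReal_le_ofReal (hB' y hy.2)
      _ = ENNReal.ofReal B * volume (e.symm ⁻¹' A ∩ K) := by rw [setLIntegral_const]
      _ ≤ _ := by gcongr; exact le_max_left _ _
  · calc volume (e.symm ⁻¹' A ∩ K)
        = ENNReal.ofReal c⁻¹ * ∫⁻ y in e.symm ⁻¹' A ∩ K, ENNReal.ofReal c := by
          rw [setLIntegral_const, ← mul_assoc, ← ENNReal.ofReal_mul (inv_nonneg.2 hc0.le),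
            inv_mul_cancel₀ hc0.ne', ENNReal.ofReal_one, one_mul]
      _ ≤ ENNReal.ofReal c⁻¹ * ∫⁻ y in e.symm ⁻¹' A ∩ K,
          ENNReal.ofReal (Real.sqrt (gramMatrix e y).det * Real.exp (-φ (e.symm y))) := by
          gcongr ENNReal.ofReal c⁻¹ * ?_
          refine lintegral_mono_ae ?_
          filter_upwards [ae_restrict_mem hS] with y hy
          exact ENNReal.ofReal_le_ofReal (hc y hy.2)
      _ ≤ _ := by gcongr; exact le_max_right _ _

omit [ChartedSpace (EuclideanSpace ℝ (Fin n)) M] [IsManifold (𝓡 n) ∞ M]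
  [RiemannianBundle (fun x : M => TangentSpace (𝓡 n) x)]
  [IsContMDiffRiemannianBundle (𝓡 n) ∞ (EuclideanSpace ℝ (Fin n))
    (fun x : M => TangentSpace (𝓡 n) x)] in
theorem measurableSet_symm_image [T2Space M]
    {e : OpenPartialHomeomorph M (EuclideanSpace ℝ (Fin n))}
    {K : Set (EuclideanSpace ℝ (Fin n))} (hK : IsCompact K) (hKe : K ⊆ e.target) :
    MeasurableSet (e.symm '' K) :=
  (hK.image_of_continuousOn (e.continuousOn_symm.mono hKe)).measurableSet

/-- The weighted volume on a compact piece of a chart, read in the chart, is controlled by the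
Lebesgue measure, and conversely. -/
theorem exists_weightedVolume_le [T2Space M] (hφ : Continuous φ)
    {e : OpenPartialHomeomorph M (EuclideanSpace ℝ (Fin n))}
    (he : e ∈ atlas (EuclideanSpace ℝ (Fin n)) M) {K : Set (EuclideanSpace ℝ (Fin n))}
    (hK : IsCompact K) (hKe : K ⊆ e.target) :
    ∃ C : ℝ≥0∞, C ≠ ⊤ ∧
      ((weightedVolume n φ).restrict (e.symm '' K)).map e ≤ C • volume.restrict K ∧
      (volume.restrict K).map e.symm ≤ C • weightedVolume n φ := by
  obtain ⟨C, hC, h⟩ := weightedVolume_bounds hφ he hK hKe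
  have hKm := measurableSet_symm_image hK hKe
  refine ⟨C, hC, Measure.le_iff.2 fun B hB => ?_, Measure.le_iff.2 fun A hA => ?_⟩
  · have hae : AEMeasurable e ((weightedVolume n φ).restrict (e.symm '' K)) := by
      refine ContinuousOn.aemeasurable (e.continuousOn.mono ?_) hKm
      rintro _ ⟨y, hy, rfl⟩
      exact e.map_target (hKe hy)
    rw [Measure.map_apply_of_aemeasurable hae hB, Measure.restrict_apply₀ (hae.nullMeasurable hB)]
    have hA : MeasurableSet (e ⁻¹' B ∩ e.symm '' K) := by
      refine measurableSet_preimage_inter (e.continuousOn.mono ?_) hKm hB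
      rintro _ ⟨y, hy, rfl⟩
      exact e.map_target (hKe hy)
    refine (h _ hA Set.inter_subset_right).1.trans ?_
    rw [Measure.smul_apply, smul_eq_mul, Measure.restrict_apply hB]
    have hsub : e.symm ⁻¹' (e ⁻¹' B ∩ e.symm '' K) ∩ K ⊆ B ∩ K := by
      intro y hy
      refine ⟨?_, hy.2⟩
      have := hy.1.1
      rwa [Set.mem_preimage, e.right_inv (hKe hy.2)] at this
    exact mul_le_mul' le_rfl (measure_mono hsub)
  · have hae : AEMeasurable e.symm (volume.restrict K) :=
      (e.continuousOn_symm.mono hKe).aemeasurable hK.measurableSet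
    rw [Measure.map_apply_of_aemeasurable hae hA, Measure.restrict_apply₀ (hae.nullMeasurable hA),
      Measure.smul_apply, smul_eq_mul]
    have h1 := (h (A ∩ e.symm '' K) (hA.inter hKm) Set.inter_subset_right).2
    have h2 : e.symm ⁻¹' (A ∩ e.symm '' K) ∩ K = e.symm ⁻¹' A ∩ K := by
      ext y
      simp only [Set.mem_inter_iff, Set.mem_preimage, Set.mem_image]
      constructor
      · rintro ⟨⟨h1, _⟩, h2⟩; exact ⟨h1, h2⟩
      · rintro ⟨h1, h2⟩; exact ⟨⟨h1, y, h2, rfl⟩, h2⟩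
    rw [h2] at h1
    exact h1.trans (by gcongr; exact Set.inter_subset_left)

end Riemannian

end

/-! ### Measurability and `L^p` bounds passed between a chart and the manifold. -/

theorem aestronglyMeasurable_of_locally {X : Type*} [TopologicalSpace X]
    [SecondCountableTopology X] [MeasurableSpace X] {μ : Measure X} {f : X → ℝ}
    (h : ∀ x, ∃ s ∈ 𝓝 x, AEStronglyMeasurable f (μ.restrict s)) : AEStronglyMeasurable f μ := by
  choose s hs hf using h
  obtain ⟨t, htc, ht⟩ := TopologicalSpace.countable_cover_nhds hs
  have := htc.to_subtype
  have h1 : AEStronglyMeasurable f (μ.restrict (⋃ x : t, s x)) :=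
    aestronglyMeasurable_iUnion_iff.2 fun x => hf x
  rwa [← Set.biUnion_eq_iUnion t (fun x _ => s x), ht, Measure.restrict_univ] at h1

section

variable {n : ℕ} {M : Type*} [TopologicalSpace M] [ChartedSpace (EuclideanSpace ℝ (Fin n)) M]
  [IsManifold (𝓡 n) ∞ M]
  [RiemannianBundle (fun x : M => TangentSpace (𝓡 n) x)]
  [IsContMDiffRiemannianBundle (𝓡 n) ∞ (EuclideanSpace ℝ (Fin n))
    (fun x : M => TangentSpace (𝓡 n) x)] {φ : M → ℝ}

omit [IsManifold (𝓡 n) ∞ M] [RiemannianBundle (fun x : M => TangentSpace (𝓡 n) x)]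
  [IsContMDiffRiemannianBundle (𝓡 n) ∞ (EuclideanSpace ℝ (Fin n))
    (fun x : M => TangentSpace (𝓡 n) x)] in
theorem exists_chart_compact_nhds (x : M) :
    ∃ K : Set (EuclideanSpace ℝ (Fin n)), IsCompact K ∧
      K ⊆ (chartAt (EuclideanSpace ℝ (Fin n)) x).target ∧
      (chartAt (EuclideanSpace ℝ (Fin n)) x).symm '' K ∈ 𝓝 x := by
  set e := chartAt (EuclideanSpace ℝ (Fin n)) x
  have hx := mem_chart_source (EuclideanSpace ℝ (Fin n)) x
  obtain ⟨K, hKx, hKe, hK⟩ := local_compact_nhds (e.open_target.mem_nhds (e.map_source hx))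
  refine ⟨K, hK, hKe, ?_⟩
  have h1 : e ⁻¹' K ∩ e.source ∈ 𝓝 x :=
    inter_mem ((e.continuousAt hx).preimage_mem_nhds hKx) (e.open_source.mem_nhds hx)
  refine mem_of_superset h1 fun z hz => ⟨e z, hz.1, e.left_inv hz.2⟩

omit [IsContMDiffRiemannianBundle (𝓡 n) ∞ (EuclideanSpace ℝ (Fin n))
    (fun x : M => TangentSpace (𝓡 n) x)] in
theorem inner_coords {e : OpenPartialHomeomorph M (EuclideanSpace ℝ (Fin n))}
    (he : e ∈ atlas (EuclideanSpace ℝ (Fin n)) M) (X : (x : M) → TangentSpace (𝓡 n) x)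
    {y : EuclideanSpace ℝ (Fin n)} (hy : y ∈ e.target) (v : TangentSpace (𝓡 n) (e.symm y)) :
    inner ℝ v (X (e.symm y)) =
      ∑ i, coords e X y i * inner ℝ v (coordVec e y (EuclideanSpace.single i 1)) := by
  conv_lhs => rw [← coordVec_coords he X hy]
  exact inner_coordVec_eq_sum e y _ v

-- A weak gradient is controlled only through its inner products with coordinate fields. Inverting
-- the Gram matrix recovers the components themselves, and with them the measurability of inner
-- products and directional derivatives.
omit [IsContMDiffRiemannianBundle (𝓡 n) ∞ (EuclideanSpace ℝ (Fin n))
    (fun x : M => TangentSpace (𝓡 n) x)] in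
theorem coords_apply_eq {e : OpenPartialHomeomorph M (EuclideanSpace ℝ (Fin n))}
    (he : e ∈ atlas (EuclideanSpace ℝ (Fin n)) M) (X : (x : M) → TangentSpace (𝓡 n) x)
    {y : EuclideanSpace ℝ (Fin n)} (hy : y ∈ e.target) (i : Fin n) :
    coords e X y i = ∑ j, (gramMatrix e y)⁻¹ i j *
      inner ℝ (X (e.symm y)) (coordVec e y (EuclideanSpace.single j 1)) := by
  have h1 : (fun j => inner ℝ (X (e.symm y)) (coordVec e y (EuclideanSpace.single j 1))) =
      (gramMatrix e y).mulVec (fun i => coords e X y i) := by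
    ext j
    rw [real_inner_comm, inner_coords he X hy, Matrix.mulVec, dotProduct]
    refine Finset.sum_congr rfl fun k _ => mul_comm _ _
  have h2 : (gramMatrix e y)⁻¹.mulVec ((gramMatrix e y).mulVec (fun i => coords e X y i)) =
      fun i => coords e X y i := by
    rw [Matrix.mulVec_mulVec, Matrix.nonsing_inv_mul, Matrix.one_mulVec]
    exact isUnit_iff_ne_zero.2 (det_gramMatrix_pos he hy).ne'
  rw [← h1] at h2
  exact (congrFun h2 i).symm

theorem aestronglyMeasurable_coords {e : OpenPartialHomeomorph M (EuclideanSpace ℝ (Fin n))}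
    (he : e ∈ atlas (EuclideanSpace ℝ (Fin n)) M) {K : Set (EuclideanSpace ℝ (Fin n))}
    (hK : IsCompact K) (hKe : K ⊆ e.target) {f : M → ℝ} {X : (x : M) → TangentSpace (𝓡 n) x}
    (hX : HasWeakGrad f X) (i : Fin n) :
    AEStronglyMeasurable (fun y => coords e X y i) (volume.restrict K) := by
  have hG : ContinuousOn (fun y => (gramMatrix e y)⁻¹) K := by
    have h1 := (continuousOn_gramMatrix he).mono hKe
    simp only [Matrix.inv_def]
    have h2 : ContinuousOn (fun y => Ring.inverse (gramMatrix e y).det) K := by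
      simp only [Ring.inverse_eq_inv']
      exact ((continuous_id.matrix_det).comp_continuousOn h1).inv₀ fun y hy =>
        (det_gramMatrix_pos he (hKe hy)).ne'
    have h3 : ContinuousOn (fun y => (gramMatrix e y).adjugate) K :=
      (continuous_id.matrix_adjugate).comp_continuousOn h1
    exact h2.smul h3
  have hb : ∀ j : Fin n, AEStronglyMeasurable (fun y => inner ℝ (X (e.symm y))
      (coordVec e y (EuclideanSpace.single j 1))) (volume.restrict K) := fun j =>
    (((hX e he).2 _).1.integrableOn_compact_subset hKe hK).aestronglyMeasurable
  have h2 : AEStronglyMeasurable (fun y => ∑ j, (gramMatrix e y)⁻¹ i j *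
      inner ℝ (X (e.symm y)) (coordVec e y (EuclideanSpace.single j 1))) (volume.restrict K) := by
    refine Finset.aestronglyMeasurable_fun_sum _ fun j _ => ?_
    refine AEStronglyMeasurable.mul ?_ (hb j)
    exact (((continuous_apply j).comp (continuous_apply i)).comp_continuousOn hG).aestronglyMeasurable
      hK.measurableSet
  refine h2.congr ?_
  filter_upwards [ae_restrict_mem hK.measurableSet] with y hy
  exact (coords_apply_eq he X (hKe hy) i).symm

variable [T2Space M] [MeasurableSpace M] [BorelSpace M]

omit [IsContMDiffRiemannianBundle (𝓡 n) ∞ (EuclideanSpace ℝ (Fin n))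
    (fun x : M => TangentSpace (𝓡 n) x)] [IsManifold (𝓡 n) ∞ M] in
theorem aemeasurable_chart {e : OpenPartialHomeomorph M (EuclideanSpace ℝ (Fin n))}
    {K : Set (EuclideanSpace ℝ (Fin n))} (hK : IsCompact K) (hKe : K ⊆ e.target)  :
    AEMeasurable e ((weightedVolume n φ).restrict (e.symm '' K)) := by
  refine ContinuousOn.aemeasurable (e.continuousOn.mono ?_) (measurableSet_symm_image hK hKe)
  rintro _ ⟨y, hy, rfl⟩
  exact e.map_target (hKe hy)

/-- Almost everywhere statements pass from the chart to the manifold. -/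
theorem ae_of_ae_chart (hφ : Continuous φ)
    {e : OpenPartialHomeomorph M (EuclideanSpace ℝ (Fin n))}
    (he : e ∈ atlas (EuclideanSpace ℝ (Fin n)) M) {K : Set (EuclideanSpace ℝ (Fin n))}
    (hK : IsCompact K) (hKe : K ⊆ e.target) {P : EuclideanSpace ℝ (Fin n) → Prop}
    (h : ∀ᵐ y ∂(volume.restrict K), P y) :
    ∀ᵐ x ∂((weightedVolume n φ).restrict (e.symm '' K)), P (e x) := by
  obtain ⟨C, hC, h1, -⟩ := exists_weightedVolume_le hφ he hK hKe
  refine ae_of_ae_map (aemeasurable_chart hK hKe) ?_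
  exact (Measure.absolutelyContinuous_of_le_smul h1).ae_le h

/-- Almost everywhere statements pass from the manifold to the chart. -/
theorem ae_chart_of_ae (hφ : Continuous φ)
    {e : OpenPartialHomeomorph M (EuclideanSpace ℝ (Fin n))}
    (he : e ∈ atlas (EuclideanSpace ℝ (Fin n)) M) {K : Set (EuclideanSpace ℝ (Fin n))}
    (hK : IsCompact K) (hKe : K ⊆ e.target) {P : M → Prop}
    (h : ∀ᵐ x ∂(weightedVolume n φ), P x) : ∀ᵐ y ∂(volume.restrict K), P (e.symm y) := by
  obtain ⟨C, hC, -, h1⟩ := exists_weightedVolume_le hφ he hK hKe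
  refine ae_of_ae_map ((e.continuousOn_symm.mono hKe).aemeasurable hK.measurableSet) ?_
  exact (Measure.absolutelyContinuous_of_le_smul h1).ae_le h

theorem memLp_of_memLp_chart (hφ : Continuous φ)
    {e : OpenPartialHomeomorph M (EuclideanSpace ℝ (Fin n))}
    (he : e ∈ atlas (EuclideanSpace ℝ (Fin n)) M) {K : Set (EuclideanSpace ℝ (Fin n))}
    (hK : IsCompact K) (hKe : K ⊆ e.target) :
    ∃ C : ℝ≥0∞, C ≠ ⊤ ∧ ∀ (r : ℝ≥0∞), r ≠ ⊤ → ∀ g : EuclideanSpace ℝ (Fin n) → ℝ,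
      AEStronglyMeasurable g (volume.restrict K) →
      AEStronglyMeasurable (fun x => g (e x)) ((weightedVolume n φ).restrict (e.symm '' K)) ∧
      eLpNorm (fun x => g (e x)) r ((weightedVolume n φ).restrict (e.symm '' K)) ≤
        C ^ (1 / r).toReal * eLpNorm g r (volume.restrict K) := by
  obtain ⟨C, hC, h1, -⟩ := exists_weightedVolume_le hφ he hK hKe
  refine ⟨C, hC, fun r hr g hg => ?_⟩
  have hac := Measure.absolutelyContinuous_of_le_smul h1
  have hg' := hg.mono_ac hac
  refine ⟨hg'.comp_aemeasurable (aemeasurable_chart hK hKe), ?_⟩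
  have h2 := eLpNorm_map_measure (p := r) hg' (aemeasurable_chart hK hKe)
  change eLpNorm (g ∘ e) r _ ≤ _
  rw [← h2]
  refine (eLpNorm_mono_measure g h1).trans ?_
  rw [eLpNorm_smul_measure_of_ne_top hr, smul_eq_mul]

theorem memLp_chart_of_memLp (hφ : Continuous φ)
    {e : OpenPartialHomeomorph M (EuclideanSpace ℝ (Fin n))}
    (he : e ∈ atlas (EuclideanSpace ℝ (Fin n)) M) {K : Set (EuclideanSpace ℝ (Fin n))}
    (hK : IsCompact K) (hKe : K ⊆ e.target) {r : ℝ≥0∞} {f : M → ℝ}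
    (hf : MemLp f r (weightedVolume n φ)) : MemLp (fun y => f (e.symm y)) r (volume.restrict K) := by
  obtain ⟨C, hC, -, h1⟩ := exists_weightedVolume_le hφ he hK hKe
  have h2 := hf.of_measure_le_smul hC h1
  exact h2.comp_of_map ((e.continuousOn_symm.mono hKe).aemeasurable hK.measurableSet)

theorem weightedVolume_symm_image_lt_top (hφ : Continuous φ)
    {e : OpenPartialHomeomorph M (EuclideanSpace ℝ (Fin n))}
    (he : e ∈ atlas (EuclideanSpace ℝ (Fin n)) M) {K : Set (EuclideanSpace ℝ (Fin n))}
    (hK : IsCompact K) (hKe : K ⊆ e.target) : weightedVolume n φ (e.symm '' K) < ⊤ := by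
  obtain ⟨C, hC, h⟩ := weightedVolume_bounds hφ he hK hKe
  refine (h _ (measurableSet_symm_image hK hKe) le_rfl).1.trans_lt ?_
  exact ENNReal.mul_lt_top hC.lt_top
    ((measure_mono Set.inter_subset_right).trans_lt hK.measure_lt_top)

theorem isLocallyFiniteMeasure_weightedVolume (hφ : Continuous φ) :
    IsLocallyFiniteMeasure (weightedVolume n φ) := by
  refine ⟨fun x => ?_⟩
  obtain ⟨K, hK, hKe, hx⟩ := exists_chart_compact_nhds (n := n) x
  exact ⟨_, hx, weightedVolume_symm_image_lt_top hφ (chart_mem_atlas _ x) hK hKe⟩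

/-- Near a point of `O` the lower density bound would make a neighbourhood in the chart Lebesgue
null. Positivity is what forces local constants to agree on overlaps. -/
theorem weightedVolume_pos (hφ : Continuous φ) {O : Set M} (hO : IsOpen O) (hne : O.Nonempty) :
    0 < weightedVolume n φ O := by
  obtain ⟨x, hx⟩ := hne
  set e := chartAt (EuclideanSpace ℝ (Fin n)) x
  have he : e ∈ atlas (EuclideanSpace ℝ (Fin n)) M := chart_mem_atlas _ x
  obtain ⟨K, hK, hKe, hKx⟩ := exists_chart_compact_nhds (n := n) x
  obtain ⟨C, hC, h⟩ := weightedVolume_bounds hφ he hK hKe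
  by_contra h0
  have h0' : weightedVolume n φ O = 0 := by simpa using h0
  have hm := measurableSet_symm_image hK hKe
  have h1 := (h (O ∩ e.symm '' K) (hO.measurableSet.inter hm) Set.inter_subset_right).2
  rw [measure_mono_null Set.inter_subset_left h0', mul_zero] at h1
  have hxs := mem_chart_source (EuclideanSpace ℝ (Fin n)) x
  have h2 : e.symm ⁻¹' (O ∩ e.symm '' K) ∩ K ∈ 𝓝 (e x) := by
    have h3 : e.symm ⁻¹' (O ∩ e.symm '' K) ∩ e.target ∈ 𝓝 (e x) := by
      refine inter_mem ?_ (e.open_target.mem_nhds (e.map_source hxs))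
      refine (e.continuousAt_symm (e.map_source hxs)).preimage_mem_nhds ?_
      rw [e.left_inv hxs]
      exact inter_mem (hO.mem_nhds hx) hKx
    refine mem_of_superset h3 fun y hy => ⟨hy.1, ?_⟩
    obtain ⟨z, hz, hzy⟩ := hy.1.2
    rwa [← e.symm.injOn (hKe hz) hy.2 hzy]
  exact (Measure.measure_pos_of_mem_nhds volume h2).not_ge h1

/-- Measurability of a function which in charts is a polynomial in coordinate expressions. -/
theorem aestronglyMeasurable_of_chart [SecondCountableTopology M] (hφ : Continuous φ) {F : M → ℝ}
    (h : ∀ e ∈ atlas (EuclideanSpace ℝ (Fin n)) M, ∀ K : Set (EuclideanSpace ℝ (Fin n)),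
      IsCompact K → K ⊆ e.target →
      AEStronglyMeasurable (fun y => F (e.symm y)) (volume.restrict K)) :
    AEStronglyMeasurable F (weightedVolume n φ) := by
  refine aestronglyMeasurable_of_locally fun x => ?_
  obtain ⟨K, hK, hKe, hx⟩ := exists_chart_compact_nhds (n := n) x
  set e := chartAt (EuclideanSpace ℝ (Fin n)) x
  have he : e ∈ atlas (EuclideanSpace ℝ (Fin n)) M := chart_mem_atlas _ x
  refine ⟨_, hx, ?_⟩
  obtain ⟨C, hC, h1⟩ := memLp_of_memLp_chart hφ he hK hKe
  refine ((h1 1 (by simp) _ (h e he K hK hKe)).1).congr ?_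
  filter_upwards [ae_restrict_mem (measurableSet_symm_image hK hKe)] with z hz
  obtain ⟨y, hy, rfl⟩ := hz
  rw [e.left_inv (e.map_target (hKe hy))]

theorem aestronglyMeasurable_inner [SecondCountableTopology M] (hφ : Continuous φ) {f f' : M → ℝ}
    {G X : (x : M) → TangentSpace (𝓡 n) x} (hG : HasWeakGrad f G) (hX : HasWeakGrad f' X) :
    AEStronglyMeasurable (fun x => (inner ℝ (G x) (X x) : ℝ)) (weightedVolume n φ) := by
  refine aestronglyMeasurable_of_chart hφ fun e he K hK hKe => ?_
  have h2 : AEStronglyMeasurable (fun y => ∑ i, coords e X y i *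
      inner ℝ (G (e.symm y)) (coordVec e y (EuclideanSpace.single i 1))) (volume.restrict K) :=
    Finset.aestronglyMeasurable_fun_sum _ fun i _ =>
      (aestronglyMeasurable_coords he hK hKe hX i).mul
        ((((hG e he).2 _).1.integrableOn_compact_subset hKe hK).aestronglyMeasurable)
  refine h2.congr ?_
  filter_upwards [ae_restrict_mem hK.measurableSet] with y hy
  exact (inner_coords he X (hKe hy) _).symm

theorem aestronglyMeasurable_dirDeriv [SecondCountableTopology M] (hφ : Continuous φ) {f : M → ℝ}
    {X : (x : M) → TangentSpace (𝓡 n) x} (hX : HasWeakGrad f X) {ψ : M → ℝ}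
    (hψ : ContMDiff (𝓡 n) 𝓘(ℝ, ℝ) ∞ ψ) :
    AEStronglyMeasurable (fun x => dirDeriv ψ x (X x)) (weightedVolume n φ) := by
  refine aestronglyMeasurable_of_chart hφ fun e he K hK hKe => ?_
  have hd : ContDiffOn ℝ ∞ (fun y => ψ (e.symm y)) e.target := by
    rw [← contMDiffOn_iff_contDiffOn]
    exact hψ.comp_contMDiffOn
      (contMDiffOn_symm_of_mem_maximalAtlas (IsManifold.subset_maximalAtlas he))
  have hc : ContinuousOn (fderiv ℝ (fun y => ψ (e.symm y))) e.target :=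
    hd.continuousOn_fderiv_of_isOpen e.open_target (by simp)
  have h2 : AEStronglyMeasurable (fun y => ∑ i, coords e X y i *
      fderiv ℝ (fun y => ψ (e.symm y)) y (EuclideanSpace.single i 1)) (volume.restrict K) :=
    Finset.aestronglyMeasurable_fun_sum _ fun i _ =>
      (aestronglyMeasurable_coords he hK hKe hX i).mul
        (((hc.mono hKe).clm_apply continuousOn_const).aestronglyMeasurable hK.measurableSet)
  refine h2.congr ?_
  filter_upwards [ae_restrict_mem hK.measurableSet] with y hy
  rw [← coordVec_coords he X (hKe hy), dirDeriv_coordVec he (hKe hy)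
    ((hψ _).mdifferentiableAt (by simp))]
  set L := fderiv ℝ (fun z => ψ (e.symm z)) y
  have h : coords e X y = ∑ i, coords e X y i • EuclideanSpace.single i (1 : ℝ) := by
    conv_lhs => rw [← (EuclideanSpace.basisFun (Fin n) ℝ).sum_repr (coords e X y)]
    simp
  conv_rhs => rw [h]
  rw [map_sum]
  simp only [map_smul, smul_eq_mul]

end

/-! ### Closed balls of a complete Riemannian manifold. -/

section


/-- Points at distance less than `a + b` have a point in between. -/
theorem exists_between_dist (n : ℕ) {M : Type*} [MetricSpace M]
    [ChartedSpace (EuclideanSpace ℝ (Fin n)) M]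
    [RiemannianBundle (fun x : M => TangentSpace (𝓡 n) x)] [IsRiemannianManifold (𝓡 n) M]
    {o x : M} {a b : ℝ} (ha : 0 ≤ a) (hb : 0 < b)
    (h : dist o x < a + b) : ∃ z, dist o z ≤ a ∧ dist z x < b := by
  rcases le_or_gt (dist o x) a with h1 | h1
  · exact ⟨x, h1, by simpa using hb⟩
  have hr : Manifold.riemannianEDist (𝓡 n) o x < ENNReal.ofReal (a + b) := by
    rw [← IsRiemannianManifold.out (I := 𝓡 n) o x, edist_dist]
    exact (ENNReal.ofReal_lt_ofReal_iff (by linarith)).2 h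
  -- On a path of length less than `a + b`, the intermediate value theorem finds a point at distance
  -- exactly `a` from `o`; by additivity of length less than `b` remains.
  obtain ⟨γ, h0, h1', hγ, hlen⟩ := Manifold.exists_lt_of_riemannianEDist_lt hr
  have hcont : ContinuousOn (fun s => dist o (γ s)) (Set.Icc 0 1) :=
    (continuous_const.dist continuous_id).comp_continuousOn hγ.continuousOn
  obtain ⟨s, hs, hsa⟩ := intermediate_value_Icc zero_le_one hcont
    (show a ∈ Set.Icc (dist o (γ 0)) (dist o (γ 1)) by
      rw [h0, h1', dist_self]; exact ⟨ha, h1.le⟩)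
  simp only at hsa
  refine ⟨γ s, hsa.le, ?_⟩
  have e1 : edist o (γ s) ≤ Manifold.pathELength (𝓡 n) γ 0 s := by
    rw [IsRiemannianManifold.out (I := 𝓡 n) o (γ s)]
    exact Manifold.riemannianEDist_le_pathELength (hγ.mono (Set.Icc_subset_Icc le_rfl hs.2))
      h0 rfl hs.1
  have e2 : edist (γ s) x ≤ Manifold.pathELength (𝓡 n) γ s 1 := by
    rw [IsRiemannianManifold.out (I := 𝓡 n) (γ s) x]
    exact Manifold.riemannianEDist_le_pathELength (hγ.mono (Set.Icc_subset_Icc hs.1 le_rfl))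
      rfl h1' hs.2
  have e3 : edist o (γ s) + edist (γ s) x < ENNReal.ofReal (a + b) := by
    refine lt_of_le_of_lt (add_le_add e1 e2) ?_
    rwa [Manifold.pathELength_add hs.1 hs.2]
  rw [edist_dist, edist_dist, ← ENNReal.ofReal_add dist_nonneg dist_nonneg,
    ENNReal.ofReal_lt_ofReal_iff (by linarith), hsa] at e3
  linarith

/-- Hopf-Rinow: closed balls of a complete Riemannian manifold are compact. -/
theorem isCompact_closedBall_of_complete (n : ℕ) {M : Type*} [MetricSpace M]
    [ChartedSpace (EuclideanSpace ℝ (Fin n)) M]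
    [RiemannianBundle (fun x : M => TangentSpace (𝓡 n) x)] [IsRiemannianManifold (𝓡 n) M]
    [CompleteSpace M] (o : M) (r : ℝ) :
    IsCompact (Metric.closedBall o r) := by
  have : LocallyCompactSpace M := ChartedSpace.locallyCompactSpace (EuclideanSpace ℝ (Fin n)) M
  by_contra hr
  -- Continuity argument in the radius: the ball at the infimum `R` of the noncompact radii is shown
  -- to be compact, and local compactness then makes slightly larger balls compact.
  set S : Set ℝ := {r | ¬ IsCompact (Metric.closedBall o r)}
  have hmono : ∀ r ∈ S, ∀ r', r ≤ r' → r' ∈ S := fun r hr r' h hc =>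
    hr (hc.of_isClosed_subset Metric.isClosed_closedBall (Metric.closedBall_subset_closedBall h))
  have hlow : ∀ r ∈ S, 0 ≤ r := by
    intro r hr
    by_contra hneg
    refine hr ?_
    rw [Metric.closedBall_eq_empty.2 (not_le.1 hneg)]
    exact isCompact_empty
  have hbdd : BddBelow S := ⟨0, hlow⟩
  have hne : S.Nonempty := ⟨r, hr⟩
  set R := sInf S
  have hR0 : 0 ≤ R := le_csInf hne hlow
  have hlt : ∀ r < R, IsCompact (Metric.closedBall o r) := fun r hr => by
    by_contra hc
    exact absurd (csInf_le hbdd hc) (not_le.2 hr)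
  have hRc : IsCompact (Metric.closedBall o R) := by
    refine isCompact_iff_totallyBounded_isComplete.2 ⟨?_, Metric.isClosed_closedBall.isComplete⟩
    rw [Metric.totallyBounded_iff]
    intro ε hε
    rcases hR0.eq_or_lt with hR | hR
    · refine ⟨{o}, Set.finite_singleton _, fun x hx => ?_⟩
      rw [← hR, Metric.mem_closedBall] at hx
      simp only [Set.mem_singleton_iff, Set.iUnion_iUnion_eq_left]
      exact lt_of_le_of_lt hx hε
    -- Every point of the `R`-ball is within `ε / 2` of the compact `a`-ball, so an `ε / 2`-net of
    -- the latter is an `ε`-net of the former.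
    · set a := max 0 (R - ε / 4)
      have haR : a < R := max_lt hR (by linarith)
      obtain ⟨t, htf, ht⟩ := Metric.totallyBounded_iff.1 (hlt a haR).totallyBounded (ε / 2)
        (half_pos hε)
      refine ⟨t, htf, fun x hx => ?_⟩
      have hx' : dist o x < a + ε / 2 := by
        rw [dist_comm]
        have h1 : R - ε / 4 ≤ a := le_max_right _ _
        linarith [Metric.mem_closedBall.1 hx]
      obtain ⟨z, hz1, hz2⟩ := exists_between_dist n (le_max_left _ _) (half_pos hε) hx'
      have hz : z ∈ Metric.closedBall o a := by rwa [Metric.mem_closedBall, dist_comm]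
      obtain ⟨y, hy, hzy⟩ := Set.mem_iUnion₂.1 (ht hz)
      refine Set.mem_iUnion₂.2 ⟨y, hy, ?_⟩
      rw [Metric.mem_ball] at hzy ⊢
      linarith [dist_triangle x z y, dist_comm x z]
  obtain ⟨K', hK', hsub⟩ := exists_compact_superset hRc
  obtain ⟨δ, hδ, hδK⟩ := hRc.exists_thickening_subset_open isOpen_interior hsub
  obtain ⟨r, hrS, hrR⟩ := exists_lt_of_csInf_lt hne (show sInf S < R + δ / 2 by
    change R < R + δ / 2; linarith)
  refine hrS (hK'.of_isClosed_subset Metric.isClosed_closedBall fun x hx => ?_)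
  have hx' : dist o x < R + δ := by
    rw [dist_comm]; linarith [Metric.mem_closedBall.1 hx]
  obtain ⟨z, hz1, hz2⟩ := exists_between_dist n hR0 hδ hx'
  refine interior_subset (hδK (Metric.mem_thickening_iff.2 ⟨z, ?_, ?_⟩))
  · rwa [Metric.mem_closedBall, dist_comm]
  · rwa [dist_comm]

end

/-! ### Lipschitz functions in charts and distance cutoffs. -/

section

variable {n : ℕ} {M : Type*} [MetricSpace M] [ChartedSpace (EuclideanSpace ℝ (Fin n)) M]
  [IsManifold (𝓡 n) ∞ M]
  [RiemannianBundle (fun x : M => TangentSpace (𝓡 n) x)]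
  [IsContMDiffRiemannianBundle (𝓡 n) ∞ (EuclideanSpace ℝ (Fin n))
    (fun x : M => TangentSpace (𝓡 n) x)]
  [IsRiemannianManifold (𝓡 n) M]

omit [IsContMDiffRiemannianBundle (𝓡 n) ∞ (EuclideanSpace ℝ (Fin n))
    (fun x : M => TangentSpace (𝓡 n) x)] in
/-- The distance of two points of a chart is at most the length of the segment joining them. -/
theorem dist_symm_le_of_segment {e : OpenPartialHomeomorph M (EuclideanSpace ℝ (Fin n))}
    (he : e ∈ atlas (EuclideanSpace ℝ (Fin n)) M) {a w : EuclideanSpace ℝ (Fin n)} {B : ℝ}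
    (hseg : ∀ t ∈ Set.Icc (0 : ℝ) 1, a + t • w ∈ e.target)
    (hB : ∀ t ∈ Set.Icc (0 : ℝ) 1, ‖coordVec e (a + t • w) w‖ ≤ B) :
    dist (e.symm a) (e.symm (a + w)) ≤ B := by
  have hB0 : 0 ≤ B := (norm_nonneg _).trans (hB 0 ⟨le_rfl, zero_le_one⟩)
  set γ : ℝ → M := fun t => e.symm (a + t • w)
  have hlin : ContMDiff 𝓘(ℝ, ℝ) (𝓡 n) ∞ (fun t : ℝ => a + t • w) :=
    (contDiff_const.add (contDiff_id.smul contDiff_const)).contMDiff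
  have hs : ContMDiffOn (𝓡 n) (𝓡 n) ∞ e.symm e.target :=
    contMDiffOn_symm_of_mem_maximalAtlas (IsManifold.subset_maximalAtlas he)
  have hγ : ContMDiffOn 𝓘(ℝ, ℝ) (𝓡 n) 1 γ (Set.Icc 0 1) :=
    (hs.comp hlin.contMDiffOn hseg).of_le (by exact_mod_cast le_top)
  have h1 := Manifold.riemannianEDist_le_pathELength (I := 𝓡 n) hγ (x := e.symm a)
    (y := e.symm (a + w)) (by simp [γ]) (by simp [γ]) zero_le_one
  rw [← IsRiemannianManifold.out (I := 𝓡 n), Manifold.pathELength_eq_lintegral_mfderiv_Icc,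
    edist_dist] at h1
  have h2 : ∫⁻ t in Set.Icc (0 : ℝ) 1, ‖mfderiv 𝓘(ℝ, ℝ) (𝓡 n) γ t 1‖ₑ ≤ ENNReal.ofReal B := by
    calc _ ≤ ∫⁻ t in Set.Icc (0 : ℝ) 1, ENNReal.ofReal B := by
          refine setLIntegral_mono' measurableSet_Icc fun t ht => ?_
          have h3 : mfderiv 𝓘(ℝ, ℝ) (𝓡 n) γ t 1 = coordVec e (a + t • w) w := by
            have h4 := mfderiv_comp t
              ((mdifferentiable_of_mem_atlas' he).mdifferentiableAt_symm (hseg t ht))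
              ((hlin t).mdifferentiableAt (by simp))
            have h5 := congrArg (fun L => L (1 : ℝ)) h4
            refine h5.trans ?_
            change mfderiv (𝓡 n) (𝓡 n) e.symm (a + t • w)
              (mfderiv 𝓘(ℝ, ℝ) (𝓡 n) (fun t : ℝ => a + t • w) t 1) = _
            have h6 : mfderiv 𝓘(ℝ, ℝ) (𝓡 n) (fun t : ℝ => a + t • w) t 1 = w := by
              rw [mfderiv_eq_fderiv]
              have h7 : HasDerivAt (fun t : ℝ => a + t • w) ((1 : ℝ) • w) t :=
                ((hasDerivAt_id t).smul_const w).const_add a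
              have h8 := h7.hasFDerivAt.fderiv
              rw [h8, one_smul]
              change (1 : ℝ) • w = w
              exact one_smul _ _
            rw [h6]
            rfl
          rw [h3, ← ofReal_norm]
          exact ENNReal.ofReal_le_ofReal (hB t ht)
      _ = ENNReal.ofReal B := by simp
  exact (ENNReal.ofReal_le_ofReal_iff hB0).1 (h1.trans h2)

/-- Mollifying a Lipschitz function in a chart keeps its gradient bounded. -/
theorem abs_fderiv_mollify_le {e : OpenPartialHomeomorph M (EuclideanSpace ℝ (Fin n))}
    (he : e ∈ atlas (EuclideanSpace ℝ (Fin n)) M) {K : Set (EuclideanSpace ℝ (Fin n))}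
    (hK : IsCompact K) (hKe : K ⊆ e.target) {δ : ℝ} (hδ : 0 < δ)
    (hδK : Metric.cthickening δ K ⊆ e.target) {η : M → ℝ} {L : ℝ} (hL : 0 ≤ L)
    (hη : ∀ x x', |η x - η x'| ≤ L * dist x x') :
    ∀ᶠ m in atTop, ∀ y ∈ K, ∀ w, |fderiv ℝ (mollify m ((Metric.cthickening δ K).indicator
      fun z => η (e.symm z))) y w| ≤ 2 * L * ‖coordVec e y w‖ := by
  obtain ⟨ε, hε, hεK⟩ := exists_norm_coordVec_le_two_mul he hK hKe
  -- `δ` keeps the translated points in the thickening, `ε` keeps the metric there within a factor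
  -- `2` of that at `y`.
  have hm : ∀ᶠ m in atTop, (mollifier n m).rOut < min δ ε :=
    (tendsto_mollifier_rOut n).eventually (gt_mem_nhds (lt_min hδ hε))
  have hηc : Continuous η := by
    refine (LipschitzWith.of_dist_le_mul (K := L.toNNReal) fun x y => ?_).continuous
    rw [Real.dist_eq, Real.coe_toNNReal L hL]
    exact hη x y
  have hfi : LocallyIntegrable ((Metric.cthickening δ K).indicator fun z => η (e.symm z)) := by
    refine Integrable.locallyIntegrable ((integrable_indicator_iff
      hK.cthickening.measurableSet).2 ?_)
    exact (hηc.comp_continuousOn (e.continuousOn_symm.mono hδK)).integrableOn_compact hK.cthickening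
  filter_upwards [hm] with m hm y hy w
  set f := mollify m ((Metric.cthickening δ K).indicator fun z => η (e.symm z))
  have hm' : (1 : ℝ) / (m + 1) < min δ ε := hm
  have hfd : HasFDerivAt f (fderiv ℝ f y) y :=
    ((contDiff_mollify m hfi).differentiable (by simp) y).hasFDerivAt
  have hline : HasDerivAt (fun h : ℝ => f (y + h • w)) (fderiv ℝ f y w) 0 := by
    have h7 : HasDerivAt (fun t : ℝ => y + t • w) ((1 : ℝ) • w) 0 :=
      ((hasDerivAt_id (0 : ℝ)).smul_const w).const_add y
    rw [one_smul] at h7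
    have h8 : HasFDerivAt f (fderiv ℝ f y) (y + (0 : ℝ) • w) := by simpa using hfd
    exact h8.comp_hasDerivAt (0 : ℝ) h7
  rw [← Real.norm_eq_abs]
  -- The derivative is bounded by the local Lipschitz constant at `y` along the line in direction
  -- `w`; the latter is inherited from `η` through the length of coordinate segments.
  refine hline.le_of_lip' (C := 2 * L * ‖coordVec e y w‖) (by positivity) ?_
  -- The room left for the displacement `h • w` after that of the kernel.
  set ρ := min δ ε - 1 / (m + 1)
  have hρ : 0 < ρ := by simp only [ρ]; linarith
  have hsmall : ∀ᶠ h : ℝ in 𝓝 0, ‖h • w‖ < ρ := by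
    have : Tendsto (fun h : ℝ => ‖h • w‖) (𝓝 0) (𝓝 ‖(0 : ℝ) • w‖) :=
      (continuous_id.smul continuous_const).norm.tendsto 0
    rw [zero_smul, norm_zero] at this
    exact this.eventually (gt_mem_nhds hρ)
  filter_upwards [hsmall] with h hh
  rw [zero_smul, add_zero, sub_zero, Real.norm_eq_abs, Real.norm_eq_abs]
  refine mollify_sub_mollify_le m hfi fun z hz => ?_
  have hz' : ‖z‖ < 1 / (m + 1) := by simpa using hz
  have hnear : ∀ t ∈ Set.Icc (0 : ℝ) 1, dist (y - z + t • (h • w)) y < min δ ε := by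
    intro t ht
    rw [dist_eq_norm, show y - z + t • (h • w) - y = t • (h • w) - z by abel]
    have h1 : ‖t • (h • w)‖ ≤ ‖h • w‖ := by
      rw [norm_smul, Real.norm_of_nonneg ht.1]
      exact mul_le_of_le_one_left (norm_nonneg _) ht.2
    have h2 := norm_sub_le (t • (h • w)) z
    simp only [ρ] at hh
    linarith
  have hmemK : ∀ t ∈ Set.Icc (0 : ℝ) 1, y - z + t • (h • w) ∈ Metric.cthickening δ K :=
    fun t ht => Metric.mem_cthickening_of_dist_le _ y δ K hy
      ((hnear t ht).le.trans (min_le_left _ _))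
  have hd := dist_symm_le_of_segment he (a := y - z) (w := h • w) (B := 2 * ‖coordVec e y (h • w)‖)
    (fun t ht => hδK (hmemK t ht))
    (fun t ht => (hεK y hy _ ((hnear t ht).trans_le (min_le_right _ _))).2 (h • w))
  have m0 := hmemK 0 ⟨le_rfl, zero_le_one⟩
  have m1 := hmemK 1 ⟨zero_le_one, le_rfl⟩
  rw [zero_smul, add_zero] at m0
  rw [one_smul] at m1
  have e1 : y + h • w - z = y - z + h • w := by abel
  rw [e1, Set.indicator_of_mem m0, Set.indicator_of_mem m1]
  refine (hη _ _).trans ?_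
  rw [dist_comm]
  refine (mul_le_mul_of_nonneg_left hd hL).trans (le_of_eq ?_)
  rw [coordVec_smul, norm_smul, Real.norm_eq_abs]
  ring

/-- The cutoff function which is one on the ball of radius `R` and vanishes outside the ball of
radius `2 R`. -/
def cutoff (o : M) (R : ℝ) (x : M) : ℝ := max 0 (min 1 (2 - dist o x / R))

end

section

variable {M : Type*} [MetricSpace M]

theorem cutoff_nonneg (o : M) (R : ℝ) (x : M) : 0 ≤ cutoff o R x := le_max_left _ _

theorem cutoff_le_one (o : M) (R : ℝ) (x : M) : cutoff o R x ≤ 1 :=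
  max_le zero_le_one (min_le_left _ _)

theorem abs_cutoff_le_one (o : M) (R : ℝ) (x : M) : |cutoff o R x| ≤ 1 := by
  rw [abs_of_nonneg (cutoff_nonneg o R x)]
  exact cutoff_le_one o R x

/-- The constant `1 / R` is what makes the cutoff error vanish as the balls exhaust the manifold;
only the distance function is used, which need not be smooth. -/
theorem cutoff_lipschitz (o : M) {R : ℝ} (hR : 0 < R) (x x' : M) :
    |cutoff o R x - cutoff o R x'| ≤ 1 / R * dist x x' := by
  unfold cutoff
  refine (abs_max_sub_max_le_max _ _ _ _).trans ?_
  rw [sub_self, abs_zero]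
  refine max_le (by positivity) ?_
  refine (abs_min_sub_min_le_max _ _ _ _).trans ?_
  rw [sub_self, abs_zero]
  refine max_le (by positivity) ?_
  rw [show 2 - dist o x / R - (2 - dist o x' / R) = 1 / R * (dist o x' - dist o x) by ring, abs_mul,
    abs_of_pos (by positivity : 0 < 1 / R)]
  refine mul_le_mul_of_nonneg_left ?_ (by positivity)
  rw [dist_comm o x', dist_comm o x, dist_comm x x']
  exact abs_dist_sub_le x' x o

theorem cutoff_eq_zero {o : M} {R : ℝ} (hR : 0 < R) {x : M} (hx : 2 * R ≤ dist o x) :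
    cutoff o R x = 0 := by
  unfold cutoff
  refine max_eq_left ((min_le_right _ _).trans ?_)
  rw [sub_nonpos, le_div_iff₀ hR]
  exact hx

theorem continuous_cutoff (o : M) (R : ℝ) : Continuous (cutoff o R) := by
  unfold cutoff
  fun_prop

theorem tendsto_cutoff (o x : M) :
    Tendsto (fun k : ℕ => cutoff o ((k : ℝ) + 1) x) atTop (𝓝 1) := by
  refine tendsto_const_nhds.congr' ?_
  obtain ⟨N, hN⟩ := exists_nat_ge (dist o x)
  filter_upwards [eventually_ge_atTop N] with k hk
  unfold cutoff
  have h1 : dist o x / ((k : ℝ) + 1) ≤ 1 := by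
    rw [div_le_one (by positivity)]
    have : (N : ℝ) ≤ k := by exact_mod_cast hk
    linarith
  rw [min_eq_left (by linarith), max_eq_right zero_le_one]

end

/-! ### Passing to the limit in products. -/

section

variable {α : Type*} [MeasurableSpace α] {ν : Measure α}

theorem tendsto_integral_mul_of_bounded {F h : α → ℝ} {hm : ℕ → α → ℝ} {B : ℝ}
    (hF : Integrable F ν) (hmeas : ∀ m, AEStronglyMeasurable (hm m) ν)
    (hB : ∀ᶠ m in atTop, ∀ᵐ x ∂ν, |hm m x| ≤ B)
    (hlim : ∀ᵐ x ∂ν, Tendsto (fun m => hm m x) atTop (𝓝 (h x))) :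
    Tendsto (fun m => ∫ x, hm m x * F x ∂ν) atTop (𝓝 (∫ x, h x * F x ∂ν)) := by
  refine tendsto_integral_filter_of_dominated_convergence (fun x => B * |F x|)
    (Eventually.of_forall fun m => (hmeas m).mul hF.aestronglyMeasurable) ?_
    (hF.abs.const_mul B) ?_
  · filter_upwards [hB] with m hm'
    filter_upwards [hm'] with x hx
    rw [Real.norm_eq_abs, abs_mul]
    exact mul_le_mul_of_nonneg_right hx (abs_nonneg _)
  · filter_upwards [hlim] with x hx
    exact hx.mul_const _

/-- Products of a bounded a.e. convergent sequence, a fixed function, and a sequence converging in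
the dual exponent, pass to the limit under the integral. -/
theorem tendsto_integral_mul_of_tendsto_eLpNorm {r s : ℝ≥0∞} [ENNReal.HolderTriple r s 1]
    {a b h : α → ℝ} {bm hm : ℕ → α → ℝ} {B : ℝ} (ha : MemLp a r ν) (hb : MemLp b s ν)
    (hbmeas : ∀ m, AEStronglyMeasurable (bm m) ν)
    (hbm : Tendsto (fun m => eLpNorm (fun x => bm m x - b x) s ν) atTop (𝓝 0))
    (hmeas : ∀ m, AEStronglyMeasurable (hm m) ν)
    (hB : ∀ᶠ m in atTop, ∀ᵐ x ∂ν, |hm m x| ≤ B)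
    (hlim : ∀ᵐ x ∂ν, Tendsto (fun m => hm m x) atTop (𝓝 (h x))) :
    (∀ᶠ m in atTop, Integrable (fun x => hm m x * (a x * bm m x)) ν) ∧
    Tendsto (fun m => ∫ x, hm m x * (a x * bm m x) ∂ν) atTop
      (𝓝 (∫ x, h x * (a x * b x) ∂ν)) := by
  have hab : Integrable (fun x => a x * b x) ν := ha.integrable_mul hb
  have h0 := tendsto_integral_mul_of_bounded hab hmeas hB hlim
  -- Norms tending to zero are finite only for large `m`, hence the eventual integrability in the
  -- conclusion.
  have hfin : ∀ᶠ m in atTop, eLpNorm (fun x => bm m x - b x) s ν < ⊤ :=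
    hbm.eventually (gt_mem_nhds ENNReal.zero_lt_top)
  have hd : ∀ᶠ m in atTop, Integrable (fun x => hm m x * (a x * (bm m x - b x))) ν := by
    filter_upwards [hfin, hB] with m h1 h2
    have h3 : Integrable (fun x => a x * (bm m x - b x)) ν :=
      ha.integrable_mul ⟨(hbmeas m).sub hb.aestronglyMeasurable, h1⟩
    exact h3.bdd_mul (hmeas m) h2
  have he : ∀ᶠ m in atTop, Integrable (fun x => hm m x * (a x * b x)) ν := by
    filter_upwards [hB] with m h2
    exact hab.bdd_mul (hmeas m) h2
  have hlim0 : Tendsto (fun m => ∫ x, hm m x * (a x * (bm m x - b x)) ∂ν) atTop (𝓝 0) := by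
    have h1 : Tendsto (fun m => ENNReal.ofReal B * (eLpNorm a r ν *
        eLpNorm (fun x => bm m x - b x) s ν)) atTop (𝓝 0) := by
      have h2 := ENNReal.Tendsto.const_mul (a := eLpNorm a r ν) hbm
        (Or.inr ha.eLpNorm_lt_top.ne)
      rw [mul_zero] at h2
      have h3 := ENNReal.Tendsto.const_mul (a := ENNReal.ofReal B) h2
        (Or.inr ENNReal.ofReal_ne_top)
      rwa [mul_zero] at h3
    have h4 := (ENNReal.continuousAt_toReal ENNReal.zero_ne_top).tendsto.comp h1
    rw [ENNReal.toReal_zero] at h4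
    refine squeeze_zero_norm' ?_ h4
    filter_upwards [hB, hfin] with m h5 h6
    have h7 : eLpNorm (fun x => a x * (bm m x - b x)) 1 ν ≤
        eLpNorm a r ν * eLpNorm (fun x => bm m x - b x) s ν := by
      have h := eLpNorm_smul_le_mul_eLpNorm (p := r) (q := s) (r := 1)
        ((hbmeas m).sub hb.aestronglyMeasurable) ha.aestronglyMeasurable
      exact h
    have h8 : ‖∫ x, hm m x * (a x * (bm m x - b x)) ∂ν‖ₑ ≤
        ENNReal.ofReal B * (eLpNorm a r ν * eLpNorm (fun x => bm m x - b x) s ν) := by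
      refine (enorm_integral_le_lintegral_enorm _).trans ?_
      refine le_trans ?_ (mul_le_mul_right h7 _)
      rw [eLpNorm_one_eq_lintegral_enorm, ← lintegral_const_mul' _ _ ENNReal.ofReal_ne_top]
      refine lintegral_mono_ae ?_
      filter_upwards [h5] with x hx
      rw [enorm_mul]
      refine mul_le_mul_left ?_ _
      rw [← ofReal_norm, Real.norm_eq_abs]
      exact ENNReal.ofReal_le_ofReal hx
    rw [← toReal_enorm]
    refine ENNReal.toReal_mono ?_ h8
    exact (ENNReal.mul_lt_top ENNReal.ofReal_lt_top
      (ENNReal.mul_lt_top ha.eLpNorm_lt_top h6)).ne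
  have hsplit : ∀ m, (fun x => hm m x * (a x * bm m x)) =
      fun x => hm m x * (a x * b x) + hm m x * (a x * (bm m x - b x)) := fun m => by
    ext x; ring
  constructor
  · filter_upwards [hd, he] with m h1 h2
    rw [hsplit m]
    exact h2.add h1
  · have h9 := h0.add hlim0
    rw [add_zero] at h9
    refine h9.congr' ?_
    filter_upwards [hd, he] with m h1 h2
    rw [hsplit m, integral_add h2 h1]

end

/-! ### Test functions supported in a chart. -/

section

variable {n : ℕ} {M : Type*} [TopologicalSpace M]
  [ChartedSpace (EuclideanSpace ℝ (Fin n)) M] [IsManifold (𝓡 n) ∞ M]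

omit [IsManifold (𝓡 n) ∞ M] in
theorem dirDeriv_eq_zero_of_notMem_tsupport {ρ : M → ℝ} {x : M} (hx : x ∉ tsupport ρ)
    (v : TangentSpace (𝓡 n) x) : dirDeriv ρ x v = 0 := by
  have h1 : ρ =ᶠ[𝓝 x] fun _ => (0 : ℝ) := notMem_tsupport_iff_eventuallyEq.1 hx
  unfold dirDeriv
  rw [h1.mfderiv_eq, mfderiv_const]
  rfl

theorem isTestFunction_mul_chart {e : OpenPartialHomeomorph M (EuclideanSpace ℝ (Fin n))}
    (he : e ∈ atlas (EuclideanSpace ℝ (Fin n)) M) {ρ : M → ℝ} (hρ : IsTestFunction n ρ)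
    (hρe : tsupport ρ ⊆ e.source) {a : EuclideanSpace ℝ (Fin n) → ℝ} (ha : ContDiff ℝ ∞ a) :
    IsTestFunction n (fun x => ρ x * a (e x)) := by
  have hsub : tsupport (fun x => ρ x * a (e x)) ⊆ tsupport ρ := tsupport_mul_subset_left
  refine ⟨contMDiff_of_tsupport fun x hx => ?_, hρ.2.mul_right⟩
  have hx' : x ∈ e.source := hρe (hsub hx)
  have h1 : ContMDiffAt (𝓡 n) (𝓡 n) ∞ e x :=
    (contMDiffOn_of_mem_maximalAtlas (IsManifold.subset_maximalAtlas he)).contMDiffAt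
      (e.open_source.mem_nhds hx')
  exact (hρ.1 x).mul (ha.contMDiff.contMDiffAt.comp x h1)

theorem dirDeriv_mul_chart {e : OpenPartialHomeomorph M (EuclideanSpace ℝ (Fin n))}
    (he : e ∈ atlas (EuclideanSpace ℝ (Fin n)) M) {ρ : M → ℝ}
    (hρ : ContMDiff (𝓡 n) 𝓘(ℝ, ℝ) ∞ ρ) {a : EuclideanSpace ℝ (Fin n) → ℝ}
    (ha : ContDiff ℝ ∞ a) (X : (x : M) → TangentSpace (𝓡 n) x)
    {y : EuclideanSpace ℝ (Fin n)} (hy : y ∈ e.target) :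
    dirDeriv (fun x => ρ x * a (e x)) (e.symm y) (X (e.symm y)) =
      a y * dirDeriv ρ (e.symm y) (X (e.symm y)) +
        ρ (e.symm y) * fderiv ℝ a y (coords e X y) := by
  have h1 : ContMDiffAt (𝓡 n) (𝓡 n) ∞ e (e.symm y) :=
    (contMDiffOn_of_mem_maximalAtlas (IsManifold.subset_maximalAtlas he)).contMDiffAt
      (e.open_source.mem_nhds (e.map_target hy))
  have h2 : MDifferentiableAt (𝓡 n) 𝓘(ℝ, ℝ) (fun x => ρ x * a (e x)) (e.symm y) :=
    ((hρ _).mul (ha.contMDiff.contMDiffAt.comp _ h1)).mdifferentiableAt (by simp)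
  have h3 : MDifferentiableAt (𝓡 n) 𝓘(ℝ, ℝ) ρ (e.symm y) := (hρ _).mdifferentiableAt (by simp)
  have hc := coordVec_coords he X hy
  rw [← hc, dirDeriv_coordVec he hy h2, dirDeriv_coordVec he hy h3]
  have h4 : (fun z => ρ (e.symm z) * a (e (e.symm z))) =ᶠ[𝓝 y] fun z => ρ (e.symm z) * a z := by
    filter_upwards [e.open_target.mem_nhds hy] with z hz
    rw [e.right_inv hz]
  rw [h4.fderiv_eq]
  have h5 : DifferentiableAt ℝ (fun z => ρ (e.symm z)) y := by
    have h6 : ContMDiffAt (𝓡 n) 𝓘(ℝ, ℝ) ∞ (fun z => ρ (e.symm z)) y :=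
      (hρ _).comp y ((contMDiffOn_symm_of_mem_maximalAtlas
        (IsManifold.subset_maximalAtlas he)).contMDiffAt (e.open_target.mem_nhds hy))
    exact h6.contDiffAt.differentiableAt (by simp)
  rw [fderiv_fun_mul h5 (ha.differentiable (by simp) y)]
  simp only [add_apply, smul_apply, smul_eq_mul]
  ring

end

/-! ### Integrability of the flux. -/

/-- At `a = 0` the value of `0 ^ (p - 2)` is a convention (`1` for `p = 2`, otherwise `0`); the
factor `a` makes it harmless. This covers the singular range `p < 2`. -/
theorem rpow_sub_two_mul_self {p a : ℝ} (hp : 1 < p) (ha : 0 ≤ a) : a ^ (p - 2) * a = a ^ (p - 1) := by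
  rcases ha.eq_or_lt with h | h
  · rw [← h, mul_zero, Real.zero_rpow (by linarith)]
  · nth_rewrite 2 [← Real.rpow_one a]
    rw [← Real.rpow_add h]
    ring_nf

theorem memLp_rpow_sub_one {α : Type*} [MeasurableSpace α] {μ : Measure α} {p : ℝ} (hp : 1 < p)
    {f : α → ℝ} (hf : MemLp f (ENNReal.ofReal p) μ) (hf0 : ∀ x, 0 ≤ f x) :
    MemLp (fun x => f x ^ (p - 1)) (ENNReal.ofReal (p / (p - 1))) μ := by
  have h := memLp_spow (q := p - 1) (by linarith) (f := f) (μ := μ) (by simpa using hf)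
  simp only [sub_add_cancel] at h
  refine h.congr_norm (hf.aestronglyMeasurable.aemeasurable.pow_const _).aestronglyMeasurable ?_
  refine Eventually.of_forall fun x => ?_
  rw [spow_of_nonneg (by linarith) (hf0 x)]

section

variable {n : ℕ} {M : Type*} [TopologicalSpace M] [T2Space M]
  [ChartedSpace (EuclideanSpace ℝ (Fin n)) M] [IsManifold (𝓡 n) ∞ M]
  [RiemannianBundle (fun x : M => TangentSpace (𝓡 n) x)]
  [IsContMDiffRiemannianBundle (𝓡 n) ∞ (EuclideanSpace ℝ (Fin n))
    (fun x : M => TangentSpace (𝓡 n) x)]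
  [MeasurableSpace M] [BorelSpace M] {φ : M → ℝ}

omit [T2Space M] [MeasurableSpace M] [BorelSpace M] in
/-- The differential of a function supported in a chart is bounded. -/
theorem exists_abs_dirDeriv_le {e : OpenPartialHomeomorph M (EuclideanSpace ℝ (Fin n))}
    (he : e ∈ atlas (EuclideanSpace ℝ (Fin n)) M) {ρ : M → ℝ} (hρ : IsTestFunction n ρ)
    (hρe : tsupport ρ ⊆ e.source) :
    ∃ C, ∀ x, ∀ v : TangentSpace (𝓡 n) x, |dirDeriv ρ x v| ≤ C * ‖v‖ := by
  set K := e '' tsupport ρ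
  have hK : IsCompact K := hρ.2.isCompact.image_of_continuousOn (e.continuousOn.mono hρe)
  have hKe : K ⊆ e.target := by
    rintro _ ⟨x, hx, rfl⟩
    exact e.map_source (hρe hx)
  obtain ⟨C, hC, h1⟩ := exists_norm_le_norm_coordVec he hK hKe
  have hd : ContDiffOn ℝ ∞ (fun y => ρ (e.symm y)) e.target := by
    rw [← contMDiffOn_iff_contDiffOn]
    exact hρ.1.comp_contMDiffOn
      (contMDiffOn_symm_of_mem_maximalAtlas (IsManifold.subset_maximalAtlas he))
  have hf : ContinuousOn (fderiv ℝ fun y => ρ (e.symm y)) K :=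
    (hd.continuousOn_fderiv_of_isOpen e.open_target (by simp)).mono hKe
  obtain ⟨C', hC'⟩ := hK.exists_bound_of_continuousOn hf
  have hC0 : 0 ≤ max C' 0 := le_max_right _ _
  refine ⟨max C' 0 * C, fun x v => ?_⟩
  by_cases hx : x ∈ tsupport ρ
  · have hxK : e x ∈ K := ⟨x, hx, rfl⟩
    have hx' : e.symm (e x) = x := e.left_inv (hρe hx)
    have key : ∀ y ∈ K, ∀ v : TangentSpace (𝓡 n) (e.symm y),
        |dirDeriv ρ (e.symm y) v| ≤ max C' 0 * C * ‖v‖ := by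
      intro y hy v
      have hc : coordVec e y (coords e (fun _ => (v : EuclideanSpace ℝ (Fin n))) y) = v :=
        coordVec_coords he (fun _ : M => (v : EuclideanSpace ℝ (Fin n))) (hKe hy)
      rw [← hc, dirDeriv_coordVec he (hKe hy) ((hρ.1 _).mdifferentiableAt (by simp))]
      refine ((fderiv ℝ (fun z => ρ (e.symm z)) y).le_opNorm _).trans ?_
      rw [mul_assoc]
      exact mul_le_mul ((hC' y hy).trans (le_max_left _ _)) (h1 y hy _).1 (norm_nonneg _) hC0
    have h2 := key (e x) hxK
    rw [hx'] at h2
    exact h2 v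
  · rw [dirDeriv_eq_zero_of_notMem_tsupport hx, abs_zero]
    positivity

/-- The integrand is at most `C ‖X‖ ^ (p - 1)`, which lies in the dual space `L^{p/(p-1)}` and so is
integrable over the compact support of `ρ`. -/
theorem integrable_rpow_mul_dirDeriv [SecondCountableTopology M] (hφ : Continuous φ) {p : ℝ}
    (hp : 1 < p) {f : M → ℝ} {X : (x : M) → TangentSpace (𝓡 n) x} (hX : HasWeakGrad f X)
    (hXp : MemLp (fun x => ‖X x‖) (ENNReal.ofReal p) (weightedVolume n φ))
    {e : OpenPartialHomeomorph M (EuclideanSpace ℝ (Fin n))}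
    (he : e ∈ atlas (EuclideanSpace ℝ (Fin n)) M) {ρ : M → ℝ} (hρ : IsTestFunction n ρ)
    (hρe : tsupport ρ ⊆ e.source) :
    Integrable (fun x => ‖X x‖ ^ (p - 2) * dirDeriv ρ x (X x)) (weightedVolume n φ) := by
  have := isLocallyFiniteMeasure_weightedVolume (n := n) hφ
  obtain ⟨C, hC⟩ := exists_abs_dirDeriv_le he hρ hρe
  have h1 := memLp_rpow_sub_one hp hXp (fun x => norm_nonneg _)
  have h2 : IntegrableOn (fun x => ‖X x‖ ^ (p - 1)) (tsupport ρ) (weightedVolume n φ) := by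
    have h3 : IsFiniteMeasure ((weightedVolume n φ).restrict (tsupport ρ)) :=
      ⟨by rw [Measure.restrict_apply_univ]; exact hρ.2.isCompact.measure_lt_top⟩
    refine (h1.restrict (tsupport ρ)).integrable ?_
    rw [← ENNReal.ofReal_one]
    refine ENNReal.ofReal_le_ofReal ?_
    rw [le_div_iff₀ (by linarith)]
    linarith
  have hmeas : AEStronglyMeasurable (fun x => ‖X x‖ ^ (p - 2) * dirDeriv ρ x (X x))
      (weightedVolume n φ) :=
    (hXp.aestronglyMeasurable.aemeasurable.pow_const _).aestronglyMeasurable.mul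
      (aestronglyMeasurable_dirDeriv hφ hX hρ.1)
  refine (integrableOn_iff_integrable_of_support_subset (s := tsupport ρ) ?_).1 ?_
  · intro x hx
    by_contra hx'
    exact hx (by simp only [dirDeriv_eq_zero_of_notMem_tsupport hx', mul_zero])
  · refine Integrable.mono' (h2.const_mul C) hmeas.restrict (Eventually.of_forall fun x => ?_)
    rw [Real.norm_eq_abs, abs_mul, abs_of_nonneg (Real.rpow_nonneg (norm_nonneg _) _),
      ← rpow_sub_two_mul_self hp (norm_nonneg (X x))]
    calc _ ≤ ‖X x‖ ^ (p - 2) * (C * ‖X x‖) :=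
          mul_le_mul_of_nonneg_left (hC x _) (Real.rpow_nonneg (norm_nonneg _) _)
      _ = _ := by ring

theorem ae_tendsto_mollify_chart (hφ : Continuous φ)
    {e : OpenPartialHomeomorph M (EuclideanSpace ℝ (Fin n))}
    (he : e ∈ atlas (EuclideanSpace ℝ (Fin n)) M) {K K' : Set (EuclideanSpace ℝ (Fin n))}
    (hK : IsCompact K) (hK' : IsCompact K') (hKK' : K ⊆ K') (hKe : K' ⊆ e.target) {f : M → ℝ}
    (hf : LocallyIntegrableOn (fun y => f (e.symm y)) e.target) :
    ∀ᵐ x ∂((weightedVolume n φ).restrict (e.symm '' K)),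
      Tendsto (fun m => mollify m (K'.indicator fun y => f (e.symm y)) (e x)) atTop (𝓝 (f x)) := by
  have hfi : LocallyIntegrable (K'.indicator fun y => f (e.symm y)) :=
    ((integrable_indicator_iff hK'.measurableSet).2
      (hf.integrableOn_compact_subset hKe hK')).locallyIntegrable
  have h1 := ae_of_ae_chart hφ he hK (hKK'.trans hKe)
    (ae_restrict_of_ae (s := K) (ae_tendsto_mollify hfi))
  filter_upwards [h1, ae_restrict_mem (measurableSet_symm_image hK (hKK'.trans hKe))] with x hx hxK
  obtain ⟨y, hy, rfl⟩ := hxK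
  rw [e.right_inv (hKe (hKK' hy))] at hx ⊢
  rwa [Set.indicator_of_mem (hKK' hy)] at hx

theorem memLp_inner_coordVec (hφ : Continuous φ) {p : ℝ} {f : M → ℝ}
    {G : (x : M) → TangentSpace (𝓡 n) x} (hG : HasWeakGrad f G)
    (hGp : MemLp (fun x => ‖G x‖) (ENNReal.ofReal p) (weightedVolume n φ))
    {e : OpenPartialHomeomorph M (EuclideanSpace ℝ (Fin n))}
    (he : e ∈ atlas (EuclideanSpace ℝ (Fin n)) M) {K : Set (EuclideanSpace ℝ (Fin n))}
    (hK : IsCompact K) (hKe : K ⊆ e.target) (w : EuclideanSpace ℝ (Fin n)) :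
    MemLp (fun y => (inner ℝ (G (e.symm y)) (coordVec e y w) : ℝ)) (ENNReal.ofReal p)
      (volume.restrict K) := by
  obtain ⟨C, hC, h1⟩ := exists_norm_le_norm_coordVec he hK hKe
  refine MemLp.of_le_mul (c := C * ‖w‖) (memLp_chart_of_memLp hφ he hK hKe hGp)
    ((((hG e he).2 w).1.integrableOn_compact_subset hKe hK).aestronglyMeasurable) ?_
  filter_upwards [ae_restrict_mem hK.measurableSet] with y hy
  refine (norm_inner_le_norm _ _).trans ?_
  rw [norm_norm, mul_comm]
  exact mul_le_mul_of_nonneg_right (h1 y hy w).2 (norm_nonneg _)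

theorem tendsto_eLpNorm_mollify_chart (hφ : Continuous φ) {p : ℝ} (hp : 1 ≤ p)
    {e : OpenPartialHomeomorph M (EuclideanSpace ℝ (Fin n))}
    (he : e ∈ atlas (EuclideanSpace ℝ (Fin n)) M) {K K' : Set (EuclideanSpace ℝ (Fin n))}
    (hK : IsCompact K) (hK' : IsCompact K') (hKK' : K ⊆ K') (hKe : K' ⊆ e.target)
    {g : EuclideanSpace ℝ (Fin n) → ℝ} (hg : MemLp g (ENNReal.ofReal p) (volume.restrict K')) :
    MemLp (fun x => g (e x)) (ENNReal.ofReal p)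
      ((weightedVolume n φ).restrict (e.symm '' K)) ∧
    Tendsto (fun m => eLpNorm (fun x => mollify m (K'.indicator g) (e x) - g (e x))
      (ENNReal.ofReal p) ((weightedVolume n φ).restrict (e.symm '' K))) atTop (𝓝 0) := by
  obtain ⟨C, hC, h⟩ := memLp_of_memLp_chart hφ he hK (hKK'.trans hKe)
  have hgK : MemLp g (ENNReal.ofReal p) (volume.restrict K) :=
    hg.mono_measure (Measure.restrict_mono hKK' le_rfl)
  have hgi : MemLp (K'.indicator g) (ENNReal.ofReal p) volume :=
    (memLp_indicator_iff_restrict hK'.measurableSet).2 hg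
  have hfin : C ^ (1 / ENNReal.ofReal p).toReal ≠ ⊤ :=
    ENNReal.rpow_ne_top_of_nonneg ENNReal.toReal_nonneg hC
  refine ⟨⟨(h (ENNReal.ofReal p) ENNReal.ofReal_ne_top g hgK.aestronglyMeasurable).1,
    (h (ENNReal.ofReal p) ENNReal.ofReal_ne_top g hgK.aestronglyMeasurable).2.trans_lt
      (ENNReal.mul_lt_top hfin.lt_top hgK.eLpNorm_lt_top)⟩, ?_⟩
  have h1 := ENNReal.Tendsto.const_mul (a := C ^ (1 / ENNReal.ofReal p).toReal)
    (tendsto_eLpNorm_mollify_sub hp hgi) (Or.inr hfin)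
  rw [mul_zero] at h1
  refine tendsto_of_tendsto_of_tendsto_of_le_of_le tendsto_const_nhds h1 (fun _ => zero_le)
    fun m => ?_
  have hcont : Continuous (mollify m (K'.indicator g)) :=
    (contDiff_mollify m (hgi.locallyIntegrable (by simpa using hp))).continuous
  refine (h (ENNReal.ofReal p) ENNReal.ofReal_ne_top (fun y => mollify m (K'.indicator g) y - g y)
    (hcont.aestronglyMeasurable.sub hgK.aestronglyMeasurable)).2.trans ?_
  refine mul_le_mul_right ?_ _
  refine le_trans (le_of_eq ?_) (eLpNorm_mono_measure _ (Measure.restrict_le_self (s := K)))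
  refine eLpNorm_congr_ae ?_
  filter_upwards [ae_restrict_mem hK.measurableSet] with y hy
  rw [Set.indicator_of_mem (hKK' hy)]

theorem memLp_rpow_mul_coords (hφ : Continuous φ) {p : ℝ} (hp : 1 < p) {f : M → ℝ}
    {X : (x : M) → TangentSpace (𝓡 n) x} (hX : HasWeakGrad f X)
    (hXp : MemLp (fun x => ‖X x‖) (ENNReal.ofReal p) (weightedVolume n φ))
    {e : OpenPartialHomeomorph M (EuclideanSpace ℝ (Fin n))}
    (he : e ∈ atlas (EuclideanSpace ℝ (Fin n)) M) {K : Set (EuclideanSpace ℝ (Fin n))}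
    (hK : IsCompact K) (hKe : K ⊆ e.target) (i : Fin n) :
    MemLp (fun x => ‖X x‖ ^ (p - 2) * coords e X (e x) i) (ENNReal.ofReal (p / (p - 1)))
      ((weightedVolume n φ).restrict (e.symm '' K)) := by
  obtain ⟨C, hC, h1⟩ := exists_norm_le_norm_coordVec he hK hKe
  obtain ⟨C', hC', h⟩ := memLp_of_memLp_chart hφ he hK hKe
  have h2 := memLp_rpow_sub_one hp hXp (fun x => norm_nonneg _)
  refine MemLp.of_le_mul (c := C) (h2.restrict _)
    ((hXp.aestronglyMeasurable.aemeasurable.pow_const _).aestronglyMeasurable.restrict.mul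
      (h 1 ENNReal.one_ne_top _ (aestronglyMeasurable_coords he hK hKe hX i)).1) ?_
  filter_upwards [ae_restrict_mem (measurableSet_symm_image hK hKe)] with x hx
  obtain ⟨y, hy, rfl⟩ := hx
  rw [e.right_inv (hKe hy), norm_mul,
    Real.norm_of_nonneg (Real.rpow_nonneg (norm_nonneg _) _),
    Real.norm_of_nonneg (Real.rpow_nonneg (norm_nonneg _) _),
    ← rpow_sub_two_mul_self hp (norm_nonneg _), mul_left_comm]
  refine mul_le_mul_of_nonneg_left ?_ (Real.rpow_nonneg (norm_nonneg _) _)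
  have h3 := (h1 y hy (coords e X y)).1
  rw [coordVec_coords he X (hKe hy)] at h3
  exact (PiLp.norm_apply_le _ i).trans h3

end

/-! ### Testing the equation locally with Sobolev functions. -/

section

variable {n : ℕ} {M : Type*} [MetricSpace M] [SecondCountableTopology M]
  [ChartedSpace (EuclideanSpace ℝ (Fin n)) M] [IsManifold (𝓡 n) ∞ M]
  [RiemannianBundle (fun x : M => TangentSpace (𝓡 n) x)]
  [IsContMDiffRiemannianBundle (𝓡 n) ∞ (EuclideanSpace ℝ (Fin n))
    (fun x : M => TangentSpace (𝓡 n) x)]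
  [IsRiemannianManifold (𝓡 n) M]
  [MeasurableSpace M] [BorelSpace M] {φ : M → ℝ}

/-- A divergence form equation with `p`-growth, tested with `ρ η S(w)`, where `ρ` is a smooth
cutoff function supported in a chart, `η` is Lipschitz and `w` is a Sobolev function. -/
theorem abs_integral_local_test_le (hφ : Continuous φ) {p : ℝ} (hp : 1 < p)
    {e : OpenPartialHomeomorph M (EuclideanSpace ℝ (Fin n))}
    (he : e ∈ atlas (EuclideanSpace ℝ (Fin n)) M) {ρ : M → ℝ} (hρ : IsTestFunction n ρ)
    (hρ0 : ∀ x, 0 ≤ ρ x) (hρe : tsupport ρ ⊆ e.source) {w w₂ v : M → ℝ}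
    {G X : (x : M) → TangentSpace (𝓡 n) x} (hG : HasWeakGrad w G)
    (hGp : MemLp (fun x => ‖G x‖) (ENNReal.ofReal p) (weightedVolume n φ))
    (hX : HasWeakGrad w₂ X)
    (hXp : MemLp (fun x => ‖X x‖) (ENNReal.ofReal p) (weightedVolume n φ))
    (hv : LocallyIntegrable v (weightedVolume n φ))
    (heq : ∀ ψ : M → ℝ, IsTestFunction n ψ → ∫ x, v x * ψ x ∂(weightedVolume n φ) =
      -∫ x, ‖X x‖ ^ (p - 2) * dirDeriv ψ x (X x) ∂(weightedVolume n φ))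
    {η : M → ℝ} {L : ℝ} (hL : 0 ≤ L) (hη1 : ∀ x, |η x| ≤ 1)
    (hη : ∀ x x', |η x - η x'| ≤ L * dist x x') {S : ℝ → ℝ} (hS : ContDiff ℝ ∞ S) {B : ℝ}
    (hSB : ∀ a, |S a| ≤ B) (hS' : ∀ a, |deriv S a| ≤ 1) :
    |(∫ x, ρ x * (η x * S (w x)) * v x ∂(weightedVolume n φ)) +
      (∫ x, η x * S (w x) * (‖X x‖ ^ (p - 2) * dirDeriv ρ x (X x)) ∂(weightedVolume n φ)) +
      ∫ x, ρ x * (η x * deriv S (w x)) * (‖X x‖ ^ (p - 2) * inner ℝ (G x) (X x))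
        ∂(weightedVolume n φ)| ≤
    2 * L * ∫ x, ρ x * |S (w x)| * ‖X x‖ ^ (p - 1) ∂(weightedVolume n φ) := by
  have := isLocallyFiniteMeasure_weightedVolume (n := n) hφ
  set μ := weightedVolume n φ
  set K := e '' tsupport ρ
  have hK : IsCompact K := hρ.2.isCompact.image_of_continuousOn (e.continuousOn.mono hρe)
  have hKe : K ⊆ e.target := by
    rintro _ ⟨x, hx, rfl⟩
    exact e.map_source (hρe hx)
  have hA : e.symm '' K = tsupport ρ := by
    rw [Set.image_image]
    exact (Set.image_congr fun x hx => e.left_inv (hρe hx)).trans (Set.image_id _)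
  obtain ⟨δ, hδ, hδK⟩ := hK.exists_cthickening_subset_open e.open_target hKe
  set K' := Metric.cthickening δ K
  have hK' : IsCompact K' := hK.cthickening
  have hKK' : K ⊆ K' := Metric.self_subset_cthickening K
  set ν := μ.restrict (e.symm '' K)
  have hνfin : IsFiniteMeasure ν :=
    ⟨by rw [Measure.restrict_apply_univ, hA]; exact hρ.2.isCompact.measure_lt_top⟩
  have hηc : Continuous η := by
    refine (LipschitzWith.of_dist_le_mul (K := L.toNNReal) fun x y => ?_).continuous
    rw [Real.dist_eq, Real.coe_toNNReal L hL]
    exact hη x y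
  have hηloc : LocallyIntegrableOn (fun y => η (e.symm y)) e.target :=
    (hηc.comp_continuousOn e.continuousOn_symm).locallyIntegrableOn e.open_target.measurableSet
  have hwloc : LocallyIntegrableOn (fun y => w (e.symm y)) e.target := (hG e he).1
  have hint : ∀ {f : EuclideanSpace ℝ (Fin n) → ℝ}, LocallyIntegrableOn f e.target →
      LocallyIntegrable (K'.indicator f) := fun {f} hf =>
    ((integrable_indicator_iff hK'.measurableSet).2
      (hf.integrableOn_compact_subset hδK hK')).locallyIntegrable
  -- `η` and `w` are mollified separately and `S` is applied afterwards: `ρ * ηm * S(wm)` is then an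
  -- admissible test function whose gradient splits by the product and chain rules.
  set ηm : ℕ → EuclideanSpace ℝ (Fin n) → ℝ :=
    fun m => mollify m (K'.indicator fun y => η (e.symm y)) with hηm
  set wm : ℕ → EuclideanSpace ℝ (Fin n) → ℝ :=
    fun m => mollify m (K'.indicator fun y => w (e.symm y)) with hwm
  set g : Fin n → EuclideanSpace ℝ (Fin n) → ℝ :=
    fun i y => inner ℝ (G (e.symm y)) (coordVec e y (EuclideanSpace.single i 1)) with hg
  set gm : Fin n → ℕ → EuclideanSpace ℝ (Fin n) → ℝ :=
    fun i m => mollify m (K'.indicator (g i)) with hgm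
  have hηs : ∀ m, ContDiff ℝ ∞ (ηm m) := fun m => contDiff_mollify m (hint hηloc)
  have hws : ∀ m, ContDiff ℝ ∞ (wm m) := fun m => contDiff_mollify m (hint hwloc)
  have hgs : ∀ i m, ContDiff ℝ ∞ (gm i m) := fun i m =>
    contDiff_mollify m (hint ((hG e he).2 _).1)
  have hηm1 : ∀ m y, |ηm m y| ≤ 1 := fun m y => abs_mollify_le m fun z _ => by
    by_cases hz : z ∈ K'
    · rw [Set.indicator_of_mem hz]; exact hη1 _
    · rw [Set.indicator_of_notMem hz, abs_zero]; exact zero_le_one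
  have hηlim : ∀ᵐ x ∂ν, Tendsto (fun m => ηm m (e x)) atTop (𝓝 (η x)) :=
    ae_tendsto_mollify_chart hφ he hK hK' hKK' hδK hηloc
  have hwlim : ∀ᵐ x ∂ν, Tendsto (fun m => wm m (e x)) atTop (𝓝 (w x)) :=
    ae_tendsto_mollify_chart hφ he hK hK' hKK' hδK hwloc
  have hglim : ∀ i, _ := fun i => tendsto_eLpNorm_mollify_chart hφ hp.le he hK hK' hKK' hδK
    (memLp_inner_coordVec hφ hG hGp he hK' hδK (EuclideanSpace.single i 1))
  have hdiff : ∀ᶠ m in atTop, ∀ y ∈ K, ∀ i,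
      fderiv ℝ (wm m) y (EuclideanSpace.single i 1) = gm i m y := by
    have h1 : ∀ᶠ m in atTop, (mollifier n m).rOut < δ :=
      (tendsto_mollifier_rOut n).eventually (gt_mem_nhds hδ)
    filter_upwards [h1] with m hm y hy i
    have hm' : (1 : ℝ) / (m + 1) < δ := hm
    refine fderiv_mollify_indicator hK' hδK hwloc ((hG e he).2 _).2 fun z hz => ?_
    exact Metric.mem_cthickening_of_dist_le z y δ K hy ((Metric.mem_closedBall.1 hz).trans hm'.le)
  -- The gradients of `ηm` are bounded but not shown to converge. Their contribution is estimated
  -- and not passed to the limit, so the result is an inequality.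
  have hηder := abs_fderiv_mollify_le he hK hKe hδ hδK hL hη
  have heν : AEMeasurable e ν := aemeasurable_chart hK hKe
  have hcomp : ∀ {f : EuclideanSpace ℝ (Fin n) → ℝ}, Continuous f →
      AEStronglyMeasurable (fun x => f (e x)) ν := fun hf =>
    (hf.measurable.comp_aemeasurable heν).aestronglyMeasurable
  have hρν : AEStronglyMeasurable ρ ν := hρ.1.continuous.aestronglyMeasurable
  obtain ⟨R, hR⟩ := hρ.2.exists_bound_of_continuous hρ.1.continuous
  have hS'c : Continuous (deriv S) := hS.continuous_deriv (by simp)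
  have hmem : ∀ᵐ x ∂ν, x ∈ e.symm '' K := ae_restrict_mem (measurableSet_symm_image hK hKe)
  have hR0 : ∀ x : M, 0 ≤ R := fun x => (norm_nonneg _).trans (hR x)
  have hB0 : 0 ≤ B := (abs_nonneg _).trans (hSB 0)
  -- All integrands vanish off the support of `ρ`, so the finite measure `ν` may replace `μ`.
  have hto : ∀ f : M → ℝ, (∀ x ∉ tsupport ρ, f x = 0) → ∫ x, f x ∂μ = ∫ x, f x ∂ν := by
    intro f hf
    refine (setIntegral_eq_integral_of_forall_compl_eq_zero fun x hx => hf x ?_).symm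
    rwa [hA] at hx
  have hoff : ∀ x ∉ tsupport ρ, ρ x = 0 := fun x hx => image_eq_zero_of_notMem_tsupport hx
  set am : ℕ → EuclideanSpace ℝ (Fin n) → ℝ := fun m y => ηm m y * S (wm m y) with ham
  have hams : ∀ m, ContDiff ℝ ∞ (am m) := fun m => (hηs m).mul (hS.comp (hws m))
  have hamB : ∀ m y, |am m y| ≤ B := fun m y => by
    rw [ham, abs_mul]
    exact (mul_le_mul (hηm1 m y) (hSB _) (abs_nonneg _) zero_le_one).trans (one_mul B).le
  have hamlim : ∀ᵐ x ∂ν, Tendsto (fun m => am m (e x)) atTop (𝓝 (η x * S (w x))) := by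
    filter_upwards [hηlim, hwlim] with x h1 h2
    exact h1.mul ((hS.continuous.tendsto _).comp h2)
  have hvν : Integrable v ν := by
    have := hv.integrableOn_isCompact hρ.2.isCompact
    rwa [← hA] at this
  set N : M → ℝ := fun x => ‖X x‖ ^ (p - 2) with hN
  have hN0 : ∀ x, 0 ≤ N x := fun x => Real.rpow_nonneg (norm_nonneg _) _
  have hdρ : Integrable (fun x => N x * dirDeriv ρ x (X x)) ν :=
    (integrable_rpow_mul_dirDeriv hφ hp hX hXp he hρ hρe).restrict
  have hXν : Integrable (fun x => ‖X x‖ ^ (p - 1)) ν := by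
    refine ((memLp_rpow_sub_one hp hXp fun x => norm_nonneg _).restrict _).integrable ?_
    rw [← ENNReal.ofReal_one]
    refine ENNReal.ofReal_le_ofReal ?_
    rw [le_div_iff₀ (by linarith)]
    linarith
  have hlim1 := tendsto_integral_mul_of_bounded (B := R * B) hvν
    (hm := fun m x => ρ x * am m (e x)) (h := fun x => ρ x * (η x * S (w x))) (fun m => hρν.mul (hcomp (hams m).continuous))
    (Eventually.of_forall fun m => Eventually.of_forall fun x => by
      rw [abs_mul]
      exact mul_le_mul (hR x) (hamB m _) (abs_nonneg _) (hR0 x))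
    (hamlim.mono fun x hx => hx.const_mul (ρ x))
  have hlim2 := tendsto_integral_mul_of_bounded (B := B) hdρ (fun m => hcomp (hams m).continuous)
    (Eventually.of_forall fun m => Eventually.of_forall fun x => hamB m _) hamlim
  have hlim3 := tendsto_integral_mul_of_bounded (B := R * B) hXν
    (hm := fun m x => ρ x * |S (wm m (e x))|) (h := fun x => ρ x * |S (w x)|)
    (fun m => hρν.mul (hcomp (hS.continuous.comp (hws m).continuous).abs))
    (Eventually.of_forall fun m => Eventually.of_forall fun x => by
      rw [abs_mul, abs_abs]
      exact mul_le_mul (hR x) (hSB _) (abs_nonneg _) (hR0 x))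
    (hwlim.mono fun x hx => ((hS.continuous.abs.tendsto _).comp hx).const_mul (ρ x))
  have hHT : ENNReal.HolderTriple (ENNReal.ofReal (p / (p - 1))) (ENNReal.ofReal p) 1 := by
    have h := holderTriple_add_one (q := p - 1) (by linarith)
    rw [sub_add_cancel] at h
    exact h.symm
  have hlim4 : ∀ i, _ := fun i => tendsto_integral_mul_of_tendsto_eLpNorm (B := R)
    (hm := fun m x => ρ x * (ηm m (e x) * deriv S (wm m (e x))))
    (h := fun x => ρ x * (η x * deriv S (w x))) (bm := fun m x => gm i m (e x))
    (memLp_rpow_mul_coords hφ hp hX hXp he hK hKe i) (hglim i).1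
    (fun m => hcomp (hgs i m).continuous) (hglim i).2
    (fun m => hρν.mul (hcomp ((hηs m).continuous.mul (hS'c.comp (hws m).continuous))))
    (Eventually.of_forall fun m => Eventually.of_forall fun x => by
      rw [abs_mul, abs_mul]
      calc |ρ x| * (|ηm m (e x)| * |deriv S (wm m (e x))|) ≤ R * (1 * 1) :=
            mul_le_mul (hR x) (mul_le_mul (hηm1 m _) (hS' _) (abs_nonneg _) zero_le_one)
              (by positivity) (hR0 x)
        _ = R := by ring)
    (by
      filter_upwards [hηlim, hwlim] with x h1 h2
      exact (h1.mul ((hS'c.tendsto _).comp h2)).const_mul (ρ x))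
  have hint4 : ∀ i, Integrable (fun x => ρ x * (η x * deriv S (w x)) *
      (N x * coords e X (e x) i * g i (e x))) ν := by
    intro i
    have h1 : Integrable (fun x => N x * coords e X (e x) i * g i (e x)) ν :=
      (memLp_rpow_mul_coords hφ hp hX hXp he hK hKe i).integrable_mul (hglim i).1
    refine h1.bdd_mul (c := R) ?_ (Eventually.of_forall fun x => ?_)
    · refine aestronglyMeasurable_of_tendsto_ae atTop
        (f := fun m x => ρ x * (ηm m (e x) * deriv S (wm m (e x)))) (fun m => ?_) ?_
      · exact hρν.mul (hcomp ((hηs m).continuous.mul (hS'c.comp (hws m).continuous)))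
      · filter_upwards [hηlim, hwlim] with x h1 h2
        exact (h1.mul ((hS'c.tendsto _).comp h2)).const_mul (ρ x)
    · rw [Real.norm_eq_abs, abs_mul, abs_mul]
      calc |ρ x| * (|η x| * |deriv S (w x)|) ≤ R * (1 * 1) :=
            mul_le_mul (hR x) (mul_le_mul (hη1 x) (hS' _) (abs_nonneg _) zero_le_one)
              (by positivity) (hR0 x)
        _ = R := by ring
  -- Each component converges as a product of a bounded factor, an `L^{p/(p-1)}` factor and an `L^p`
  -- convergent one; the sum over components is the inner product of the gradients.
  have hlim5 : Tendsto (fun m => ∑ i, ∫ x, ρ x * (ηm m (e x) * deriv S (wm m (e x))) *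
      (N x * coords e X (e x) i * gm i m (e x)) ∂ν) atTop
      (𝓝 (∫ x, ρ x * (η x * deriv S (w x)) * (N x * inner ℝ (G x) (X x)) ∂μ)) := by
    have h1 := tendsto_finsetSum Finset.univ fun i _ => (hlim4 i).2
    convert h1 using 2
    rw [← integral_finsetSum _ fun i _ => hint4 i,
      hto _ fun x hx => by rw [hoff x hx, zero_mul, zero_mul]]
    refine integral_congr_ae ?_
    filter_upwards [hmem] with x hx
    obtain ⟨y, hy, rfl⟩ := hx
    rw [inner_coords he X (hKe hy), Finset.mul_sum, Finset.mul_sum]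
    refine Finset.sum_congr rfl fun i _ => ?_
    rw [e.right_inv (hKe hy)]
    simp only [hg]
    ring
  rw [hto _ fun x hx => by rw [hoff x hx, zero_mul, zero_mul],
    hto (fun x => η x * S (w x) * (N x * dirDeriv ρ x (X x)))
      fun x hx => by rw [dirDeriv_eq_zero_of_notMem_tsupport hx, mul_zero, mul_zero],
    hto (fun x => ρ x * |S (w x)| * ‖X x‖ ^ (p - 1))
      fun x hx => by rw [hoff x hx, zero_mul, zero_mul]]
  refine le_of_tendsto_of_tendsto ((hlim1.add hlim2).add hlim5).abs (hlim3.const_mul (2 * L)) ?_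
  have hall : ∀ᶠ m in atTop, ∀ i, Integrable (fun x =>
      ρ x * (ηm m (e x) * deriv S (wm m (e x))) *
      (N x * coords e X (e x) i * gm i m (e x))) ν :=
    eventually_all.2 fun i => (hlim4 i).1
  filter_upwards [hall, hdiff, hηder] with m hi hd hη'
  set ψ : M → ℝ := fun x => ρ x * am m (e x) with hψ
  have hψt : IsTestFunction n ψ := isTestFunction_mul_chart he hρ hρe (hams m)
  have hψe : tsupport ψ ⊆ e.source := (tsupport_mul_subset_left).trans hρe
  have hT : Integrable (fun x => N x * dirDeriv ψ x (X x)) ν :=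
    (integrable_rpow_mul_dirDeriv hφ hp hX hXp he hψt hψe).restrict
  have hT2 : Integrable (fun x => am m (e x) * (N x * dirDeriv ρ x (X x))) ν :=
    hdρ.bdd_mul (hcomp (hams m).continuous) (Eventually.of_forall fun x => hamB m _)
  have hT3 : Integrable (fun x => ρ x * |S (wm m (e x))| * ‖X x‖ ^ (p - 1)) ν := by
    refine hXν.bdd_mul (c := R * B)
      (hρν.mul (hcomp (hS.continuous.comp (hws m).continuous).abs))
      (Eventually.of_forall fun x => ?_)
    rw [norm_mul, Real.norm_eq_abs |_|, abs_abs]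
    exact mul_le_mul (hR x) (hSB _) (abs_nonneg _) (hR0 x)
  have h1 : ∫ x, ρ x * am m (e x) * v x ∂ν = -∫ x, N x * dirDeriv ψ x (X x) ∂ν := by
    rw [← hto _ fun x hx => by rw [hoff x hx, zero_mul, zero_mul],
      ← hto _ fun x hx => by rw [dirDeriv_eq_zero_of_notMem_tsupport
        fun hx' => hx (tsupport_mul_subset_left hx'), mul_zero], ← heq ψ hψt]
    exact integral_congr_ae (Eventually.of_forall fun x => mul_comm _ _)
  -- Subtracting the terms with the gradients of `ρ` and `wm` leaves only the one with the gradient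
  -- of `ηm`, bounded pointwise by `2 * L * ‖X‖`.
  have h2 : (∫ x, ρ x * am m (e x) * v x ∂ν) +
      (∫ x, am m (e x) * (N x * dirDeriv ρ x (X x)) ∂ν) +
      ∑ i, ∫ x, ρ x * (ηm m (e x) * deriv S (wm m (e x))) *
        (N x * coords e X (e x) i * gm i m (e x)) ∂ν =
      -∫ x, N x * dirDeriv ψ x (X x) - am m (e x) * (N x * dirDeriv ρ x (X x)) -
        ∑ i, ρ x * (ηm m (e x) * deriv S (wm m (e x))) *
          (N x * coords e X (e x) i * gm i m (e x)) ∂ν := by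
    have hT12 : Integrable (fun x => N x * dirDeriv ψ x (X x) -
        am m (e x) * (N x * dirDeriv ρ x (X x))) ν := hT.sub hT2
    rw [integral_sub hT12 (integrable_finsetSum _ fun i _ => hi i),
      integral_sub hT hT2, integral_finsetSum _ fun i _ => hi i, h1]
    ring
  rw [h2, abs_neg, ← integral_const_mul, ← Real.norm_eq_abs]
  refine norm_integral_le_of_norm_le (hT3.const_mul (2 * L)) ?_
  filter_upwards [hmem] with x hx
  obtain ⟨y, hy, rfl⟩ := hx
  have h3 := dirDeriv_mul_chart he hρ.1 (hams m) X (hKe hy)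
  have h4 : fderiv ℝ (am m) y (coords e X y) = fderiv ℝ (ηm m) y (coords e X y) * S (wm m y) +
      ηm m y * (deriv S (wm m y) * ∑ i, coords e X y i * gm i m y) := by
    have e1 : HasFDerivAt (ηm m) (fderiv ℝ (ηm m) y) y :=
      ((hηs m).differentiable (by simp) y).hasFDerivAt
    have e2 : HasFDerivAt (wm m) (fderiv ℝ (wm m) y) y :=
      ((hws m).differentiable (by simp) y).hasFDerivAt
    have e3 : HasDerivAt S (deriv S (wm m y)) (wm m y) :=
      (hS.differentiable (by simp) _).hasDerivAt
    have e4 := e1.mul (e3.comp_hasFDerivAt y e2)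
    have e5 : fderiv ℝ (wm m) y (coords e X y) = ∑ i, coords e X y i * gm i m y := by
      have e6 : coords e X y = ∑ i, coords e X y i • EuclideanSpace.single i (1 : ℝ) := by
        conv_lhs => rw [← (EuclideanSpace.basisFun (Fin n) ℝ).sum_repr (coords e X y)]
        simp
      conv_lhs => rw [e6]
      rw [map_sum]
      refine Finset.sum_congr rfl fun i _ => ?_
      rw [map_smul, hd y hy i, smul_eq_mul]
    have e7 := e4.fderiv
    have e8 : fderiv ℝ (am m) y = _ := e7
    rw [e8, ← e5]
    simp only [add_apply, smul_apply, smul_eq_mul, Function.comp_apply]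
    ring
  rw [hψ, h3, e.right_inv (hKe hy), h4]
  have h5 := hη' y hy (coords e X y)
  rw [coordVec_coords he X (hKe hy)] at h5
  set x := e.symm y
  have h6 : N x * (am m y * dirDeriv ρ x (X x) + ρ x *
      (fderiv ℝ (ηm m) y (coords e X y) * S (wm m y) +
        ηm m y * (deriv S (wm m y) * ∑ i, coords e X y i * gm i m y))) -
      am m y * (N x * dirDeriv ρ x (X x)) -
      ∑ i, ρ x * (ηm m y * deriv S (wm m y)) * (N x * coords e X y i * gm i m y) =
      ρ x * S (wm m y) * (N x * fderiv ℝ (ηm m) y (coords e X y)) := by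
    have : ∑ i, ρ x * (ηm m y * deriv S (wm m y)) * (N x * coords e X y i * gm i m y) =
        ρ x * (ηm m y * deriv S (wm m y)) * N x * ∑ i, coords e X y i * gm i m y := by
      rw [Finset.mul_sum]
      exact Finset.sum_congr rfl fun i _ => by ring
    rw [this]
    ring
  rw [h6, norm_mul, norm_mul, norm_mul, Real.norm_of_nonneg (hρ0 x), Real.norm_of_nonneg (hN0 x),
    Real.norm_eq_abs, Real.norm_eq_abs, ← rpow_sub_two_mul_self hp (norm_nonneg _)]
  calc ρ x * |S (wm m y)| * (N x * |fderiv ℝ (ηm m) y (coords e X y)|)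
      ≤ ρ x * |S (wm m y)| * (N x * (2 * L * ‖X x‖)) :=
        mul_le_mul_of_nonneg_left (mul_le_mul_of_nonneg_left h5 (hN0 x))
          (mul_nonneg (hρ0 x) (abs_nonneg _))
    _ = _ := by simp only [hN]; ring

end

/-- Pointwise `|f| ^ p ≤ B ^ (p - s) |f| ^ s`. It puts the truncation of a function in `L^{(q+1)/q}`
into `L^p`. -/
theorem memLp_of_memLp_of_bound {α : Type*} [MeasurableSpace α] {μ : Measure α} {s p B : ℝ}
    (hs : 0 < s) (hsp : s ≤ p) {f : α → ℝ} (hf : MemLp f (ENNReal.ofReal s) μ)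
    (hB : ∀ x, |f x| ≤ B) : MemLp f (ENNReal.ofReal p) μ := by
  have hp : 0 < p := hs.trans_le hsp
  have h1 : Integrable (fun x => ‖f x‖ ^ s) μ := by
    have := hf.integrable_norm_rpow (by simpa using hs) ENNReal.ofReal_ne_top
    rwa [ENNReal.toReal_ofReal hs.le] at this
  refine (integrable_norm_rpow_iff hf.aestronglyMeasurable (by simpa using hp)
    ENNReal.ofReal_ne_top).1 ?_
  rw [ENNReal.toReal_ofReal hp.le]
  refine (h1.const_mul (B ^ (p - s))).mono'
    (hf.aestronglyMeasurable.norm.aemeasurable.pow_const _).aestronglyMeasurable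
    (Eventually.of_forall fun x => ?_)
  rw [Real.norm_of_nonneg (Real.rpow_nonneg (norm_nonneg _) _)]
  have h2 : ‖f x‖ ^ p = ‖f x‖ ^ (p - s) * ‖f x‖ ^ s := by
    rcases hsp.eq_or_lt with h | h
    · rw [h, sub_self, Real.rpow_zero, one_mul]
    · rw [← Real.rpow_add_of_nonneg (norm_nonneg _) (by linarith) hs.le]
      ring_nf
  rw [h2]
  exact mul_le_mul_of_nonneg_right (Real.rpow_le_rpow (norm_nonneg _) (hB x) (by linarith))
    (Real.rpow_nonneg (norm_nonneg _) _)

/-! ### Partition of unity and compactly supported cutoffs. -/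

section

variable (n : ℕ) {M : Type*} [TopologicalSpace M] [T2Space M] [SigmaCompactSpace M]
  [ChartedSpace (EuclideanSpace ℝ (Fin n)) M] [IsManifold (𝓡 n) ∞ M]

/-- On a compact set, the constant function one is a finite sum of nonnegative test functions,
each supported in a chart. -/
theorem exists_finite_partition {Q : Set M} (hQ : IsCompact Q) :
    ∃ (s : Finset M) (ρ : M → M → ℝ), (∀ i, IsTestFunction n (ρ i)) ∧
      (∀ i x, 0 ≤ ρ i x) ∧
      (∀ i, ∃ e ∈ atlas (EuclideanSpace ℝ (Fin n)) M, tsupport (ρ i) ⊆ e.source) ∧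
      (∀ x, ∑ i ∈ s, ρ i x ≤ 1) ∧ ∀ x ∈ Q, ∑ i ∈ s, ρ i x = 1 := by
  choose K hK hKe hKx using fun x : M => exists_chart_compact_nhds (n := n) x
  set A : M → Set M := fun x => (chartAt (EuclideanSpace ℝ (Fin n)) x).symm '' K x
  have hA : ∀ x, IsCompact (A x) := fun x => (hK x).image_of_continuousOn
    ((chartAt (EuclideanSpace ℝ (Fin n)) x).continuousOn_symm.mono (hKe x))
  obtain ⟨f, hf⟩ := SmoothPartitionOfUnity.exists_isSubordinate (𝓡 n) (s := (Set.univ : Set M))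
    isClosed_univ (fun x => interior (A x)) (fun x => isOpen_interior)
    (fun x _ => Set.mem_iUnion.2 ⟨x, mem_interior_iff_mem_nhds.2 (hKx x)⟩)
  -- Only the indices whose support meets `Q` are kept; on `Q` the finite sum is still the whole
  -- sum.
  have hfin := f.locallyFinite.finite_nonempty_inter_compact hQ
  have hsupp : ∀ x, (Function.support fun i => f i x).Finite := fun x =>
    f.locallyFinite.point_finite x
  refine ⟨hfin.toFinset, fun i x => f i x, fun i => ⟨(f i).contMDiff, ?_⟩, fun i x => f.nonneg i x,
    fun i => ⟨chartAt _ i, chart_mem_atlas _ i, ?_⟩, fun x => ?_, fun x hx => ?_⟩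
  · exact (hA i).of_isClosed_subset (isClosed_tsupport _) ((hf i).trans interior_subset)
  · refine ((hf i).trans interior_subset).trans ?_
    rintro _ ⟨y, hy, rfl⟩
    exact (chartAt _ i).map_target (hKe i hy)
  · refine le_trans ?_ (f.sum_le_one x)
    classical
    rw [finsum_eq_sum_of_support_subset (s := hfin.toFinset ∪ (hsupp x).toFinset) _
      fun i hi => by simpa using Or.inr hi]
    exact Finset.sum_le_sum_of_subset_of_nonneg Finset.subset_union_left
      fun i _ _ => f.nonneg i x
  · rw [← f.sum_eq_one (Set.mem_univ x), finsum_eq_sum_of_support_subset]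
    intro i hi
    simp only [Set.Finite.coe_toFinset]
    exact ⟨x, hi, hx⟩

end

section

theorem dirDeriv_sum {n : ℕ} {M : Type*} [TopologicalSpace M]
    [ChartedSpace (EuclideanSpace ℝ (Fin n)) M] {ι : Type*} {s : Finset ι} {ρ : ι → M → ℝ} {x : M}
    (h : ∀ i ∈ s, MDifferentiableAt (𝓡 n) 𝓘(ℝ, ℝ) (ρ i) x) (v : TangentSpace (𝓡 n) x) :
    dirDeriv (fun z => ∑ i ∈ s, ρ i z) x v = ∑ i ∈ s, dirDeriv (ρ i) x v := by
  classical
  have key : MDifferentiableAt (𝓡 n) 𝓘(ℝ, ℝ) (fun z => ∑ i ∈ s, ρ i z) x ∧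
      dirDeriv (fun z => ∑ i ∈ s, ρ i z) x v = ∑ i ∈ s, dirDeriv (ρ i) x v := by
    induction s using Finset.induction_on with
    | empty =>
      simp only [Finset.sum_empty]
      refine ⟨mdifferentiableAt_const, ?_⟩
      unfold dirDeriv
      rw [mfderiv_const]
      rfl
    | insert a s ha ih =>
      obtain ⟨h1, h2⟩ := ih fun i hi => h i (Finset.mem_insert_of_mem hi)
      have h3 := h a (Finset.mem_insert_self a s)
      simp only [Finset.sum_insert ha]
      have h4 := h3.hasMFDerivAt.add h1.hasMFDerivAt
      refine ⟨h4.mdifferentiableAt, ?_⟩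
      rw [← h2]
      have h5 := congrArg (fun T => T v) h4.mfderiv
      exact h5
  exact key.2

variable {n : ℕ} {M : Type*} [MetricSpace M] [SecondCountableTopology M]
  [ChartedSpace (EuclideanSpace ℝ (Fin n)) M] [IsManifold (𝓡 n) ∞ M]
  [RiemannianBundle (fun x : M => TangentSpace (𝓡 n) x)]
  [IsContMDiffRiemannianBundle (𝓡 n) ∞ (EuclideanSpace ℝ (Fin n))
    (fun x : M => TangentSpace (𝓡 n) x)]
  [IsRiemannianManifold (𝓡 n) M]
  [MeasurableSpace M] [BorelSpace M] {φ : M → ℝ}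

/-- The local estimates are summed over a partition of unity. The terms with the differentials of
the `ρ i` cancel, since these sum to zero on the support of `η`, and the errors add up to at most
the global one because `∑ ρ i ≤ 1`. -/
theorem abs_integral_cutoff_test_le (hφ : Continuous φ) {p : ℝ} (hp : 1 < p)
    {w w₂ v : M → ℝ}
    {G X : (x : M) → TangentSpace (𝓡 n) x} (hG : HasWeakGrad w G)
    (hGp : MemLp (fun x => ‖G x‖) (ENNReal.ofReal p) (weightedVolume n φ))
    (hX : HasWeakGrad w₂ X)
    (hXp : MemLp (fun x => ‖X x‖) (ENNReal.ofReal p) (weightedVolume n φ))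
    (hv : LocallyIntegrable v (weightedVolume n φ))
    (hw : AEStronglyMeasurable w (weightedVolume n φ))
    (heq : ∀ ψ : M → ℝ, IsTestFunction n ψ → ∫ x, v x * ψ x ∂(weightedVolume n φ) =
      -∫ x, ‖X x‖ ^ (p - 2) * dirDeriv ψ x (X x) ∂(weightedVolume n φ))
    {η : M → ℝ} {L : ℝ} (hL : 0 ≤ L) (hη1 : ∀ x, |η x| ≤ 1)
    (hη : ∀ x x', |η x - η x'| ≤ L * dist x x') (hηs : HasCompactSupport η)
    {S : ℝ → ℝ} (hS : ContDiff ℝ ∞ S) {B : ℝ}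
    (hSB : ∀ a, |S a| ≤ B) (hS' : ∀ a, |deriv S a| ≤ 1)
    (h1 : Integrable (fun x => S (w x) * v x) (weightedVolume n φ))
    (h2 : Integrable (fun x => ‖X x‖ ^ (p - 2) * inner ℝ (G x) (X x)) (weightedVolume n φ))
    (h3 : Integrable (fun x => |S (w x)| * ‖X x‖ ^ (p - 1)) (weightedVolume n φ)) :
    |(∫ x, η x * (S (w x) * v x) ∂(weightedVolume n φ)) +
      ∫ x, η x * deriv S (w x) * (‖X x‖ ^ (p - 2) * inner ℝ (G x) (X x))
        ∂(weightedVolume n φ)| ≤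
    2 * L * ∫ x, |S (w x)| * ‖X x‖ ^ (p - 1) ∂(weightedVolume n φ) := by
  have : LocallyCompactSpace M := ChartedSpace.locallyCompactSpace (EuclideanSpace ℝ (Fin n)) M
  have hηc : Continuous η := by
    refine (LipschitzWith.of_dist_le_mul (K := L.toNNReal) fun x y => ?_).continuous
    rw [Real.dist_eq, Real.coe_toNNReal L hL]
    exact hη x y
  have hS'c : Continuous (deriv S) := hS.continuous_deriv (by simp)
  set μ := weightedVolume n φ
  -- `Q` is a neighbourhood of the support, so `∑ ρ i = 1` near each of its points and the
  -- differential of the sum vanishes there.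
  obtain ⟨Q, hQ, hsub⟩ := exists_compact_superset hηs.isCompact
  obtain ⟨s, ρ, hρ, hρ0, hρe, hle, hone⟩ := exists_finite_partition n hQ
  choose e he hρe using hρe
  choose R hR using fun i => (hρ i).2.exists_bound_of_continuous (hρ i).1.continuous
  have hloc := fun i => abs_integral_local_test_le hφ hp (he i) (hρ i) (hρ0 i) (hρe i) hG hGp hX hXp
    hv heq hL hη1 hη hS hSB hS'
  have hA : ∀ x ∈ tsupport η, ∑ i ∈ s, ρ i x = 1 := fun x hx => hone x (interior_subset (hsub hx))
  have hη0 : ∀ x ∉ tsupport η, η x = 0 := fun x hx => image_eq_zero_of_notMem_tsupport hx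
  have hd : ∀ x ∈ tsupport η, ∀ v : TangentSpace (𝓡 n) x, ∑ i ∈ s, dirDeriv (ρ i) x v = 0 := by
    intro x hx v
    have e1 : (fun z => ∑ i ∈ s, ρ i z) =ᶠ[𝓝 x] fun _ => (1 : ℝ) := by
      filter_upwards [isOpen_interior.mem_nhds (hsub hx)] with z hz
      exact hone z (interior_subset hz)
    rw [← dirDeriv_sum fun i _ => ((hρ i).1 x).mdifferentiableAt (by simp)]
    unfold dirDeriv
    rw [e1.mfderiv_eq, mfderiv_const]
    rfl
  have hbd : ∀ (i : M) {a : M → ℝ} {b : ℝ}, (∀ x, |a x| ≤ b) → ∀ x, ‖ρ i x * a x‖ ≤ R i * b := by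
    intro i a b hab x
    rw [norm_mul]
    exact mul_le_mul (hR i x) (hab x) (norm_nonneg _) ((norm_nonneg _).trans (hR i x))
  have hB0 : 0 ≤ B := (abs_nonneg _).trans (hSB 0)
  have hSw : AEStronglyMeasurable (fun x => S (w x)) μ :=
    hS.continuous.comp_aestronglyMeasurable hw
  have hS'w : AEStronglyMeasurable (fun x => deriv S (w x)) μ :=
    hS'c.comp_aestronglyMeasurable hw
  have iA : ∀ i, Integrable (fun x => ρ i x * (η x * S (w x)) * v x) μ := fun i => by
    have := h1.bdd_mul (c := R i * 1)
      ((hρ i).1.continuous.mul hηc).aestronglyMeasurable (Eventually.of_forall (hbd i hη1))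
    refine this.congr (Eventually.of_forall fun x => ?_)
    simp only [Pi.mul_apply]
    ring
  have iB : ∀ i, Integrable (fun x => η x * S (w x) *
      (‖X x‖ ^ (p - 2) * dirDeriv (ρ i) x (X x))) μ := fun i => by
    refine (integrable_rpow_mul_dirDeriv hφ hp hX hXp (he i) (hρ i) (hρe i)).bdd_mul (c := 1 * B)
      (hηc.aestronglyMeasurable.mul hSw) (Eventually.of_forall fun x => ?_)
    rw [norm_mul]
    exact mul_le_mul (hη1 x) (hSB _) (abs_nonneg _) zero_le_one
  have iC : ∀ i, Integrable (fun x => ρ i x * (η x * deriv S (w x)) *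
      (‖X x‖ ^ (p - 2) * inner ℝ (G x) (X x))) μ := fun i => by
    refine h2.bdd_mul (c := R i * 1) ((hρ i).1.continuous.aestronglyMeasurable.mul
      (hηc.aestronglyMeasurable.mul hS'w)) (Eventually.of_forall (hbd i fun x => ?_))
    rw [abs_mul]
    exact mul_le_one₀ (hη1 x) (abs_nonneg _) (hS' _)
  have iD : ∀ i, Integrable (fun x => ρ i x * |S (w x)| * ‖X x‖ ^ (p - 1)) μ := fun i => by
    simp only [mul_assoc]
    exact h3.bdd_mul (c := R i) (hρ i).1.continuous.aestronglyMeasurable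
      (Eventually.of_forall (hR i))
  have sA : ∫ x, η x * (S (w x) * v x) ∂μ = ∑ i ∈ s, ∫ x, ρ i x * (η x * S (w x)) * v x ∂μ := by
    rw [← integral_finsetSum _ fun i _ => iA i]
    refine integral_congr_ae (Eventually.of_forall fun x => ?_)
    simp only [← Finset.sum_mul]
    by_cases hx : x ∈ tsupport η
    · rw [hA x hx]; ring
    · rw [hη0 x hx]; ring
  have sB : ∑ i ∈ s, ∫ x, η x * S (w x) * (‖X x‖ ^ (p - 2) * dirDeriv (ρ i) x (X x)) ∂μ = 0 := by
    rw [← integral_finsetSum _ fun i _ => iB i]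
    refine (integral_congr_ae (Eventually.of_forall fun x => ?_)).trans (integral_zero _ _)
    simp only [← Finset.mul_sum]
    by_cases hx : x ∈ tsupport η
    · rw [hd x hx]; ring
    · rw [hη0 x hx]; ring
  have sC : ∫ x, η x * deriv S (w x) * (‖X x‖ ^ (p - 2) * inner ℝ (G x) (X x)) ∂μ =
      ∑ i ∈ s, ∫ x, ρ i x * (η x * deriv S (w x)) * (‖X x‖ ^ (p - 2) * inner ℝ (G x) (X x)) ∂μ := by
    rw [← integral_finsetSum _ fun i _ => iC i]
    refine integral_congr_ae (Eventually.of_forall fun x => ?_)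
    simp only [← Finset.sum_mul]
    by_cases hx : x ∈ tsupport η
    · rw [hA x hx]; ring
    · rw [hη0 x hx]; ring
  have sD : ∑ i ∈ s, ∫ x, ρ i x * |S (w x)| * ‖X x‖ ^ (p - 1) ∂μ ≤
      ∫ x, |S (w x)| * ‖X x‖ ^ (p - 1) ∂μ := by
    rw [← integral_finsetSum _ fun i _ => iD i]
    refine integral_mono (integrable_finsetSum _ fun i _ => iD i) h3 fun x => ?_
    simp only [mul_assoc, ← Finset.sum_mul]
    exact mul_le_of_le_one_left (mul_nonneg (abs_nonneg _) (Real.rpow_nonneg (norm_nonneg _) _))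
      (hle x)
  have hsum := (Finset.abs_sum_le_sum_abs _ s).trans (Finset.sum_le_sum fun i _ => hloc i)
  rw [Finset.sum_add_distrib, Finset.sum_add_distrib, sB, ← sA, ← sC, add_zero,
    ← Finset.mul_sum] at hsum
  exact hsum.trans (mul_le_mul_of_nonneg_left sD (by positivity))

end

/-! ### Smooth truncation. -/

/-- A bounded smooth approximation of the identity function. -/
def softClip (c a : ℝ) : ℝ := c * Real.arctan (a / c)

theorem contDiff_softClip (c : ℝ) : ContDiff ℝ ∞ (softClip c) :=
  contDiff_const.mul (Real.contDiff_arctan.comp (contDiff_id.div_const c))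

theorem hasDerivAt_softClip {c : ℝ} (hc : 0 < c) (a : ℝ) :
    HasDerivAt (softClip c) (1 / (1 + (a / c) ^ 2)) a := by
  have h := (((hasDerivAt_id a).div_const c).arctan).const_mul c
  have e : c * (1 / (1 + (id a / c) ^ 2) * (1 / c)) = 1 / (1 + (a / c) ^ 2) := by
    rw [id, mul_left_comm, mul_one_div_cancel hc.ne', mul_one]
  rw [e] at h
  exact h

theorem abs_deriv_softClip_le {c : ℝ} (hc : 0 < c) (a : ℝ) : |deriv (softClip c) a| ≤ 1 := by
  rw [(hasDerivAt_softClip hc a).deriv, abs_of_pos (by positivity), div_le_one (by positivity)]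
  nlinarith [sq_nonneg (a / c)]

theorem abs_softClip_le {c : ℝ} (hc : 0 < c) (a : ℝ) : |softClip c a| ≤ c * (Real.pi / 2) := by
  rw [softClip, abs_mul, abs_of_pos hc]
  refine mul_le_mul_of_nonneg_left (abs_le.2 ⟨?_, (Real.arctan_lt_pi_div_two _).le⟩) hc.le
  exact (Real.neg_pi_div_two_lt_arctan _).le

theorem abs_softClip_le_abs {c : ℝ} (hc : 0 < c) (a : ℝ) : |softClip c a| ≤ |a| := by
  have h := Convex.norm_image_sub_le_of_norm_hasDerivWithin_le (f := softClip c)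
    (s := Set.univ) (x := 0) (y := a) (C := 1)
    (fun x _ => (hasDerivAt_softClip hc x).hasDerivWithinAt)
    (fun x _ => by rw [← (hasDerivAt_softClip hc x).deriv]; exact abs_deriv_softClip_le hc x)
    convex_univ (Set.mem_univ _) (Set.mem_univ _)
  simpa [softClip] using h

theorem tendsto_deriv_softClip (a : ℝ) :
    Tendsto (fun k : ℕ => deriv (softClip ((k : ℝ) + 1)) a) atTop (𝓝 1) := by
  have h1 : Tendsto (fun k : ℕ => a / ((k : ℝ) + 1)) atTop (𝓝 0) :=
    tendsto_const_nhds.div_atTop (tendsto_atTop_add_const_right _ _ tendsto_natCast_atTop_atTop)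
  have h2 : Tendsto (fun k : ℕ => 1 / (1 + (a / ((k : ℝ) + 1)) ^ 2)) atTop
      (𝓝 (1 / (1 + (0 : ℝ) ^ 2))) :=
    tendsto_const_nhds.div (tendsto_const_nhds.add (h1.pow 2)) (by norm_num)
  norm_num only at h2
  refine h2.congr fun k => ?_
  rw [(hasDerivAt_softClip (by positivity) a).deriv]

theorem tendsto_softClip (a : ℝ) :
    Tendsto (fun k : ℕ => softClip ((k : ℝ) + 1) a) atTop (𝓝 a) := by
  have h0 : HasDerivAt Real.arctan 1 0 := by simpa using Real.hasDerivAt_arctan 0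
  rcases eq_or_ne a 0 with rfl | ha
  · simp [softClip]
  have h1 : Tendsto (fun k : ℕ => a / ((k : ℝ) + 1)) atTop (𝓝[≠] 0) :=
    tendsto_nhdsWithin_iff.2 ⟨tendsto_const_nhds.div_atTop
      (tendsto_atTop_add_const_right _ _ tendsto_natCast_atTop_atTop),
      Eventually.of_forall fun k => div_ne_zero ha (by positivity)⟩
  have h2 := (h0.tendsto_slope_zero.comp h1).const_mul a
  rw [mul_one] at h2
  refine h2.congr fun k => ?_
  simp only [Function.comp_apply, zero_add, Real.arctan_zero, sub_zero, smul_eq_mul, softClip]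
  field_simp

/-! ### Sobolev test functions on a complete manifold. -/

section

variable {n : ℕ} {M : Type*} [MetricSpace M] [CompleteSpace M] [SecondCountableTopology M]
  [ChartedSpace (EuclideanSpace ℝ (Fin n)) M] [IsManifold (𝓡 n) ∞ M]
  [RiemannianBundle (fun x : M => TangentSpace (𝓡 n) x)]
  [IsContMDiffRiemannianBundle (𝓡 n) ∞ (EuclideanSpace ℝ (Fin n))
    (fun x : M => TangentSpace (𝓡 n) x)]
  [IsRiemannianManifold (𝓡 n) M]
  [MeasurableSpace M] [BorelSpace M] {φ : M → ℝ}

omit [CompleteSpace M] [IsRiemannianManifold (𝓡 n) M] in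
theorem integrable_rpow_mul_inner (hφ : Continuous φ) {p : ℝ} (hp : 1 < p) {w w₂ : M → ℝ}
    {G X : (x : M) → TangentSpace (𝓡 n) x} (hG : HasWeakGrad w G)
    (hGp : MemLp (fun x => ‖G x‖) (ENNReal.ofReal p) (weightedVolume n φ))
    (hX : HasWeakGrad w₂ X)
    (hXp : MemLp (fun x => ‖X x‖) (ENNReal.ofReal p) (weightedVolume n φ)) :
    Integrable (fun x => ‖G x‖ * ‖X x‖ ^ (p - 1)) (weightedVolume n φ) ∧
    Integrable (fun x => ‖X x‖ ^ (p - 2) * inner ℝ (G x) (X x)) (weightedVolume n φ) := by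
  have h1 : Integrable (fun x => ‖G x‖ * ‖X x‖ ^ (p - 1)) (weightedVolume n φ) := by
    have h2 := integrable_mul_spow (q := p - 1) (by linarith)
      (f := fun x => ‖G x‖) (g := fun x => ‖X x‖) (by simpa using hGp) (by simpa using hXp)
    refine h2.congr (Eventually.of_forall fun x => ?_)
    simp only
    rw [spow_of_nonneg (by linarith) (norm_nonneg _)]
  refine ⟨h1, h1.mono' ((hXp.aestronglyMeasurable.aemeasurable.pow_const _).aestronglyMeasurable.mul
    (aestronglyMeasurable_inner hφ hG hX)) (Eventually.of_forall fun x => ?_)⟩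
  rw [norm_mul, Real.norm_of_nonneg (Real.rpow_nonneg (norm_nonneg _) _),
    ← rpow_sub_two_mul_self hp (norm_nonneg (X x))]
  calc _ ≤ ‖X x‖ ^ (p - 2) * (‖G x‖ * ‖X x‖) :=
        mul_le_mul_of_nonneg_left (norm_inner_le_norm _ _) (Real.rpow_nonneg (norm_nonneg _) _)
    _ = _ := by ring

/-- On a complete manifold, a weak divergence form equation with `p`-growth may be tested with
Sobolev functions. -/
theorem integral_mul_eq_of_weak_equation (hφ : Continuous φ) {p q : ℝ} (hp : 1 < p) (hq : 0 < q)
    (hqp : (q + 1) / q ≤ p) {w w₂ v : M → ℝ} {G X : (x : M) → TangentSpace (𝓡 n) x}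
    (hG : HasWeakGrad w G)
    (hGp : MemLp (fun x => ‖G x‖) (ENNReal.ofReal p) (weightedVolume n φ))
    (hX : HasWeakGrad w₂ X)
    (hXp : MemLp (fun x => ‖X x‖) (ENNReal.ofReal p) (weightedVolume n φ))
    (hv : MemLp v (ENNReal.ofReal (q + 1)) (weightedVolume n φ))
    (hw : MemLp w (ENNReal.ofReal ((q + 1) / q)) (weightedVolume n φ))
    (heq : ∀ ψ : M → ℝ, IsTestFunction n ψ → ∫ x, v x * ψ x ∂(weightedVolume n φ) =
      -∫ x, ‖X x‖ ^ (p - 2) * dirDeriv ψ x (X x) ∂(weightedVolume n φ)) :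
    ∫ x, v x * w x ∂(weightedVolume n φ) =
      -∫ x, ‖X x‖ ^ (p - 2) * inner ℝ (G x) (X x) ∂(weightedVolume n φ) := by
  rcases isEmpty_or_nonempty M with hE | ⟨⟨o⟩⟩
  · simp [Measure.eq_zero_of_isEmpty]
  have := isLocallyFiniteMeasure_weightedVolume (n := n) hφ
  have hvloc : LocallyIntegrable v (weightedVolume n φ) := hv.locallyIntegrable (by simpa using hq.le)
  set μ := weightedVolume n φ
  have hHT := holderTriple_add_one hq
  have hwv : Integrable (fun x => w x * v x) μ := by
    have h := hv.integrable_mul hw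
    exact h.congr (Eventually.of_forall fun x => mul_comm _ _)
  obtain ⟨-, h2⟩ := integrable_rpow_mul_inner hφ hp hG hGp hX hXp
  -- At a fixed truncation level the cutoff radius goes to infinity; the level goes to infinity only
  -- afterwards, since the error integral is finite only for the truncated function.
  have hclip : ∀ c : ℝ, 0 < c → (∫ x, softClip c (w x) * v x ∂μ) +
      ∫ x, deriv (softClip c) (w x) * (‖X x‖ ^ (p - 2) * inner ℝ (G x) (X x)) ∂μ = 0 := by
    intro c hc
    have hSc : Continuous (softClip c) := (contDiff_softClip c).continuous
    have hS'c : Continuous (deriv (softClip c)) := (contDiff_softClip c).continuous_deriv (by simp)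
    have hSm := hSc.comp_aestronglyMeasurable hw.aestronglyMeasurable
    have hS'm := hS'c.comp_aestronglyMeasurable hw.aestronglyMeasurable
    have h1 : Integrable (fun x => softClip c (w x) * v x) μ := by
      refine hwv.mono (hSm.mul hv.aestronglyMeasurable) (Eventually.of_forall fun x => ?_)
      rw [norm_mul, norm_mul]
      exact mul_le_mul_of_nonneg_right (abs_softClip_le_abs hc _) (norm_nonneg _)
    -- Here `(q + 1) / q ≤ p`, that is `δ ≥ 0`, is used: the truncation is bounded and in
    -- `L^{(q+1)/q}`, hence in `L^p`, and pairs with the flux.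
    have hSp : MemLp (fun x => softClip c (w x)) (ENNReal.ofReal p) μ := by
      refine memLp_of_memLp_of_bound (s := (q + 1) / q) (by positivity) hqp ?_
        (fun x => abs_softClip_le hc (w x))
      exact hw.mono hSm (Eventually.of_forall fun x => abs_softClip_le_abs hc _)
    have h3 : Integrable (fun x => |softClip c (w x)| * ‖X x‖ ^ (p - 1)) μ := by
      have h4 := integrable_mul_spow (q := p - 1) (by linarith)
        (f := fun x => |softClip c (w x)|) (g := fun x => ‖X x‖) (by rw [sub_add_cancel]; exact hSp.abs)
        (by simpa using hXp)
      refine h4.congr (Eventually.of_forall fun x => ?_)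
      simp only
      rw [spow_of_nonneg (by linarith) (norm_nonneg _)]
    have hS'i : Integrable (fun x => deriv (softClip c) (w x) *
        (‖X x‖ ^ (p - 2) * inner ℝ (G x) (X x))) μ :=
      h2.bdd_mul hS'm (Eventually.of_forall fun x => abs_deriv_softClip_le hc _)
    have hk : ∀ k : ℕ, _ := fun k : ℕ => abs_integral_cutoff_test_le hφ hp hG hGp hX hXp hvloc
      hw.aestronglyMeasurable heq (η := cutoff o ((k : ℝ) + 1)) (L := 1 / ((k : ℝ) + 1))
      (by positivity) (abs_cutoff_le_one o _) (cutoff_lipschitz o (by positivity))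
      -- Completeness enters here.
      (HasCompactSupport.intro (isCompact_closedBall_of_complete n o (2 * ((k : ℝ) + 1)))
        fun x hx => cutoff_eq_zero (by positivity) (by
          rw [Metric.mem_closedBall, not_le, dist_comm] at hx
          exact hx.le))
      (contDiff_softClip c) (fun a => abs_softClip_le hc a) (abs_deriv_softClip_le hc) h1 h2 h3
    have hcut : ∀ k : ℕ, AEStronglyMeasurable (fun x => cutoff o ((k : ℝ) + 1) x) μ :=
      fun k => (continuous_cutoff o _).aestronglyMeasurable
    have l1 := tendsto_integral_mul_of_bounded (B := 1) h1 hcut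
      (Eventually.of_forall fun k => Eventually.of_forall fun x => abs_cutoff_le_one o _ x)
      (Eventually.of_forall fun x => tendsto_cutoff o x)
    have l2 := tendsto_integral_mul_of_bounded (B := 1) hS'i hcut
      (Eventually.of_forall fun k => Eventually.of_forall fun x => abs_cutoff_le_one o _ x)
      (Eventually.of_forall fun x => tendsto_cutoff o x)
    simp only [one_mul] at l1 l2
    have l3 : Tendsto (fun k : ℕ => 2 * (1 / ((k : ℝ) + 1)) *
        ∫ x, |softClip c (w x)| * ‖X x‖ ^ (p - 1) ∂μ) atTop (𝓝 0) := by
      have := (tendsto_one_div_add_atTop_nhds_zero_nat (𝕜 := ℝ)).const_mul 2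
      have := this.mul_const (∫ x, |softClip c (w x)| * ‖X x‖ ^ (p - 1) ∂μ)
      simpa using this
    have l4 := le_of_tendsto_of_tendsto' (l1.add l2).abs l3 fun k => by
      simpa only [mul_assoc] using hk k
    exact abs_nonpos_iff.1 l4
  have hm : ∀ k : ℕ, (0 : ℝ) < k + 1 := fun k => by positivity
  have l1 : Tendsto (fun k : ℕ => ∫ x, softClip ((k : ℝ) + 1) (w x) * v x ∂μ) atTop
      (𝓝 (∫ x, w x * v x ∂μ)) := by
    refine tendsto_integral_of_dominated_convergence (fun x => ‖w x * v x‖) (fun k => ?_)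
      hwv.norm (fun k => Eventually.of_forall fun x => ?_) (Eventually.of_forall fun x => ?_)
    · exact ((contDiff_softClip _).continuous.comp_aestronglyMeasurable
        hw.aestronglyMeasurable).mul hv.aestronglyMeasurable
    · rw [norm_mul, norm_mul]
      exact mul_le_mul_of_nonneg_right (abs_softClip_le_abs (hm k) _) (norm_nonneg _)
    · exact (tendsto_softClip (w x)).mul_const _
  have l2 := tendsto_integral_mul_of_bounded (B := 1) h2
    (hm := fun (k : ℕ) x => deriv (softClip ((k : ℝ) + 1)) (w x)) (h := fun _ => 1)
    (fun k => ((contDiff_softClip _).continuous_deriv (by simp)).comp_aestronglyMeasurable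
      hw.aestronglyMeasurable)
    (Eventually.of_forall fun k => Eventually.of_forall fun x => abs_deriv_softClip_le (hm k) _)
    (Eventually.of_forall fun x => tendsto_deriv_softClip (w x))
  have l3 := l1.add l2
  simp only [one_mul] at l3
  have l4 := tendsto_nhds_unique (l3.congr fun k => hclip _ (hm k)) tendsto_const_nhds
  have l5 : ∫ x, v x * w x ∂μ = ∫ x, w x * v x ∂μ :=
    integral_congr_ae (Eventually.of_forall fun x => mul_comm _ _)
  rw [l5]
  linarith

end

/-! ### From vanishing gradient to constancy. -/

section

variable {n : ℕ} {M : Type*} [TopologicalSpace M] [T2Space M]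
  [ChartedSpace (EuclideanSpace ℝ (Fin n)) M] [IsManifold (𝓡 n) ∞ M]
  [RiemannianBundle (fun x : M => TangentSpace (𝓡 n) x)]
  [IsContMDiffRiemannianBundle (𝓡 n) ∞ (EuclideanSpace ℝ (Fin n))
    (fun x : M => TangentSpace (𝓡 n) x)]
  [MeasurableSpace M] [BorelSpace M] {φ : M → ℝ}

/-- In a chart all weak derivatives vanish, so mollification makes `f` almost everywhere constant on
a small ball. -/
theorem exists_locally_ae_const (hφ : Continuous φ) {f : M → ℝ}
    {G : (x : M) → TangentSpace (𝓡 n) x} (hG : HasWeakGrad f G)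
    (h0 : ∀ᵐ x ∂(weightedVolume n φ), ‖G x‖ = 0) (x : M) :
    ∃ O, IsOpen O ∧ x ∈ O ∧ ∃ c, ∀ᵐ z ∂(weightedVolume n φ), z ∈ O → f z = c := by
  set e := chartAt (EuclideanSpace ℝ (Fin n)) x
  have he : e ∈ atlas (EuclideanSpace ℝ (Fin n)) M := chart_mem_atlas _ x
  have hx : x ∈ e.source := mem_chart_source _ x
  obtain ⟨R, hR, hball⟩ := Metric.nhds_basis_closedBall.mem_iff.1
    (e.open_target.mem_nhds (e.map_source hx))
  obtain ⟨c, hc⟩ := ae_const_of_weak_deriv_zero (hG e he).1 (fun w θ hθ hθc hθt => by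
    rw [((hG e he).2 w).2 θ hθ hθc hθt, neg_eq_zero]
    refine (setIntegral_eq_integral_of_forall_compl_eq_zero (s := tsupport θ) fun y hy => by
      rw [image_eq_zero_of_notMem_tsupport hy, mul_zero]).symm.trans ?_
    refine (integral_congr_ae ?_).trans (integral_zero _ _)
    filter_upwards [ae_chart_of_ae hφ he hθc hθt h0] with y hy
    rw [norm_eq_zero.1 hy, inner_zero_left, zero_mul]) hR hball
  -- Constancy is known on the open ball of radius `R / 2`; transfer to the manifold needs a compact
  -- set inside it.
  have hK : IsCompact (Metric.closedBall (e x) (R / 4)) := isCompact_closedBall _ _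
  have hKe : Metric.closedBall (e x) (R / 4) ⊆ e.target :=
    (Metric.closedBall_subset_closedBall (by linarith)).trans hball
  have h1 : ∀ᵐ y ∂(volume.restrict (Metric.closedBall (e x) (R / 4))), f (e.symm y) = c := by
    filter_upwards [ae_restrict_of_ae hc, ae_restrict_mem hK.measurableSet] with y hy hyK
    exact hy (Metric.closedBall_subset_ball (by linarith) hyK)
  have h2 := ae_of_ae_chart hφ he hK hKe h1
  rw [ae_restrict_iff' (measurableSet_symm_image hK hKe)] at h2
  refine ⟨e.source ∩ e ⁻¹' Metric.ball (e x) (R / 4),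
    e.isOpen_inter_preimage Metric.isOpen_ball,
    ⟨hx, Metric.mem_ball_self (by positivity)⟩, c, ?_⟩
  filter_upwards [h2] with z hz hzO
  have h3 := hz ⟨e z, Metric.ball_subset_closedBall hzO.2, e.left_inv hzO.1⟩
  rwa [e.left_inv hzO.1] at h3

/-- A function with vanishing weak gradient on a connected manifold is constant. -/
theorem exists_ae_const [ConnectedSpace M] [SecondCountableTopology M] (hφ : Continuous φ)
    {f : M → ℝ} {G : (x : M) → TangentSpace (𝓡 n) x} (hG : HasWeakGrad f G)
    (h0 : ∀ᵐ x ∂(weightedVolume n φ), ‖G x‖ = 0) :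
    ∃ c, ∀ᵐ x ∂(weightedVolume n φ), f x = c := by
  choose O hO hxO c hc using exists_locally_ae_const hφ hG h0
  -- Overlaps of the neighbourhoods are open and nonempty, so of positive measure, which forces the
  -- constants to agree.
  have hloc : IsLocallyConstant c := by
    refine (IsLocallyConstant.iff_exists_open c).2 fun x => ⟨O x, hO x, hxO x, fun x' hx' => ?_⟩
    by_contra hne
    have hpos := weightedVolume_pos (n := n) hφ ((hO x).inter (hO x')) ⟨x', hx', hxO x'⟩
    refine hpos.ne' (measure_mono_null ?_ (ae_iff.1 ((hc x).and (hc x'))))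
    intro z hz hz'
    exact hne ((hz'.2 hz.2).symm.trans (hz'.1 hz.1))
  obtain ⟨x₀⟩ : Nonempty M := inferInstance
  refine ⟨c x₀, ?_⟩
  -- A countable cover keeps the union of the exceptional sets null.
  obtain ⟨s, hs, hcov⟩ := TopologicalSpace.countable_cover_nhds
    fun x => (hO x).mem_nhds (hxO x)
  have hall : ∀ᵐ z ∂(weightedVolume n φ), ∀ x ∈ s, z ∈ O x → f z = c x :=
    (ae_ball_iff hs).2 fun x _ => hc x
  filter_upwards [hall] with z hz
  obtain ⟨x, hx, hzx⟩ := Set.mem_iUnion₂.1 (hcov.symm ▸ Set.mem_univ z : z ∈ ⋃ x ∈ s, O x)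
  rw [hz x hx hzx]
  exact hloc.apply_eq_of_preconnectedSpace x x₀

omit [T2Space M] [IsManifold (𝓡 n) ∞ M] [IsContMDiffRiemannianBundle (𝓡 n) ∞
  (EuclideanSpace ℝ (Fin n)) (fun x : M => TangentSpace (𝓡 n) x)] [MeasurableSpace M]
  [BorelSpace M] in
theorem hasWeakGrad_weakGrad {f : M → ℝ} (h : WeaklyDifferentiable n f) :
    HasWeakGrad f (weakGrad n f) := by
  rw [weakGrad, dif_pos h]
  exact Classical.choose_spec h

end

section

variable {α : Type*} [MeasurableSpace α] {μ : Measure α}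

/-- A differentiable curve of a.e. constant functions with zero derivative is constant. -/
theorem IsLpDeriv.exists_const {q : ℝ} (hq : 0 < q) {u ut : ℝ → α → ℝ} (h : IsLpDeriv q μ u ut)
    (hut : ∀ t < 0, ∀ᵐ x ∂μ, ut t x = 0) {c : ℝ → ℝ} (hc : ∀ t < 0, ∀ᵐ x ∂μ, u t x = c t)
    {A : Set α} (hA : MeasurableSet A) (hA0 : μ A ≠ 0) (hAt : μ A ≠ ⊤) :
    ∃ c₀, ∀ t < 0, ∀ᵐ x ∂μ, u t x = c₀ := by
  -- The indicator equals its own signed power, so pairing with it gives `c t * μ A`, which has zero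
  -- derivative in `t`.
  have hg : MemLp (A.indicator fun _ => (1 : ℝ)) (ENNReal.ofReal (q + 1)) μ :=
    memLp_indicator_const _ hA _ (Or.inr hAt)
  have hspow : ∀ x, spow q (A.indicator (fun _ => (1 : ℝ)) x) = A.indicator (fun _ => (1 : ℝ)) x := by
    intro x
    by_cases hx : x ∈ A <;> simp [spow, hx]
  have hd : ∀ t < 0, HasDerivAt
      (fun s => ∫ x, u s x * spow q (A.indicator (fun _ => (1 : ℝ)) x) ∂μ) 0 t := by
    intro t ht
    have h1 := h.hasDerivAt_integral_mul_spow hq ht hg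
    have h2 : ∫ x, ut t x * spow q (A.indicator (fun _ => (1 : ℝ)) x) ∂μ = 0 := by
      refine (integral_congr_ae ?_).trans (integral_zero _ _)
      filter_upwards [hut t ht] with x hx
      rw [hx, zero_mul]
    rwa [h2] at h1
  have hval : ∀ t < 0, ∫ x, u t x * spow q (A.indicator (fun _ => (1 : ℝ)) x) ∂μ =
      c t * μ.real A := by
    intro t ht
    have h1 : ∫ x, u t x * spow q (A.indicator (fun _ => (1 : ℝ)) x) ∂μ =
        ∫ x, c t * A.indicator (fun _ => (1 : ℝ)) x ∂μ := by
      refine integral_congr_ae ?_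
      filter_upwards [hc t ht] with x hx
      rw [hx, hspow]
    rw [h1, integral_const_mul, integral_indicator_const _ hA, smul_eq_mul, mul_one]
  have hmono := monotoneOn_Iio_of_hasDerivAt_nonneg hd fun _ _ => le_rfl
  have hanti := antitoneOn_Iio_of_hasDerivAt_nonpos hd fun _ _ => le_rfl
  have hpos : μ.real A ≠ 0 := (ENNReal.toReal_pos hA0 hAt).ne'
  have hconst : ∀ s < 0, ∀ t < 0, s ≤ t → c s = c t := by
    intro s hs t ht hst
    have h1 := le_antisymm (hmono hs ht hst) (hanti hs ht hst)
    simp only at h1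
    rw [hval s hs, hval t ht] at h1
    exact mul_right_cancel₀ hpos h1
  refine ⟨c (-1), fun t ht => ?_⟩
  have h1 : c t = c (-1) := by
    rcases le_total t (-1) with h2 | h2
    · exact hconst t ht _ (by norm_num) h2
    · exact (hconst _ (by norm_num) t ht h2).symm
  rw [← h1]
  exact hc t ht

end

/-! ### Application to ancient solutions. -/

section

variable {n : ℕ} {M : Type*} [MetricSpace M] [CompleteSpace M] [SecondCountableTopology M]
  [ChartedSpace (EuclideanSpace ℝ (Fin n)) M] [IsManifold (𝓡 n) ∞ M]
  [RiemannianBundle (fun x : M => TangentSpace (𝓡 n) x)]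
  [IsContMDiffRiemannianBundle (𝓡 n) ∞ (EuclideanSpace ℝ (Fin n))
    (fun x : M => TangentSpace (𝓡 n) x)]
  [IsRiemannianManifold (𝓡 n) M]
  [MeasurableSpace M] [BorelSpace M] {φ : M → ℝ}

/-- Under the growth assumptions on the energy, the gradient of an ancient solution vanishes. -/
theorem integral_normGrad_rpow_eq_zero (hφ : Continuous φ) {p q : ℝ} (hp : 1 < p) (hq : 0 < q)
    {u ut : ℝ → M → ℝ} (hu : IsAncientSolution n φ p q u ut)
    (hA : StandingAssumption n φ p q (Set.Iio 0) u ut)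
    (hκ : 0 < q * (p - 1) - 1 ∨ (q * (p - 1) - 1 = 0 ∧
      ∃ C d : ℝ, 0 < C ∧ 0 < d ∧ ∀ t < 0, energyI n φ q u t ≤ C * (1 + |t|) ^ d))
    {t : ℝ} (ht : t < 0) :
    ∫ x, normGrad n (fun z => spow q (u t z)) x ^ p ∂(weightedVolume n φ) = 0 := by
  have hδ : 0 ≤ q * (p - 1) - 1 := by
    rcases hκ with h | ⟨h, -⟩
    · exact h.le
    · exact h.ge
  have hqp : (q + 1) / q ≤ p := by
    rw [div_le_iff₀ hq]
    nlinarith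
  have hp0 : 0 < p := by linarith
  set μ := weightedVolume n φ
  have hL : IsLpDeriv q μ u ut := hu.1
  have hgrad : ∀ t < 0, HasWeakGrad (fun x => spow q (u t x))
      (weakGrad n fun x => spow q (u t x)) := fun t ht => hasWeakGrad_weakGrad (hA t ht).2.2.1
  have hLp : ∀ t < 0, MemLp (fun x => ‖weakGrad n (fun x => spow q (u t x)) x‖)
      (ENNReal.ofReal p) μ := fun t ht => (hA t ht).2.2.2
  -- The equation at time `t`, tested with `u^q` at time `s`.
  have htest := fun (s : ℝ) (hs : s < 0) (t : ℝ) (ht : t < 0) =>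
    integral_mul_eq_of_weak_equation hφ hp hq hqp (hgrad s hs) (hLp s hs) (hgrad t ht) (hLp t ht)
      (hL t ht).2.1 (memLp_spow hq (hL s hs).1) (hu.2 t ht).2.2
  refine IsLpDeriv.dissipation_eq_zero hp hq (F := fun t =>
    ∫ x, normGrad n (fun z => spow q (u t z)) x ^ p ∂μ) hL
    (fun t ht => integral_nonneg fun x => Real.rpow_nonneg (norm_nonneg _) _)
    (fun t ht => ?_) (fun s hs t ht => ?_) hκ ht
  · rw [htest t ht t ht]
    congr 1
    refine integral_congr_ae (Eventually.of_forall fun x => ?_)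
    simp only [normGrad]
    rw [real_inner_self_eq_norm_sq, sq, ← mul_assoc, rpow_sub_two_mul_self hp (norm_nonneg _)]
    have h := Real.rpow_add_one' (norm_nonneg (weakGrad n (fun z => spow q (u t z)) x))
      (y := p - 1) (by linarith)
    rw [← h, sub_add_cancel]
  · rw [htest s hs t ht, neg_neg]
    obtain ⟨h1, h2⟩ := integrable_rpow_mul_inner hφ hp (hgrad s hs) (hLp s hs) (hgrad t ht)
      (hLp t ht)
    have hp1 : 0 < p - 1 := by linarith
    have hG' : MemLp (normGrad n fun x => spow q (u s x)) (ENNReal.ofReal (p - 1 + 1)) μ := by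
      rw [sub_add_cancel]; exact hLp s hs
    have hX' : MemLp (normGrad n fun x => spow q (u t x)) (ENNReal.ofReal (p - 1 + 1)) μ := by
      rw [sub_add_cancel]; exact hLp t ht
    have h0n : ∀ t x, 0 ≤ normGrad n (fun x => spow q (u t x)) x := fun t x => norm_nonneg _
    have hroot : ∀ {f : M → ℝ}, (∀ x, 0 ≤ f x) → MemLp f (ENNReal.ofReal (p - 1 + 1)) μ →
        lpNorm (p - 1) μ f = (∫ x, f x ^ p ∂μ) ^ (1 / p) := by
      intro f hf0 hf
      have h3 := integral_abs_rpow_eq hp1 hf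
      simp only [sub_add_cancel, abs_of_nonneg (hf0 _)] at h3
      rw [h3, ← Real.rpow_mul (lpNorm_nonneg _ _), mul_one_div_cancel hp0.ne', Real.rpow_one]
    -- Cauchy-Schwarz pointwise, then Hölder with exponents `p` and `p / (p - 1)`; the latter is the
    -- `L^{q+1}` pairing bound with `p - 1` in place of `q`.
    calc ∫ x, ‖weakGrad n (fun x => spow q (u t x)) x‖ ^ (p - 2) *
          inner ℝ (weakGrad n (fun x => spow q (u s x)) x)
            (weakGrad n (fun x => spow q (u t x)) x) ∂μ
        ≤ ∫ x, ‖weakGrad n (fun x => spow q (u s x)) x‖ *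
          ‖weakGrad n (fun x => spow q (u t x)) x‖ ^ (p - 1) ∂μ := by
          refine integral_mono h2 h1 fun x => ?_
          simp only
          rw [← rpow_sub_two_mul_self hp (norm_nonneg (weakGrad n (fun x => spow q (u t x)) x)),
            mul_left_comm]
          exact mul_le_mul_of_nonneg_left (real_inner_le_norm _ _)
            (Real.rpow_nonneg (norm_nonneg _) _)
      _ = ∫ x, |normGrad n (fun x => spow q (u s x)) x| *
          |normGrad n (fun x => spow q (u t x)) x| ^ (p - 1) ∂μ := by
          simp only [normGrad, abs_norm]
      _ ≤ lpNorm (p - 1) μ (normGrad n fun x => spow q (u s x)) *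
          lpNorm (p - 1) μ (normGrad n fun x => spow q (u t x)) ^ (p - 1) :=
          integral_abs_mul_rpow_le hp1 hG' hX'
      _ = _ := by
          rw [hroot (f := normGrad n fun x => spow q (u s x)) (h0n s) hG',
            hroot (f := normGrad n fun x => spow q (u t x)) (h0n t) hX',
            ← Real.rpow_mul (integral_nonneg fun x => Real.rpow_nonneg (h0n t x) _), mul_comm]
          congr 2
          field_simp

-- Zero gradient gives constancy in space at each time. The flux then vanishes, so the equation
-- makes `ut` orthogonal to all test functions, and the curve is constant in time as well.
omit [CompleteSpace M] [IsRiemannianManifold (𝓡 n) M] in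
theorem isConstant_of_integral_normGrad_rpow_eq_zero [ConnectedSpace M] (hφ : Continuous φ)
    {p q : ℝ} (hp : 1 < p) (hq : 0 < q)
    {u ut : ℝ → M → ℝ} (hu : IsAncientSolution n φ p q u ut)
    (hA : StandingAssumption n φ p q (Set.Iio 0) u ut)
    (h0 : ∀ t < 0, ∫ x, normGrad n (fun z => spow q (u t z)) x ^ p ∂(weightedVolume n φ) = 0) :
    IsConstant n φ u := by
  have : LocallyCompactSpace M := ChartedSpace.locallyCompactSpace (EuclideanSpace ℝ (Fin n)) M
  have := isLocallyFiniteMeasure_weightedVolume (n := n) hφ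
  set μ := weightedVolume n φ
  have hL : IsLpDeriv q μ u ut := hu.1
  have hp0 : 0 < p := by linarith
  have hz : ∀ t < 0, ∀ᵐ x ∂μ, ‖weakGrad n (fun z => spow q (u t z)) x‖ = 0 := by
    intro t ht
    have h1 : Integrable (fun x => ‖weakGrad n (fun z => spow q (u t z)) x‖ ^ p) μ := by
      have h2 := (hA t ht).2.2.2.integrable_norm_rpow (by simpa using hp0) ENNReal.ofReal_ne_top
      rw [ENNReal.toReal_ofReal hp0.le] at h2
      simpa only [normGrad, norm_norm] using h2
    have h3 := (integral_eq_zero_iff_of_nonneg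
      (fun x => Real.rpow_nonneg (norm_nonneg _) _) h1).1 (h0 t ht)
    filter_upwards [h3] with x hx
    exact ((Real.rpow_eq_zero_iff_of_nonneg (norm_nonneg _)).1 hx).1
  have hconst : ∀ t, t < 0 → ∃ c, ∀ᵐ x ∂μ, u t x = c := by
    intro t ht
    obtain ⟨c, hc⟩ := exists_ae_const hφ (hasWeakGrad_weakGrad (hA t ht).2.2.1) (hz t ht)
    -- If the value is attained, injectivity of `spow` identifies `u t`. If not, the almost
    -- everywhere statement is already contradictory, and any constant serves.
    by_cases hE : ∃ x, spow q (u t x) = c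
    · obtain ⟨x₀, hx₀⟩ := hE
      refine ⟨u t x₀, ?_⟩
      filter_upwards [hc] with x hx
      exact (strictMono_spow hq).injective (hx.trans hx₀.symm)
    · refine ⟨0, ?_⟩
      filter_upwards [hc] with x hx
      exact absurd ⟨x, hx⟩ hE
  choose! c hc using hconst
  have hut : ∀ t < 0, ∀ᵐ x ∂μ, ut t x = 0 := by
    intro t ht
    refine ae_eq_zero_of_integral_contMDiff_smul_eq_zero (𝓡 n)
      ((hL t ht).2.1.locallyIntegrable (by simpa using hq.le)) fun ψ hψ hψc => ?_
    have h1 := (hu.2 t ht).2.2 ψ ⟨hψ, hψc⟩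
    have h2 : ∫ x, normGrad n (fun z => spow q (u t z)) x ^ (p - 2) *
        dirDeriv ψ x (weakGrad n (fun z => spow q (u t z)) x) ∂μ = 0 := by
      refine (integral_congr_ae ?_).trans (integral_zero _ _)
      filter_upwards [hz t ht] with x hx
      rw [norm_eq_zero.1 hx, dirDeriv, map_zero]
      exact mul_zero _
    rw [h2, neg_zero] at h1
    rw [← h1]
    refine integral_congr_ae (Eventually.of_forall fun x => ?_)
    simp only [smul_eq_mul]
    ring
  obtain ⟨x₀⟩ : Nonempty M := inferInstance
  obtain ⟨K, hK, hKe, hKx⟩ := exists_chart_compact_nhds (n := n) x₀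
  have he : chartAt (EuclideanSpace ℝ (Fin n)) x₀ ∈ atlas (EuclideanSpace ℝ (Fin n)) M :=
    chart_mem_atlas _ x₀
  refine hL.exists_const hq hut hc (measurableSet_symm_image hK hKe) ?_
    (weightedVolume_symm_image_lt_top hφ he hK hKe).ne
  exact ((weightedVolume_pos (n := n) hφ isOpen_interior
    ⟨x₀, mem_interior_iff_mem_nhds.2 hKx⟩).trans_le (measure_mono interior_subset)).ne'

end

end DNE

end

theorem theorem6 {n : ℕ} {M : Type*} [MetricSpace M] [CompleteSpace M] [ConnectedSpace M]
    [SecondCountableTopology M] [MeasurableSpace M] [BorelSpace M]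
    [ChartedSpace (EuclideanSpace ℝ (Fin n)) M] [IsManifold (𝓡 n) ∞ M]
    [RiemannianBundle (fun x : M => TangentSpace (𝓡 n) x)]
    [IsContMDiffRiemannianBundle (𝓡 n) ∞ (EuclideanSpace ℝ (Fin n))
      (fun x : M => TangentSpace (𝓡 n) x)]
    [IsRiemannianManifold (𝓡 n) M]
    (φ : M → ℝ) (hφ : ContMDiff (𝓡 n) 𝓘(ℝ, ℝ) ∞ φ)
    (p q : ℝ) (hp : 1 < p) (hq : 0 < q)
    (u ut : ℝ → M → ℝ)
    (hu : DNE.IsAncientSolution n φ p q u ut)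
    (hA : DNE.StandingAssumption n φ p q (Set.Iio 0) u ut) :
    (0 < q * (p - 1) - 1 →
      (∀ t < 0, Integrable (fun x => |u t x| ^ (q + 1)) (DNE.weightedVolume n φ) ∧
        0 < DNE.energyI n φ q u t) →
      DNE.IsConstant n φ u) ∧
    (q * (p - 1) - 1 = 0 →
      (∃ C d : ℝ, 0 < C ∧ 0 < d ∧ ∀ t < 0, DNE.energyI n φ q u t ≤ C * (1 + |t|) ^ d) →
      (∀ t < 0, DNE.frequency n φ p q u t = 0) ∧ DNE.IsConstant n φ u) := by
  have hc := hφ.continuous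
  refine ⟨fun hδ _ => ?_, fun hδ hI => ?_⟩
  · exact DNE.isConstant_of_integral_normGrad_rpow_eq_zero hc hp hq hu hA fun t ht =>
      DNE.integral_normGrad_rpow_eq_zero hc hp hq hu hA (Or.inl hδ) ht
  · have h0 := fun (t : ℝ) (ht : t < 0) =>
      DNE.integral_normGrad_rpow_eq_zero hc hp hq hu hA (Or.inr ⟨hδ, hI⟩) (t := t) ht
    refine ⟨fun t ht => ?_, DNE.isConstant_of_integral_normGrad_rpow_eq_zero hc hp hq hu hA h0⟩
    rw [DNE.frequency, DNE.energyD, h0 t ht, neg_zero, zero_div]
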